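/- **Setting.** All spaces are complex Hilbert spaces. A (linear discrete-time) system $\tau=\{T;\mathfrak N,\mathfrak N,\mathfrak H\}$ with input and output space $\mathfrak N$ and state space $\mathfrak H$ is given by a bounded block operator $$T=\begin{pmatrix}D&C\\ B&A\end{pmatrix}:\mathfrak N\oplus\mathfrak H\to\mathfrak N\oplus\mathfrak H ,$$ and its transfer function is $D+\lambda C(I-\lambda A)^{-1}B$. The system is *minimal* if both $\operatorname{span}\{A^nB\mathfrak N:n\ge0\}$ and $\operatorname{span}\{A^{*n}C^*\mathfrak N:n\ge0\}$ are dense in $\mathfrak H$. It is *passive*, *isometric* or *co-isometric* if $T$ is, respectively, a contraction, an isometry, or such that $T^*$ is an isometry. It is a *$pqs$-system* if it is passive and $\operatorname{ran}(T-T^*)\subset\mathfrak N$ (equivalently, it is passive, $A=A^*$ and $C=B^*$). Two systems $\tau_1,\tau_2$ are *unitarily similar* if there is a unitary $U:\mathfrak H_1\to\mathfrak H_2$ with $A_2=UA_1U^*$, $B_2=UB_1$, $C_2=C_1U^*$, $D_2=D_1$. A *realization* of a function $\Theta$ on the unit disk $\mathbb D$ is a system whose transfer function is $\Theta$. The class $\mathbf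 S^{qs}(\mathfrak N)$ consists of the functions $\Theta$ on $\mathbb D$ with values bounded operators on $\mathfrak N$ such that: (S1) $W=\Theta-\Theta(0)$ has a holomorphic continuation to $\mathbb C\setminus\{(-\infty,-1]\cup[1,\infty)\}$ that is a Herglotz–Nevanlinna function ($W(\bar\lambda)=W(\lambda)^*$, and $\operatorname{Im}W(\lambda)\ge0$ for $\operatorname{Im}\lambda>0$); (S2) the nontangential strong limits $W(\pm1)$ exist and $W(1)-W(-1)\le 2I$; (S3) with $R=I-\tfrac12(W(1)-W(-1))$ one has $\Theta(0)=-\tfrac12(W(1)+W(-1))+R^{1/2}XR^{1/2}$ for some contraction $X$ on $\overline{\operatorname{ran}}\,R$. The function $\Theta$ is *inner* (*co-inner*) if for almost every $\xi$ on the unit circle its nontangential strong limit $\Theta(\xi)$ exists and satisfies $\Theta(\xi)^*\Theta(\xi)=I$ ($\Theta(\xi)\Theta(\xi)^*=I$). **Theorem.** Let $\Theta\in\mathbf S^{qs}(\mathfrak N)$. 1. Let $$\dot\tau=\left\{\begin{pmatrix}\dot D&\dot C\\ \dot B&\dot A\end{pmatrix};\mathfrak N,\mathfrak N,\mathfrak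 H\right\}$$ be a minimal, not necessarily passive, system whose transfer function coincides with $\Theta$ in some neighborhood of zero. Then there exists a (possibly unbounded) positive selfadjoint operator $S$ in $\mathfrak H$ ($(Sf,f)>0$ for $0\ne f\in\operatorname{dom}S$), with positive selfadjoint square root $S^{1/2}$, such that: * $\dot A\operatorname{dom}S\subset\operatorname{dom}S$ and $\dot A^*Sf=S\dot Af$ for all $f\in\operatorname{dom}S$; moreover $\dot B\mathfrak N\subset\operatorname{dom}S$ and $\dot C^*=S\dot B$; * $\dot C S^{-1/2}$ and $S^{1/2}\dot A S^{-1/2}$ are defined on $\operatorname{dom}S^{-1/2}=\operatorname{ran}S^{1/2}$ and $S^{1/2}\dot B$ on $\mathfrak N$, these operators extend to bounded operators, and with these extensions $$\widehat\tau_0=\left\{\begin{pmatrix}\dot D&\dot CS^{-1/2}\\ S^{1/2}\dot B&S^{1/2}\dot AS^{-1/2}\end{pmatrix};\mathfrak N,\mathfrak N,\mathfrak H\right\}$$ is a minimal $pqs$-system with transfer function $\Theta$ on $\mathbb D$; * $\dot\tau$ becomes a $pqs$-system with respect to the inner product $(\varphi,\psi)_{S^{1/2}}=(S^{1/2}\varphi,S^{1/2}\psi)_{\mathfrak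 H}$ on $\operatorname{dom}S^{1/2}$: $\operatorname{dom}S^{1/2}$ is invariant under $\dot A$ and contains $\dot B\mathfrak N$, and $\dot A$, $\dot B$, $\dot C$, $\dot D$ (with $\dot A$, $\dot C$ restricted to $\operatorname{dom}S^{1/2}$) extend by continuity to a $pqs$-system whose state space is the completion of $\operatorname{dom}S^{1/2}$ with respect to $(\cdot,\cdot)_{S^{1/2}}$. 2. If $\Theta$ is inner, then every minimal passive realization of $\Theta$ is an isometric $pqs$-system, and any two of them are unitarily similar. 3. If $\Theta$ is co-inner, then every minimal passive realization of $\Theta$ is a co-isometric $pqs$-system, and any two of them are unitarily similar. -/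

import Mathlib

open Filter Topology MeasureTheory

universe u v w

noncomputable section

/-! ### Linear discrete-time systems -/

/-- A linear discrete-time system `{T; 𝔐, 𝔑, ℌ}` with input space `M`, output space `N` and state
space `H`, given by the bounded entries of the block operator `T = [[D, C], [B, A]]`. -/
structure DTSystem (M : Type u) (N : Type v) (H : Type w)
    [NormedAddCommGroup M] [InnerProductSpace ℂ M]
    [NormedAddCommGroup N] [InnerProductSpace ℂ N]
    [NormedAddCommGroup H] [InnerProductSpace ℂ H] where
  /-- main operator -/
  A : H →L[ℂ] H
  /-- control operator -/
  B : M →L[ℂ] H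
  /-- observation operator -/
  C : H →L[ℂ] N
  /-- feedthrough operator -/
  D : M →L[ℂ] N

namespace DTSystem

section general

variable {M : Type*} {N : Type*} {H : Type*}
  [NormedAddCommGroup M] [InnerProductSpace ℂ M]
  [NormedAddCommGroup N] [InnerProductSpace ℂ N]
  [NormedAddCommGroup H] [InnerProductSpace ℂ H]

/-- The block operator `T = [[D, C], [B, A]] : M ⊕ H → N ⊕ H` on the orthogonal sums. -/
def blockOp (τ : DTSystem M N H) : WithLp 2 (M × H) →L[ℂ] WithLp 2 (N × H) :=
  (WithLp.prodContinuousLinearEquiv 2 ℂ N H).symm.toContinuousLinearMap ∘L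
    ((τ.D.coprod τ.C).prod (τ.B.coprod τ.A)) ∘L
      (WithLp.prodContinuousLinearEquiv 2 ℂ M H).toContinuousLinearMap

/-- The transfer function `Θ(λ) = D + λ C (I - λ A)⁻¹ B`; it is used only for those `λ` for which
`I - λ A` is boundedly invertible (near `0`, and on the unit disk if `A` is a contraction). -/
def transferFunction (τ : DTSystem M N H) (z : ℂ) : M →L[ℂ] N :=
  τ.D + z • (τ.C ∘L Ring.inverse (1 - z • τ.A) ∘L τ.B)

/-- The vectors `Aⁿ B u` span a dense subspace of the state space. -/
def IsControllable (τ : DTSystem M N H) : Prop :=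
  (Submodule.span ℂ {x : H | ∃ (n : ℕ) (a : M), x = (τ.A ^ n) (τ.B a)}).topologicalClosure = ⊤

/-- `T` is a contraction. -/
def IsPassive (τ : DTSystem M N H) : Prop := ‖τ.blockOp‖ ≤ 1

/-- `T` is an isometry (that is, `T* T = I`). -/
def IsIsometric (τ : DTSystem M N H) : Prop := Isometry τ.blockOp

end general

section complete

variable {M : Type*} {N : Type*} {H : Type*}
  [NormedAddCommGroup M] [InnerProductSpace ℂ M] [CompleteSpace M]
  [NormedAddCommGroup N] [InnerProductSpace ℂ N] [CompleteSpace N]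
  [NormedAddCommGroup H] [InnerProductSpace ℂ H] [CompleteSpace H]

/-- The vectors `A*ⁿ C* y` span a dense subspace of the state space. -/
def IsObservable (τ : DTSystem M N H) : Prop :=
  (Submodule.span ℂ {x : H | ∃ (n : ℕ) (y : N),
    x = ((ContinuousLinearMap.adjoint τ.A) ^ n)
      (ContinuousLinearMap.adjoint τ.C y)}).topologicalClosure = ⊤

/-- Controllable and observable. -/
def IsMinimal (τ : DTSystem M N H) : Prop := τ.IsControllable ∧ τ.IsObservable

/-- `T*` is an isometry (that is, `T T* = I`). -/
def IsCoisometric (τ : DTSystem M N H) : Prop :=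
  Isometry (ContinuousLinearMap.adjoint τ.blockOp)

/-- Passive quasi-selfadjoint system: `T` is a contraction in `N ⊕ H` and `ran (T - T*) ⊆ N`. -/
def IsPqs (τ : DTSystem N N H) : Prop :=
  τ.IsPassive ∧
    ∀ x : WithLp 2 (N × H), ((τ.blockOp - ContinuousLinearMap.adjoint τ.blockOp) x).snd = 0

end complete

/-- Unitary similarity: `A₂ = U A₁ U*`, `B₂ = U B₁`, `C₂ = C₁ U*`, `D₂ = D₁` with `U` unitary. -/
def UnitarilySimilar {M : Type*} {N : Type*} {H₁ : Type*} {H₂ : Type*}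
    [NormedAddCommGroup M] [InnerProductSpace ℂ M]
    [NormedAddCommGroup N] [InnerProductSpace ℂ N]
    [NormedAddCommGroup H₁] [InnerProductSpace ℂ H₁]
    [NormedAddCommGroup H₂] [InnerProductSpace ℂ H₂]
    (τ₁ : DTSystem M N H₁) (τ₂ : DTSystem M N H₂) : Prop :=
  ∃ U : H₁ ≃ₗᵢ[ℂ] H₂,
    (∀ x : H₂, τ₂.A x = U (τ₁.A (U.symm x))) ∧
    (∀ a : M, τ₂.B a = U (τ₁.B a)) ∧
    (∀ x : H₂, τ₂.C x = τ₁.C (U.symm x)) ∧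
    τ₂.D = τ₁.D

end DTSystem

/-! ### Operator functions on the unit disk -/

section functions

variable {N : Type*} [NormedAddCommGroup N] [InnerProductSpace ℂ N]

/-- `L` is the nontangential strong limit at the point `ξ` of the unit circle of the function `F`
on the unit disk: `F(z) a → L a` for each vector `a`, as `z → ξ` within any Stolz region
`{z : |z| < 1, |ξ - z| < K (1 - |z|)}` (`Complex.stolzSet K` is this region for `ξ = 1`). -/
def HasNontangentialLimit (F : ℂ → N →L[ℂ] N) (ξ : ℂ) (L : N →L[ℂ] N) : Prop :=
  ∀ (K : ℝ) (a : N),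
    Tendsto (fun z : ℂ => F (ξ * z) a) (𝓝[Complex.stolzSet K] 1) (𝓝 (L a))

/-- The domain `Ext {(-∞, -1] ∪ [1, ∞)}`: the plane without these two real half-lines. -/
def slitDomain : Set ℂ := {z : ℂ | ¬ (z.im = 0 ∧ 1 ≤ |z.re|)}

variable [CompleteSpace N]

/-- `F` is a Herglotz-Nevanlinna function on `Ext {(-∞, -1] ∪ [1, ∞)}`: it is holomorphic there,
`F(conj z) = F(z)*`, and `Im F(z) ≥ 0` for `Im z > 0`. -/
def IsHerglotzNevanlinnaOnSlit (F : ℂ → N →L[ℂ] N) : Prop :=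
  DifferentiableOn ℂ F slitDomain ∧
  (∀ z ∈ slitDomain, F (starRingEnd ℂ z) = ContinuousLinearMap.adjoint (F z)) ∧
  ∀ z : ℂ, 0 < z.im → ∀ a : N, 0 ≤ (inner ℂ a (F z a)).im

/-- The operator ball `{S + R^{1/2} X R^{1/2} : X a contraction in the closure of ran R}`. -/
def operatorBall (S R : N →L[ℂ] N) : Set (N →L[ℂ] N) :=
  {Q | ∃ X : R.range.topologicalClosure →L[ℂ] R.range.topologicalClosure, ‖X‖ ≤ 1 ∧
    Q = S + CFC.sqrt R ∘L R.range.topologicalClosure.subtypeL ∘L X ∘L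
      R.range.topologicalClosure.orthogonalProjectionOnto ∘L CFC.sqrt R}

/-- The class `𝐒^qs(N)`; only the values of `Θ` on the open unit disk matter. Here `W` is the
holomorphic continuation of `Θ - Θ(0)` and `W₁`, `W₂` are the strong limit values `W(1)`, `W(-1)`. -/
def IsSqs (Θ : ℂ → N →L[ℂ] N) : Prop :=
  ∃ (W : ℂ → N →L[ℂ] N) (W₁ W₂ : N →L[ℂ] N),
    (∀ z ∈ Metric.ball (0 : ℂ) 1, W z = Θ z - Θ 0) ∧
    IsHerglotzNevanlinnaOnSlit W ∧
    HasNontangentialLimit W 1 W₁ ∧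
    HasNontangentialLimit W (-1) W₂ ∧
    W₁ - W₂ ≤ (2 : ℂ) • (1 : N →L[ℂ] N) ∧
    Θ 0 ∈ operatorBall (-((2 : ℂ)⁻¹ • (W₁ + W₂))) (1 - (2 : ℂ)⁻¹ • (W₁ - W₂))

/-- `Θ` is inner: its nontangential strong boundary values satisfy `Θ(ξ)* Θ(ξ) = I` for almost all
`ξ = e^{it}` on the unit circle. -/
def IsInnerFunction (Θ : ℂ → N →L[ℂ] N) : Prop :=
  ∀ᵐ t : ℝ, ∃ L : N →L[ℂ] N, HasNontangentialLimit Θ (Complex.exp (t * Complex.I)) L ∧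
    ContinuousLinearMap.adjoint L ∘L L = 1

/-- `Θ` is co-inner: `Θ(ξ) Θ(ξ)* = I` for almost all `ξ` on the unit circle. -/
def IsCoinnerFunction (Θ : ℂ → N →L[ℂ] N) : Prop :=
  ∀ᵐ t : ℝ, ∃ L : N →L[ℂ] N, HasNontangentialLimit Θ (Complex.exp (t * Complex.I)) L ∧
    L ∘L ContinuousLinearMap.adjoint L = 1

end functions

/-! ### Unbounded positive selfadjoint operators -/

section unbounded

variable {H : Type w} [NormedAddCommGroup H] [InnerProductSpace ℂ H]

/-- `S` is a (densely defined, possibly unbounded) selfadjoint operator with `(S x, x) > 0` for all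
nonzero `x ∈ dom S`. -/
def IsPositiveSelfAdjoint [CompleteSpace H] (S : H →ₗ.[ℂ] H) : Prop :=
  IsSelfAdjoint S ∧ ∀ x : S.domain, x ≠ 0 → 0 < (inner ℂ (S x) (x : H)).re

/-- `R = S^{1/2}`: `R` is positive selfadjoint and `R² = S`, including equality of domains. -/
def IsPositiveSqrt [CompleteSpace H] (R S : H →ₗ.[ℂ] H) : Prop :=
  IsPositiveSelfAdjoint R ∧
    ∀ x y : H, (x, y) ∈ S.graph ↔ ∃ z : H, (x, z) ∈ R.graph ∧ (z, y) ∈ R.graph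

/-- The space `dom R`, which is going to carry the inner product `(f, g)_R = (R f, R g)`. -/
def Renormed (R : H →ₗ.[ℂ] H) : Type w := R.domain

namespace Renormed

/-- A vector of `dom R`, seen in the renormed space. -/
def mk (R : H →ₗ.[ℂ] H) (x : R.domain) : Renormed R := x

instance (R : H →ₗ.[ℂ] H) : AddCommGroup (Renormed R) :=
  inferInstanceAs (AddCommGroup R.domain)

instance (R : H →ₗ.[ℂ] H) : Module ℂ (Renormed R) :=
  inferInstanceAs (Module ℂ R.domain)

/-- The map `f ↦ R f` on the renormed space. -/
def toH (R : H →ₗ.[ℂ] H) : Renormed R →ₗ[ℂ] H := R.toFun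

instance (R : H →ₗ.[ℂ] H) : SeminormedAddCommGroup (Renormed R) :=
  SeminormedAddCommGroup.induced (Renormed R) H (toH R)

instance (R : H →ₗ.[ℂ] H) : InnerProductSpace ℂ (Renormed R) where
  norm_smul_le c x := by
    change ‖toH R (c • x)‖ ≤ ‖c‖ * ‖toH R x‖
    rw [map_smul, norm_smul]
  inner x y := inner ℂ (toH R x) (toH R y)
  norm_sq_eq_re_inner x := norm_sq_eq_re_inner (𝕜 := ℂ) (toH R x)
  conj_inner_symm x y := inner_conj_symm (toH R x) (toH R y)
  add_left x y z := by
    rw [map_add, inner_add_left]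
  smul_left x y c := by
    rw [map_smul, inner_smul_left]

/-- The Hilbert space completion of `dom R` with respect to `(f, g)_R = (R f, R g)`. -/
abbrev Compl (R : H →ₗ.[ℂ] H) : Type w := UniformSpace.Completion (Renormed R)

/-- The canonical map of `dom R` into the completion. -/
def toCompl (R : H →ₗ.[ℂ] H) (x : R.domain) : Compl R :=
  UniformSpace.Completion.coe' (mk R x)

end Renormed

end unbounded

end

/-! One minimal pqs-realization of Θ is constructed, and every assertion follows by comparing a
given realization with this model.

The model (`IsSqs.exists_minimal_pqs`). Write W = ∑ wₙλⁿ. The Nevanlinna property should make the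
w_{n+1} the moments of a positive operator measure on [-1,1]. No integral representation is needed:
λ = 2ζ/(1+ζ²) maps the disk into the slit domain, keeps the sign of the imaginary part, and
satisfies 1/λ = cos t at ζ = e^{it}. Hence 2πi w_{n+1} is the limit, as r → 1, of the integrals of
cosⁿt · sin t · W(λ(re^{it})) over [0,2π], and the Hausdorff positivity conditions follow
(`IsHerglotzNevanlinnaOnSlit.hankelForm_nonneg`). The GNS space of the resulting Hankel form carries
a selfadjoint contraction A with w_{n+1} = B*AⁿB. Put D_A = (I-A²)^{1/2}. By (S2), B = D_A L with
‖L‖ ≤ 1, and then W(±1) = L*(A ± I)L. So (S3) says that D = -L*AL + D_L X D_L, where D_L =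
(I-L*L)^{1/2}, and for such D the block operator is a contraction (`isPassive_of_defect`).

Part 1. Since both systems are minimal, the closure of ∑ȦⁿḂaₙ ↦ ∑AⁿBaₙ is the graph of an injective
operator Z with dense domain and range, which intertwines the two systems. Take S = Z*Z and Z = U
S^{1/2}. Because the model has A = A* and C = B*, one gets Ȧ*S = SȦ and Ċ* = SḂ, while U carries the
model to the renormalized system. Unbounded functional calculus is avoided by parametrizing the
graph: Z sends cz to U(sz), with commuting positive c, s and c² + s² = 1 (`exists_cos_sin`), so that
S^{1/2} = s/c and S = s²/c².

Parts 2 and 3. For a passive system with block operator T, the squared norm of (I-T*T)(a,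
λ(I-λA)⁻¹Ba) is at most ‖a‖² - ‖Θ(λ)a‖². If Θ is inner, this bounded analytic function has radial
limits zero almost everywhere, hence vanishes; controllability then gives T*T = I
(`IsPassive.isIsometric`). The Gram matrix of the vectors AⁿBa of an isometric system is determined
by Θ, so controllable isometric realizations are unitarily similar to each other and to the model,
which makes them pqs. The co-inner case is dual. -/

noncomputable section

/-! ### Dense ranges and uniqueness of power series -/

section general

variable {E : Type*} [AddCommGroup E] [Module ℂ E]
  {H : Type*} [NormedAddCommGroup H] [InnerProductSpace ℂ H] [CompleteSpace H]
  {K : Type*} [NormedAddCommGroup K] [InnerProductSpace ℂ K] [CompleteSpace K]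

/-- Two linear maps with dense ranges and equal norms differ by a unitary. -/
theorem exists_linearIsometryEquiv_of_norm_eq (f : E →ₗ[ℂ] H) (g : E →ₗ[ℂ] K)
    (hf : DenseRange f) (hg : DenseRange g) (hfg : ∀ x, ‖f x‖ = ‖g x‖) :
    ∃ U : H ≃ₗᵢ[ℂ] K, ∀ x, U (f x) = g x :=
  ⟨(LinearEquiv.refl ℂ E).extendOfIsometry f g hf hg (fun x => (hfg x).symm),
    fun x => LinearEquiv.extendOfIsometry_eq _ _ _ hf hg _ x⟩

theorem denseRange_of_topologicalClosure_eq_top {H : Type*} [NormedAddCommGroup H]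
    [InnerProductSpace ℂ H] {f : E →ₗ[ℂ] H}
    (h : (LinearMap.range f).topologicalClosure = ⊤) : DenseRange f := by
  have := Submodule.dense_iff_topologicalClosure_eq_top.2 h
  rwa [LinearMap.coe_range] at this

theorem denseRange_of_isSelfAdjoint_of_injective {c : H →L[ℂ] H} (hc : IsSelfAdjoint c)
    (hi : Function.Injective c) : DenseRange c := by
  have h1 : (c.toLinearMap.range).topologicalClosure = ⊤ := by
    rw [Submodule.topologicalClosure_eq_top_iff, ContinuousLinearMap.orthogonal_range,
      hc.adjoint_eq]
    exact LinearMap.ker_eq_bot.2 hi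
  exact denseRange_of_topologicalClosure_eq_top h1

theorem denseRange_of_adjoint_injective {c : H →L[ℂ] K}
    (hi : Function.Injective (ContinuousLinearMap.adjoint c)) : DenseRange c := by
  have h1 : (c.toLinearMap.range).topologicalClosure = ⊤ := by
    rw [Submodule.topologicalClosure_eq_top_iff, ContinuousLinearMap.orthogonal_range]
    exact LinearMap.ker_eq_bot.2 hi
  exact denseRange_of_topologicalClosure_eq_top h1

theorem hasSum_pow_smul_unique {F : Type*} [NormedAddCommGroup F] [NormedSpace ℂ F]
    {a b : ℕ → F} {f : ℂ → F}
    (ha : ∀ᶠ z in 𝓝 (0 : ℂ), HasSum (fun n => z ^ n • a n) (f z))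
    (hb : ∀ᶠ z in 𝓝 (0 : ℂ), HasSum (fun n => z ^ n • b n) (f z)) : a = b := by
  have key : ∀ c : ℕ → F, (∀ᶠ z in 𝓝 (0 : ℂ), HasSum (fun n => z ^ n • c n) (f z)) →
      HasFPowerSeriesAt f
        (fun n => ContinuousMultilinearMap.mkPiRing ℂ (Fin n) (c n) :
          FormalMultilinearSeries ℂ ℂ F) 0 := by
    intro c hc
    refine hasFPowerSeriesAt_iff.2 ?_
    simpa [FormalMultilinearSeries.coeff] using hc
  have h := (key a ha).eq_formalMultilinearSeries (key b hb)
  funext n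
  have h2 := congrArg (fun p => FormalMultilinearSeries.coeff p n) h
  simpa [FormalMultilinearSeries.coeff] using h2

end general

/-! ### Block operators, Taylor coefficients, duality and unitary similarity -/

namespace DTSystem

section algebra

variable {M : Type*} {N : Type*} {H : Type*}
  [NormedAddCommGroup M] [InnerProductSpace ℂ M]
  [NormedAddCommGroup N] [InnerProductSpace ℂ N]
  [NormedAddCommGroup H] [InnerProductSpace ℂ H]

@[simp] theorem blockOp_fst (τ : DTSystem M N H) (x : WithLp 2 (M × H)) :
    (τ.blockOp x).fst = τ.D x.fst + τ.C x.snd := by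
  simp [blockOp]

@[simp] theorem blockOp_snd (τ : DTSystem M N H) (x : WithLp 2 (M × H)) :
    (τ.blockOp x).snd = τ.B x.fst + τ.A x.snd := by
  simp [blockOp]

theorem isPassive_iff (τ : DTSystem M N H) :
    τ.IsPassive ↔ ∀ a x, ‖τ.D a + τ.C x‖ ^ 2 + ‖τ.B a + τ.A x‖ ^ 2 ≤ ‖a‖ ^ 2 + ‖x‖ ^ 2 := by
  constructor
  · intro h a x
    have h1 := (τ.blockOp.le_opNorm (WithLp.toLp 2 (a, x))).trans
      (mul_le_mul_of_nonneg_right h (norm_nonneg _))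
    have h2 := pow_le_pow_left₀ (norm_nonneg _) (h1.trans_eq (one_mul _)) 2
    simpa [WithLp.prod_norm_sq_eq_of_L2] using h2
  · intro h
    refine ContinuousLinearMap.opNorm_le_bound _ zero_le_one fun x => ?_
    rw [one_mul]
    refine le_of_sq_le_sq ?_ (norm_nonneg _)
    rw [WithLp.prod_norm_sq_eq_of_L2, WithLp.prod_norm_sq_eq_of_L2]
    simpa using h x.fst x.snd

theorem IsPassive.norm_A_le {τ : DTSystem M N H} (h : τ.IsPassive) : ‖τ.A‖ ≤ 1 := by
  refine ContinuousLinearMap.opNorm_le_bound _ zero_le_one fun x => ?_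
  have := τ.isPassive_iff.1 h 0 x
  simp only [map_zero, zero_add, norm_zero] at this
  rw [one_mul]
  refine le_of_sq_le_sq ?_ (norm_nonneg _)
  nlinarith [sq_nonneg ‖τ.C x‖]

/-- The Taylor coefficients `D, C B, C A B, C A² B, …` of the transfer function. -/
def impulseResponse (τ : DTSystem M N H) : ℕ → M →L[ℂ] N
  | 0 => τ.D
  | n + 1 => τ.C ∘L (τ.A ^ n) ∘L τ.B

variable [CompleteSpace H]

theorem hasSum_transferFunction (τ : DTSystem M N H) {z : ℂ} (hz : ‖z • τ.A‖ < 1) :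
    HasSum (fun n => z ^ n • τ.impulseResponse n) (τ.transferFunction z) := by
  have h1 : HasSum (fun n : ℕ => (z • τ.A) ^ n) (Ring.inverse (1 - z • τ.A)) := by
    rw [NormedRing.inverse_one_sub _ hz]
    exact (summable_geometric_of_norm_lt_one hz).hasSum
  let Φ : (H →L[ℂ] H) →L[ℂ] (M →L[ℂ] N) :=
    (ContinuousLinearMap.compL ℂ M H N τ.C) ∘L ((ContinuousLinearMap.compL ℂ M H H).flip τ.B)
  have h2 := ((Φ.hasSum h1).const_smul z)
  have h3 : HasSum (fun n => z ^ (n + 1) • τ.impulseResponse (n + 1))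
      (z • (τ.C ∘L Ring.inverse (1 - z • τ.A) ∘L τ.B)) := by
    convert h2 using 2 with n
    ext a
    · simp [Φ, impulseResponse, smul_pow, pow_succ', mul_smul]
    · rfl
  rw [transferFunction, add_comm]
  have h4 := (hasSum_nat_add_iff (f := fun n => z ^ n • τ.impulseResponse n) 1).1 h3
  simpa [impulseResponse] using h4

theorem eventually_hasSum_transferFunction (τ : DTSystem M N H) :
    ∀ᶠ z in 𝓝 (0 : ℂ), HasSum (fun n => z ^ n • τ.impulseResponse n) (τ.transferFunction z) := by
  have h : Tendsto (fun z : ℂ => ‖z • τ.A‖) (𝓝 0) (𝓝 0) := by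
    have : Continuous (fun z : ℂ => ‖z • τ.A‖) := by fun_prop
    simpa using this.tendsto 0
  filter_upwards [h.eventually (gt_mem_nhds one_pos)] with z hz
  exact τ.hasSum_transferFunction hz

theorem IsPassive.hasSum_transferFunction {τ : DTSystem M N H} (h : τ.IsPassive) {z : ℂ}
    (hz : ‖z‖ < 1) :
    HasSum (fun n => z ^ n • τ.impulseResponse n) (τ.transferFunction z) := by
  refine τ.hasSum_transferFunction ?_
  rw [norm_smul]
  nlinarith [h.norm_A_le, norm_nonneg z, norm_nonneg τ.A]

/-- Systems are compared through their Taylor coefficients from here on, so agreement near zero is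
all that is ever needed. -/
theorem impulseResponse_eq {H' : Type*} [NormedAddCommGroup H'] [InnerProductSpace ℂ H']
    [CompleteSpace H'] {τ : DTSystem M N H} {τ' : DTSystem M N H'}
    (h : ∀ᶠ z in 𝓝 (0 : ℂ), τ.transferFunction z = τ'.transferFunction z) :
    τ.impulseResponse = τ'.impulseResponse := by
  refine hasSum_pow_smul_unique τ.eventually_hasSum_transferFunction ?_
  filter_upwards [h, τ'.eventually_hasSum_transferFunction] with z h1 h2
  rwa [h1]

end algebra

section adjoint

variable {M : Type*} {N : Type*} {H : Type*}
  [NormedAddCommGroup M] [InnerProductSpace ℂ M] [CompleteSpace M]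
  [NormedAddCommGroup N] [InnerProductSpace ℂ N] [CompleteSpace N]
  [NormedAddCommGroup H] [InnerProductSpace ℂ H] [CompleteSpace H]

/-- The dual system, with block operator `T*`. -/
def dual (τ : DTSystem M N H) : DTSystem N M H where
  A := ContinuousLinearMap.adjoint τ.A
  B := ContinuousLinearMap.adjoint τ.C
  C := ContinuousLinearMap.adjoint τ.B
  D := ContinuousLinearMap.adjoint τ.D

theorem adjoint_blockOp (τ : DTSystem M N H) :
    ContinuousLinearMap.adjoint τ.blockOp = τ.dual.blockOp := by
  refine Eq.symm ((ContinuousLinearMap.eq_adjoint_iff _ _).2 fun x y => ?_)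
  simp only [WithLp.prod_inner_apply]
  change inner ℂ (τ.dual.blockOp x).fst y.fst + inner ℂ (τ.dual.blockOp x).snd y.snd =
    inner ℂ x.fst (τ.blockOp y).fst + inner ℂ x.snd (τ.blockOp y).snd
  simp only [blockOp_fst, blockOp_snd, dual, inner_add_left, inner_add_right,
    ContinuousLinearMap.adjoint_inner_left]
  ring

theorem isPqs_iff (τ : DTSystem N N H) :
    τ.IsPqs ↔ τ.IsPassive ∧ ContinuousLinearMap.adjoint τ.A = τ.A ∧
      ContinuousLinearMap.adjoint τ.C = τ.B := by
  rw [IsPqs, adjoint_blockOp]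
  refine and_congr_right fun _ => ⟨fun h => ⟨?_, ?_⟩, fun h x => ?_⟩
  · ext x
    have := h (WithLp.toLp 2 (0, x))
    simp [dual] at this
    exact (sub_eq_zero.1 this).symm
  · ext a
    have := h (WithLp.toLp 2 (a, 0))
    simp [dual] at this
    exact (sub_eq_zero.1 this).symm
  · simp [dual, h.1, h.2]

theorem dual_dual (τ : DTSystem M N H) : τ.dual.dual = τ := by
  simp [dual]

theorem IsMinimal.dual {τ : DTSystem M N H} (h : τ.IsMinimal) : τ.dual.IsMinimal := by
  refine ⟨h.2, ?_⟩
  have := h.1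
  simpa [IsObservable, IsControllable, DTSystem.dual] using this

theorem IsPassive.dual {τ : DTSystem M N H} (h : τ.IsPassive) : τ.dual.IsPassive := by
  rw [IsPassive, ← adjoint_blockOp, LinearIsometryEquiv.norm_map]
  exact h

theorem isCoisometric_iff (τ : DTSystem M N H) : τ.IsCoisometric ↔ τ.dual.IsIsometric := by
  rw [IsCoisometric, adjoint_blockOp, IsIsometric]

theorem adjoint_pow_apply_inner (A : H →L[ℂ] H) (n : ℕ) (x y : H) :
    inner ℂ ((ContinuousLinearMap.adjoint A ^ n) x) y = inner ℂ x ((A ^ n) y) := by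
  have : ContinuousLinearMap.adjoint A ^ n = ContinuousLinearMap.adjoint (A ^ n) := by
    rw [← ContinuousLinearMap.star_eq_adjoint, ← ContinuousLinearMap.star_eq_adjoint, star_pow]
  rw [this, ContinuousLinearMap.adjoint_inner_left]

theorem dual_impulseResponse (τ : DTSystem M N H) (n : ℕ) :
    τ.dual.impulseResponse n = ContinuousLinearMap.adjoint (τ.impulseResponse n) := by
  cases n with
  | zero => rfl
  | succ n =>
    refine (ContinuousLinearMap.eq_adjoint_iff _ _).2 fun x y => ?_
    simp only [impulseResponse, dual, ContinuousLinearMap.comp_apply,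
      ContinuousLinearMap.adjoint_inner_left, adjoint_pow_apply_inner]

end adjoint

section reachable

variable {M : Type*} {N : Type*} {H : Type*}
  [NormedAddCommGroup M] [InnerProductSpace ℂ M]
  [NormedAddCommGroup N] [InnerProductSpace ℂ N]
  [NormedAddCommGroup H] [InnerProductSpace ℂ H]

/-- The state `∑ Aⁿ B (u n)` reached by the finite input sequence `u`. -/
def reach (τ : DTSystem M N H) : (ℕ →₀ M) →ₗ[ℂ] H :=
  Finsupp.lsum ℂ fun n => ((τ.A ^ n) ∘L τ.B).toLinearMap

@[simp] theorem reach_single (τ : DTSystem M N H) (n : ℕ) (a : M) :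
    τ.reach (Finsupp.single n a) = (τ.A ^ n) (τ.B a) := by
  rw [reach, Finsupp.lsum_single]
  rfl

theorem range_reach (τ : DTSystem M N H) : LinearMap.range τ.reach =
    Submodule.span ℂ {x : H | ∃ (n : ℕ) (a : M), x = (τ.A ^ n) (τ.B a)} := by
  apply le_antisymm
  · rintro _ ⟨u, rfl⟩
    induction u using Finsupp.induction_linear with
    | zero => simp
    | add f g hf hg => rw [map_add]; exact add_mem hf hg
    | single n a => exact Submodule.subset_span ⟨n, a, by simp⟩
  · rw [Submodule.span_le]
    rintro _ ⟨n, a, rfl⟩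
    exact ⟨Finsupp.single n a, by simp⟩

theorem isControllable_iff (τ : DTSystem M N H) : τ.IsControllable ↔ DenseRange τ.reach := by
  rw [IsControllable, ← range_reach, ← Submodule.dense_iff_topologicalClosure_eq_top,
    LinearMap.coe_range, DenseRange]

/-- The right shift of input sequences. -/
def inputShift (M : Type*) [AddCommGroup M] [Module ℂ M] : (ℕ →₀ M) →ₗ[ℂ] (ℕ →₀ M) :=
  Finsupp.lmapDomain M ℂ Nat.succ

@[simp] theorem inputShift_single (n : ℕ) (a : M) :
    inputShift M (Finsupp.single n a) = Finsupp.single (n + 1) a := by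
  simp [inputShift]

theorem reach_inputShift (τ : DTSystem M N H) (u : ℕ →₀ M) :
    τ.reach (inputShift M u) = τ.A (τ.reach u) := by
  induction u using Finsupp.induction_linear with
  | zero => simp
  | add f g hf hg => simp [hf, hg]
  | single n a => simp [pow_succ']

end reachable

section similar

variable {M : Type*} {N : Type*} {H₁ : Type*} {H₂ : Type*}
  [NormedAddCommGroup M] [InnerProductSpace ℂ M]
  [NormedAddCommGroup N] [InnerProductSpace ℂ N]
  [NormedAddCommGroup H₁] [InnerProductSpace ℂ H₁]
  [NormedAddCommGroup H₂] [InnerProductSpace ℂ H₂]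

/-- The system carried by a unitary operator to another state space. -/
def transport (τ : DTSystem M N H₁) (U : H₁ ≃ₗᵢ[ℂ] H₂) : DTSystem M N H₂ where
  A := U.toContinuousLinearEquiv.toContinuousLinearMap ∘L τ.A ∘L
    U.symm.toContinuousLinearEquiv.toContinuousLinearMap
  B := U.toContinuousLinearEquiv.toContinuousLinearMap ∘L τ.B
  C := τ.C ∘L U.symm.toContinuousLinearEquiv.toContinuousLinearMap
  D := τ.D

theorem unitarilySimilar_transport (τ : DTSystem M N H₁) (U : H₁ ≃ₗᵢ[ℂ] H₂) :
    τ.UnitarilySimilar (τ.transport U) :=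
  ⟨U, fun _ => rfl, fun _ => rfl, fun _ => rfl, rfl⟩

theorem UnitarilySimilar.isPassive {τ₁ : DTSystem M N H₁} {τ₂ : DTSystem M N H₂}
    (h : τ₁.UnitarilySimilar τ₂) (h₁ : τ₁.IsPassive) : τ₂.IsPassive := by
  obtain ⟨U, hA, hB, hC, hD⟩ := h
  rw [isPassive_iff] at h₁ ⊢
  intro a x
  have := h₁ a (U.symm x)
  rwa [hA, hB, hC, hD, ← map_add, U.norm_map, ← U.symm.norm_map x]

theorem UnitarilySimilar.reach_eq {τ₁ : DTSystem M N H₁} {τ₂ : DTSystem M N H₂}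
    {U : H₁ ≃ₗᵢ[ℂ] H₂} (hA : ∀ x, τ₂.A x = U (τ₁.A (U.symm x))) (hB : ∀ a, τ₂.B a = U (τ₁.B a))
    (u : ℕ →₀ M) : τ₂.reach u = U (τ₁.reach u) := by
  induction u using Finsupp.induction_linear with
  | zero => simp
  | add f g hf hg => simp [hf, hg]
  | single n a =>
    simp only [reach_single]
    induction n with
    | zero => simp [hB]
    | succ n ih => simp [pow_succ', ih, hA]

theorem UnitarilySimilar.isControllable {τ₁ : DTSystem M N H₁} {τ₂ : DTSystem M N H₂}
    (h : τ₁.UnitarilySimilar τ₂) (h₁ : τ₁.IsControllable) : τ₂.IsControllable := by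
  obtain ⟨U, hA, hB, hC, hD⟩ := h
  rw [isControllable_iff] at h₁ ⊢
  have : ⇑τ₂.reach = U ∘ τ₁.reach := funext (UnitarilySimilar.reach_eq hA hB)
  rw [this]
  exact U.surjective.denseRange.comp h₁ U.continuous

theorem UnitarilySimilar.impulseResponse_eq {τ₁ : DTSystem M N H₁} {τ₂ : DTSystem M N H₂}
    (h : τ₁.UnitarilySimilar τ₂) : τ₂.impulseResponse = τ₁.impulseResponse := by
  obtain ⟨U, hA, hB, hC, hD⟩ := h
  funext n
  cases n with
  | zero => exact hD
  | succ n =>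
    ext a
    have := UnitarilySimilar.reach_eq hA hB (Finsupp.single n a)
    simp only [reach_single] at this
    simp [impulseResponse, this, hC]

variable [CompleteSpace M] [CompleteSpace N] [CompleteSpace H₁] [CompleteSpace H₂]

theorem UnitarilySimilar.dual {τ₁ : DTSystem M N H₁} {τ₂ : DTSystem M N H₂}
    (h : τ₁.UnitarilySimilar τ₂) : τ₁.dual.UnitarilySimilar τ₂.dual := by
  obtain ⟨U, hA, hB, hC, hD⟩ := h
  have hU : ∀ (y : H₁) (x : H₂), inner ℂ y (U.symm x) = inner ℂ (U y) x := fun y x => by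
    rw [← U.inner_map_map, U.apply_symm_apply]
  have hU' : ∀ (x : H₂) (y : H₁), inner ℂ (U.symm x) y = inner ℂ x (U y) := fun x y => by
    rw [← U.inner_map_map, U.apply_symm_apply]
  refine ⟨U, fun x => ?_, fun a => ?_, fun x => ?_, ?_⟩
  · refine ext_inner_right ℂ fun y => ?_
    simp only [DTSystem.dual, ContinuousLinearMap.adjoint_inner_left, hA, ← hU', ← hU]
  · refine ext_inner_right ℂ fun y => ?_
    simp only [DTSystem.dual]
    rw [ContinuousLinearMap.adjoint_inner_left, hC, ← hU,
      ContinuousLinearMap.adjoint_inner_left]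
  · refine ext_inner_right ℂ fun y => ?_
    simp only [DTSystem.dual]
    rw [ContinuousLinearMap.adjoint_inner_left, hB, ContinuousLinearMap.adjoint_inner_left, hU']
  · simp [DTSystem.dual, hD]

theorem UnitarilySimilar.isMinimal {τ₁ : DTSystem M N H₁} {τ₂ : DTSystem M N H₂}
    (h : τ₁.UnitarilySimilar τ₂) (h₁ : τ₁.IsMinimal) : τ₂.IsMinimal :=
  ⟨h.isControllable h₁.1, h.dual.isControllable h₁.2⟩

theorem UnitarilySimilar.isPqs {τ₁ : DTSystem N N H₁} {τ₂ : DTSystem N N H₂}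
    (h : τ₁.UnitarilySimilar τ₂) (h₁ : τ₁.IsPqs) : τ₂.IsPqs := by
  rw [isPqs_iff] at h₁ ⊢
  obtain ⟨hp, h1, h2⟩ := h₁
  refine ⟨h.isPassive hp, ?_⟩
  obtain ⟨U, hA, hB, hC, hD⟩ := h
  have hU : ∀ (y : H₁) (x : H₂), inner ℂ y (U.symm x) = inner ℂ (U y) x := fun y x => by
    rw [← U.inner_map_map, U.apply_symm_apply]
  refine ⟨?_, ?_⟩
  · refine Eq.symm ((ContinuousLinearMap.eq_adjoint_iff _ _).2 fun x y => ?_)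
    rw [hA, hA, ← hU, ← h1, ContinuousLinearMap.adjoint_inner_left, ← U.inner_map_map,
      U.apply_symm_apply, h1]
  · refine Eq.symm ((ContinuousLinearMap.eq_adjoint_iff _ _).2 fun x y => ?_)
    rw [hB, hC, ← hU, ← h2, ContinuousLinearMap.adjoint_inner_left]

end similar

end DTSystem

/-! ### Power series under the substitution λ = 2ζ/(1+ζ²) -/

section powerSeries

variable {F : Type*} [NormedAddCommGroup F] [NormedSpace ℂ F]

theorem summable_norm_mul_pow_of_hasSum {c : ℕ → F} {z : ℂ} {y : F} {r : ℝ}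
    (h : HasSum (fun n => z ^ n • c n) y) (hr : 0 ≤ r) (hrz : r < ‖z‖) :
    Summable (fun n => r ^ n * ‖c n‖) := by
  obtain ⟨C, hC⟩ := (h.summable.tendsto_atTop_zero.norm.bddAbove_range)
  have hz : 0 < ‖z‖ := hr.trans_lt hrz
  have hC' : ∀ n, ‖z‖ ^ n * ‖c n‖ ≤ C := fun n => by
    have := hC ⟨n, rfl⟩
    simpa [norm_smul] using this
  have hq : r / ‖z‖ < 1 := (div_lt_one hz).2 hrz
  refine Summable.of_nonneg_of_le (fun n => by positivity) (fun n => ?_)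
    ((summable_geometric_of_lt_one (by positivity) hq).mul_left C)
  have : r ^ n * ‖c n‖ = (‖z‖ ^ n * ‖c n‖) * (r / ‖z‖) ^ n := by
    rw [div_pow]; field_simp
  rw [this]
  exact mul_le_mul_of_nonneg_right (hC' n) (by positivity)

/-- The expansion is known off zero only. Filling in the value `c 0` there turns z⁻¹f(z) into a
convergent power series, which is continuous. -/
theorem tendsto_inv_smul_of_hasSum {c : ℕ → F} {f : ℂ → F}
    (h : ∀ᶠ z in 𝓝[≠] (0 : ℂ), HasSum (fun k => z ^ (k + 1) • c k) (f z)) :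
    Tendsto (fun z => z⁻¹ • f z) (𝓝[≠] 0) (𝓝 (c 0)) := by
  classical
  let g : ℂ → F := Function.update (fun z => z⁻¹ • f z) 0 (c 0)
  have hg : HasFPowerSeriesAt g
      (fun n => ContinuousMultilinearMap.mkPiRing ℂ (Fin n) (c n) :
        FormalMultilinearSeries ℂ ℂ F) 0 := by
    refine hasFPowerSeriesAt_iff.2 ?_
    rw [eventually_nhdsWithin_iff] at h
    filter_upwards [h] with z hz
    simp only [FormalMultilinearSeries.coeff, zero_add]
    by_cases h0 : z = 0
    · subst h0
      simp only [g, Function.update_self]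
      convert! hasSum_single (f := fun n => (0 : ℂ) ^ n •
        (ContinuousMultilinearMap.mkPiRing ℂ (Fin n) (c n)) 1) 0 ?_
      · simp
      · intro n hn
        simp [hn]
    · have h1 := (hz h0).const_smul z⁻¹
      simp only [g, Function.update_of_ne h0]
      convert! h1 using 2 with n
      rw [smul_smul, pow_succ]
      field_simp
      simp
  have h2 := hg.continuousAt.continuousWithinAt (s := {0}ᶜ)
  have h3 : Tendsto g (𝓝[≠] 0) (𝓝 (c 0)) := by
    have := h2.tendsto
    simpa [g] using this
  refine h3.congr' ?_
  filter_upwards [self_mem_nhdsWithin] with z hz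
  simp [g, Function.update_of_ne hz]

/-- The coefficients of `v ∘ (multiplication by (ζ + ζ⁻¹)/2)ⁿ`, where the terms of order at most
zero are dropped at each step. -/
def cosCoeff (v : ℕ → F) : ℕ → ℕ → F
  | 0, k => v k
  | _ + 1, 0 => 0
  | n + 1, k + 1 => (2 : ℂ)⁻¹ • (cosCoeff v n k + cosCoeff v n (k + 2))

theorem cosCoeff_zero_right {v : ℕ → F} (hv : v 0 = 0) (n : ℕ) : cosCoeff v n 0 = 0 := by
  cases n with
  | zero => exact hv
  | succ n => rfl

theorem hasSum_tail {c : ℕ → F} {z : ℂ} {y : F} (hz : z ≠ 0)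
    (h : HasSum (fun k => z ^ (k + 1) • c k) y) :
    HasSum (fun k => z ^ (k + 1) • c (k + 1)) (z⁻¹ • y - c 0) := by
  have h1 := (hasSum_nat_add_iff' 1).2 (h.const_smul z⁻¹)
  convert! h1 using 1
  · funext k
    rw [smul_smul, pow_succ' z (k + 1)]
    field_simp
  · simp [smul_smul, hz]

/-- In the variable λ, multiplication by (ζ+ζ⁻¹)/2 is division by λ, and dropping the constant term
after it is a backward shift of the Taylor series of W. After n steps the leading coefficient is
w_{n+1} in λ; since λ ≈ 2ζ near zero, it is 2w_{n+1} in ζ. -/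
theorem cosCoeff_one {v w : ℕ → F} {W : ℂ → F} (hv : v 0 = 0) (hw : w 0 = 0)
    (hW : ∀ᶠ z in 𝓝 (0 : ℂ), HasSum (fun k => z ^ k • w k) (W z))
    (hV : ∀ᶠ ζ in 𝓝 (0 : ℂ), HasSum (fun k => ζ ^ k • v k) (W (2 * ζ / (1 + ζ ^ 2)))) (n : ℕ) :
    cosCoeff v n 1 = (2 : ℂ) • w (n + 1) := by
  set l : ℂ → ℂ := fun ζ => 2 * ζ / (1 + ζ ^ 2) with hl
  have hden : ∀ᶠ ζ in 𝓝[≠] (0 : ℂ), 1 + ζ ^ 2 ≠ 0 := by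
    have : ContinuousAt (fun ζ : ℂ => 1 + ζ ^ 2) 0 := by fun_prop
    exact (this.eventually_ne (by simp)).filter_mono nhdsWithin_le_nhds
  have hne : ∀ᶠ ζ in 𝓝[≠] (0 : ℂ), ζ ≠ 0 := self_mem_nhdsWithin
  have hl0 : Tendsto l (𝓝[≠] 0) (𝓝[≠] 0) := by
    refine tendsto_nhdsWithin_iff.2 ⟨?_, ?_⟩
    · have : ContinuousAt l 0 := by
        refine ContinuousAt.div (by fun_prop) (by fun_prop) (by simp)
      have h2 := this.tendsto
      simp only [hl] at h2
      simpa using h2.mono_left nhdsWithin_le_nhds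
    · filter_upwards [hden, hne] with ζ h1 h2
      simp [hl, h1, h2]
  have hl1 : Tendsto (fun ζ => ζ⁻¹ * l ζ) (𝓝[≠] 0) (𝓝 2) := by
    have : ContinuousAt (fun ζ : ℂ => 2 / (1 + ζ ^ 2)) 0 :=
      ContinuousAt.div (by fun_prop) (by fun_prop) (by simp)
    have h2 := this.tendsto.mono_left (nhdsWithin_le_nhds (s := {0}ᶜ))
    simp only [ne_eq, OfNat.ofNat_ne_zero, not_false_eq_true, zero_pow, add_zero, div_one] at h2
    refine h2.congr' ?_
    filter_upwards [hden, hne] with ζ h1 h3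
    simp only [hl]
    field_simp
  -- `T n` is the function with expansion ∑ₖ z^{k+1} w_{n+k+1}: W with its first terms removed and n
  -- powers of z divided out.
  let T : ℕ → ℂ → F := fun n => Nat.rec W (fun n g z => z⁻¹ • g z - w (n + 1)) n
  have hT : ∀ n, ∀ᶠ z in 𝓝[≠] (0 : ℂ), HasSum (fun k => z ^ (k + 1) • w (n + k + 1)) (T n z) := by
    intro n
    induction n with
    | zero =>
      filter_upwards [hW.filter_mono nhdsWithin_le_nhds] with z hz
      have := (hasSum_nat_add_iff' 1).2 hz
      simpa [hw, T] using this
    | succ n ih =>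
      filter_upwards [ih, self_mem_nhdsWithin] with z hz hz0
      have := hasSum_tail hz0 hz
      convert! this using 1
      funext k
      congr 2
      ring
  -- Comparison of leading coefficients: divide `T n (l ζ)` by ζ, and use that l(ζ)/ζ tends to 2.
  have key : ∀ n, (∀ᶠ ζ in 𝓝[≠] (0 : ℂ),
      HasSum (fun k => ζ ^ (k + 1) • cosCoeff v n (k + 1)) (T n (l ζ))) →
      cosCoeff v n 1 = (2 : ℂ) • w (n + 1) := by
    intro n hn
    have h1 := tendsto_inv_smul_of_hasSum hn
    have h2 := hl1.smul ((tendsto_inv_smul_of_hasSum (hT n)).comp hl0)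
    refine tendsto_nhds_unique h1 (h2.congr' ?_)
    filter_upwards [hl0.eventually self_mem_nhdsWithin] with ζ hζ
    have hζ : l ζ ≠ 0 := hζ
    simp [smul_smul, hζ]
  have claim : ∀ n, ∀ᶠ ζ in 𝓝[≠] (0 : ℂ),
      HasSum (fun k => ζ ^ (k + 1) • cosCoeff v n (k + 1)) (T n (l ζ)) := by
    intro n
    induction n with
    | zero =>
      filter_upwards [hV.filter_mono nhdsWithin_le_nhds] with ζ hζ
      have := (hasSum_nat_add_iff' 1).2 hζ
      simpa [hv, cosCoeff, T] using this
    | succ n ih =>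
      filter_upwards [ih, hden, hne] with ζ hζ h1 h2
      -- The terms ζ·`T n` and ζ⁻¹·`T n` are expanded separately. The second has the constant term
      -- `cosCoeff v n 1`, and half of it is exactly the w_{n+1} subtracted in `T (n + 1)`, by `key
      -- n`.
      have e1 : HasSum (fun k => ζ ^ (k + 1) • cosCoeff v n k) (ζ • T n (l ζ)) := by
        rw [← hasSum_nat_add_iff' 1]
        convert! hζ.const_smul ζ using 1
        · funext k
          rw [smul_smul, ← pow_succ']
        · simp [cosCoeff_zero_right hv]
      have e2 := hasSum_tail h2 hζ
      have e3 := (e1.add e2).const_smul (2 : ℂ)⁻¹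
      convert! e3 using 1
      · funext k
        simp only [cosCoeff, smul_add, smul_smul]
        congr 1 <;> · congr 1; ring
      · simp only [zero_add]
        rw [key n ih]
        change (l ζ)⁻¹ • T n (l ζ) - w (n + 1) = _
        rw [← add_sub_assoc, ← add_smul, smul_sub, smul_smul, smul_smul]
        simp only [hl]
        congr 2
        · field_simp
          ring
        · norm_num
  exact key n (claim n)

end powerSeries

/-! ### Trigonometric moments of a power series on circles -/

section circle

variable {F : Type*} [NormedAddCommGroup F] [NormedSpace ℂ F] [CompleteSpace F]

theorem integral_exp_int_mul_I (m : ℤ) :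
    ∫ t in (0 : ℝ)..2 * Real.pi, Complex.exp (m * t * Complex.I) =
      if m = 0 then 2 * Real.pi else 0 := by
  split_ifs with h
  · subst h; simp
  · have h1 : ∀ t : ℝ, (m : ℂ) * t * Complex.I = (m * Complex.I) * t := fun t => by ring
    simp_rw [h1]
    rw [integral_exp_mul_complex (by simpa using h)]
    have : (m : ℂ) * Complex.I * ((2 * Real.pi : ℝ) : ℂ) = m * (2 * Real.pi * Complex.I) := by
      push_cast; ring
    rw [this, Complex.exp_int_mul_two_pi_mul_I]
    simp

theorem integral_sin_mul_exp (k m : ℕ) :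
    ∫ t in (0 : ℝ)..2 * Real.pi, (Real.sin (k * t) : ℂ) * Complex.exp (m * t * Complex.I) =
      if m = k ∧ k ≠ 0 then Real.pi * Complex.I else 0 := by
  have h1 : ∀ t : ℝ, (Real.sin (k * t) : ℂ) * Complex.exp (m * t * Complex.I) =
      (-Complex.I / 2) * (Complex.exp (((m + k : ℤ) : ℂ) * t * Complex.I) -
        Complex.exp (((m - k : ℤ) : ℂ) * t * Complex.I)) := by
    intro t
    have e1 : (((m + k : ℤ) : ℂ) * t * Complex.I) = m * t * Complex.I + k * t * Complex.I := by
      push_cast; ring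
    have e2 : (((m - k : ℤ) : ℂ) * t * Complex.I) = m * t * Complex.I + -(k * t) * Complex.I := by
      push_cast; ring
    rw [e1, e2, Complex.exp_add, Complex.exp_add]
    push_cast
    rw [Complex.sin]
    ring
  simp_rw [h1]
  rw [intervalIntegral.integral_const_mul, intervalIntegral.integral_sub
    (Continuous.intervalIntegrable (by fun_prop) _ _)
    (Continuous.intervalIntegrable (by fun_prop) _ _), integral_exp_int_mul_I,
    integral_exp_int_mul_I]
  by_cases hk : k = 0
  · subst hk; simp
  · have e1 : ((m : ℤ) + k = 0) = False := by simp; omega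
    have e2 : ((m : ℤ) - k = 0) = (m = k) := by
      simp only [eq_iff_iff]; omega
    simp only [e1, e2, if_false, ne_eq, hk, not_false_eq_true, and_true]
    split_ifs
    · push_cast
      ring
    · simp

theorem continuous_circle_of_hasSum {v : ℕ → F} {V : ℂ → F} {r : ℝ} (hr0 : 0 ≤ r)
    (hs : Summable fun n => r ^ n * ‖v n‖)
    (hV : ∀ t : ℝ, HasSum (fun n => (r * Complex.exp (t * Complex.I)) ^ n • v n)
      (V (r * Complex.exp (t * Complex.I)))) :
    Continuous fun t : ℝ => V (r * Complex.exp (t * Complex.I)) := by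
  have : (fun t : ℝ => V (r * Complex.exp (t * Complex.I))) =
      fun t : ℝ => ∑' n, (r * Complex.exp (t * Complex.I)) ^ n • v n :=
    funext fun t => (hV t).tsum_eq.symm
  rw [this]
  refine continuous_tsum (fun n => by fun_prop) hs fun n t => ?_
  rw [norm_smul, norm_pow, norm_mul, Complex.norm_exp_ofReal_mul_I, mul_one,
    Complex.norm_of_nonneg hr0]

/-- The series has no negative frequencies, so sin(kt) detects the frequency k alone. For k = 0 the
weight is zero, which is where `v 0 = 0` enters. -/
theorem integral_sin_smul_circle {v : ℕ → F} {V : ℂ → F} {r : ℝ} (hr0 : 0 ≤ r)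
    (hv : v 0 = 0) (hs : Summable fun n => r ^ n * ‖v n‖)
    (hV : ∀ t : ℝ, HasSum (fun n => (r * Complex.exp (t * Complex.I)) ^ n • v n)
      (V (r * Complex.exp (t * Complex.I)))) (k : ℕ) :
    ∫ t in (0 : ℝ)..2 * Real.pi, (Real.sin (k * t) : ℂ) • V (r * Complex.exp (t * Complex.I)) =
      (Real.pi * Complex.I * r ^ k) • v k := by
  have h1 : HasSum (fun n => ∫ t in (0 : ℝ)..2 * Real.pi,
      (Real.sin (k * t) : ℂ) • (r * Complex.exp (t * Complex.I)) ^ n • v n)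
      (∫ t in (0 : ℝ)..2 * Real.pi,
        (Real.sin (k * t) : ℂ) • V (r * Complex.exp (t * Complex.I))) := by
    refine intervalIntegral.hasSum_integral_of_dominated_convergence
      (fun n _ => r ^ n * ‖v n‖) (fun n => ?_) (fun n => ?_) ?_ ?_ ?_
    · exact Continuous.aestronglyMeasurable (by fun_prop)
    · refine Eventually.of_forall fun t _ => ?_
      rw [norm_smul, norm_smul, norm_pow, norm_mul, Complex.norm_exp_ofReal_mul_I, mul_one,
        Complex.norm_of_nonneg hr0, Complex.norm_real]
      exact mul_le_of_le_one_left (by positivity) (Real.abs_sin_le_one _)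
    · exact Eventually.of_forall fun t _ => hs
    · exact intervalIntegrable_const
    · exact Eventually.of_forall fun t _ => (hV t).const_smul _
  have h2 : ∀ n, (∫ t in (0 : ℝ)..2 * Real.pi,
      (Real.sin (k * t) : ℂ) • (r * Complex.exp (t * Complex.I)) ^ n • v n) =
      (if n = k ∧ k ≠ 0 then Real.pi * Complex.I else 0 : ℂ) • (r : ℂ) ^ n • v n := by
    intro n
    rw [← integral_sin_mul_exp, ← intervalIntegral.integral_smul_const]
    refine intervalIntegral.integral_congr fun t _ => ?_
    simp only [smul_smul, mul_pow, ← Complex.exp_nat_mul]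
    congr 1
    ring_nf
  simp_rw [h2] at h1
  refine h1.unique ?_
  by_cases hk : k = 0
  · subst hk; simp [hv]
  · convert! hasSum_single k (f := fun n => (if n = k ∧ k ≠ 0 then Real.pi * Complex.I else 0 : ℂ) •
      (r : ℂ) ^ n • v n) ?_ using 1
    · simp [hk, smul_smul]
    · intro n hn
      simp [hn]

/-- The moments of the boundary values approximate the coefficients `cosCoeff`. -/
theorem tendsto_integral_cos_pow_sin {v : ℕ → F} {V : ℂ → F} (hv : v 0 = 0)
    (hV : ∀ z ∈ Metric.ball (0 : ℂ) 1, HasSum (fun n => z ^ n • v n) (V z)) (n : ℕ) (k : ℕ) :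
    Tendsto (fun r : ℝ => ∫ t in (0 : ℝ)..2 * Real.pi,
      ((Real.cos t ^ n * Real.sin (k * t) : ℝ) : ℂ) • V (r * Complex.exp (t * Complex.I)))
      (𝓝[<] 1) (𝓝 ((Real.pi * Complex.I) • cosCoeff v n k)) := by
  have hmem : ∀ᶠ r : ℝ in 𝓝[<] 1, 0 ≤ r ∧ r < 1 := by
    filter_upwards [Ico_mem_nhdsLT (zero_lt_one' ℝ)] with r hr using hr
  have hball : ∀ r : ℝ, 0 ≤ r → r < 1 → ∀ t : ℝ,
      HasSum (fun n => (r * Complex.exp (t * Complex.I)) ^ n • v n)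
        (V (r * Complex.exp (t * Complex.I))) := by
    intro r h0 h1 t
    refine hV _ ?_
    rw [mem_ball_zero_iff, norm_mul, Complex.norm_exp_ofReal_mul_I, mul_one,
      Complex.norm_of_nonneg h0]
    exact h1
  have hsum : ∀ r : ℝ, 0 ≤ r → r < 1 → Summable fun n => r ^ n * ‖v n‖ := by
    intro r h0 h1
    have h2 : ‖(((1 + r) / 2 : ℝ) : ℂ)‖ = (1 + r) / 2 :=
      Complex.norm_of_nonneg (by linarith)
    refine summable_norm_mul_pow_of_hasSum (hV (((1 + r) / 2 : ℝ) : ℂ) ?_) h0 ?_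
    · rw [mem_ball_zero_iff, h2]; linarith
    · rw [h2]; linarith
  have hcont : ∀ r : ℝ, 0 ≤ r → r < 1 →
      Continuous fun t : ℝ => V (r * Complex.exp (t * Complex.I)) :=
    fun r h0 h1 => continuous_circle_of_hasSum h0 (hsum r h0 h1) (hball r h0 h1)
  induction n generalizing k with
  | zero =>
    have h1 : Tendsto (fun r : ℝ => ((Real.pi * Complex.I * (r : ℂ) ^ k) • v k)) (𝓝[<] 1)
        (𝓝 ((Real.pi * Complex.I * ((1 : ℝ) : ℂ) ^ k) • v k)) := by
      have : Continuous (fun r : ℝ => ((Real.pi * Complex.I * (r : ℂ) ^ k) • v k)) := by fun_prop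
      exact (this.tendsto 1).mono_left nhdsWithin_le_nhds
    simp only [Complex.ofReal_one, one_pow, mul_one] at h1
    refine h1.congr' ?_
    filter_upwards [hmem] with r hr
    rw [← integral_sin_smul_circle hr.1 hv (hsum r hr.1 hr.2) (hball r hr.1 hr.2)]
    simp
  | succ n ih =>
    cases k with
    | zero => simp [cosCoeff]
    | succ k =>
      -- The product formula 2 cos t sin((k+1)t) = sin(kt) + sin((k+2)t) is the recursion defining
      -- `cosCoeff`; the value 0 at index 0 matches sin 0 = 0.
      have h1 := ((ih k).add (ih (k + 2))).const_smul (2 : ℂ)⁻¹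
      have h2 : (2 : ℂ)⁻¹ • ((Real.pi * Complex.I) • cosCoeff v n k +
          (Real.pi * Complex.I) • cosCoeff v n (k + 2)) =
          (Real.pi * Complex.I) • cosCoeff v (n + 1) (k + 1) := by
        rw [cosCoeff, ← smul_add, smul_comm]
      rw [h2] at h1
      refine h1.congr' ?_
      filter_upwards [hmem] with r hr
      have hc : ∀ k : ℕ, Continuous fun t : ℝ => ((Real.cos t ^ n * Real.sin (k * t) : ℝ) : ℂ) •
          V (r * Complex.exp (t * Complex.I)) := fun k =>
        (Complex.continuous_ofReal.comp (by fun_prop)).smul (hcont r hr.1 hr.2)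
      rw [← intervalIntegral.integral_add ((hc k).intervalIntegrable _ _)
        ((hc (k + 2)).intervalIntegrable _ _), ← intervalIntegral.integral_smul]
      refine intervalIntegral.integral_congr fun t _ => ?_
      simp only [← add_smul, smul_smul]
      congr 1
      have e1 : Real.sin ((k : ℝ) * t) = Real.sin ((k + 1 : ℝ) * t) * Real.cos t -
          Real.cos ((k + 1 : ℝ) * t) * Real.sin t := by
        rw [← Real.sin_sub]; ring_nf
      have e2 : Real.sin (((k + 2 : ℕ) : ℝ) * t) = Real.sin ((k + 1 : ℝ) * t) * Real.cos t +
          Real.cos ((k + 1 : ℝ) * t) * Real.sin t := by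
        rw [← Real.sin_add]; push_cast; ring_nf
      rw [e1, e2]
      push_cast
      ring

end circle

/-! ### Nevanlinna functions on the slit plane and Hausdorff positivity -/

section slit

theorem one_add_sq_ne_zero {z : ℂ} (hz : ‖z‖ < 1) : 1 + z ^ 2 ≠ 0 := by
  intro h
  have h1 : z ^ 2 = -1 := by linear_combination h
  have h2 : ‖z‖ ^ 2 = 1 := by rw [← norm_pow, h1]; simp
  nlinarith [norm_nonneg z]

/-- The numerator of the quotient multiplied by the conjugate denominator is 2z(1+z̄²), with
imaginary part 2(1-|z|²) Im z. The substitution therefore keeps the sign of the imaginary part. -/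
theorem im_two_mul_div_one_add_sq {z : ℂ} (hz : ‖z‖ < 1) :
    ∃ c : ℝ, 0 < c ∧ (2 * z / (1 + z ^ 2)).im = c * z.im := by
  have h1 := one_add_sq_ne_zero hz
  have hn : Complex.normSq z < 1 := by
    rw [Complex.normSq_eq_norm_sq]; nlinarith [norm_nonneg z]
  have h2 : 0 < Complex.normSq (1 + z ^ 2) := Complex.normSq_pos.2 h1
  refine ⟨2 * (1 - Complex.normSq z) / Complex.normSq (1 + z ^ 2),
    div_pos (by linarith) h2, ?_⟩
  rw [Complex.div_im]
  field_simp
  simp [Complex.normSq_apply, pow_two]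
  ring

/-- Non-real points stay non-real, and on the real axis |2x| < 1 + x² for |x| < 1. -/
theorem two_mul_div_one_add_sq_mem_slitDomain {z : ℂ} (hz : ‖z‖ < 1) :
    2 * z / (1 + z ^ 2) ∈ slitDomain := by
  rintro ⟨h1, h2⟩
  obtain ⟨c, hc, hi⟩ := im_two_mul_div_one_add_sq hz
  have h3 : z.im = 0 := by
    rw [hi] at h1
    exact (mul_eq_zero.1 h1).resolve_left hc.ne'
  obtain ⟨x, rfl⟩ : ∃ x : ℝ, z = x := ⟨z.re, Complex.ext rfl (by simp [h3])⟩
  have h4 : (2 * (x : ℂ) / (1 + (x : ℂ) ^ 2)).re = 2 * x / (1 + x ^ 2) := by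
    have : (2 * (x : ℂ) / (1 + (x : ℂ) ^ 2)) = ((2 * x / (1 + x ^ 2) : ℝ) : ℂ) := by push_cast; rfl
    rw [this, Complex.ofReal_re]
  rw [Complex.norm_real, Real.norm_eq_abs] at hz
  rw [h4, abs_div, abs_of_pos (by positivity : 0 < 1 + x ^ 2), le_div_iff₀ (by positivity),
    abs_mul, abs_two] at h2
  nlinarith [sq_abs x]

theorem ball_subset_slitDomain : Metric.ball (0 : ℂ) 1 ⊆ slitDomain := by
  rintro z hz ⟨_, h2⟩
  rw [mem_ball_zero_iff] at hz
  exact absurd (h2.trans (Complex.abs_re_le_norm z)) (not_le.2 hz)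

variable {N : Type*} [NormedAddCommGroup N] [InnerProductSpace ℂ N] [CompleteSpace N]

/-- The symmetry W(z̄) = W(z)* carries positivity from the upper half-plane to the lower one. The
product form covers the whole circle of integration at once. -/
theorem IsHerglotzNevanlinnaOnSlit.im_mul_im_nonneg {W : ℂ → N →L[ℂ] N}
    (hW : IsHerglotzNevanlinnaOnSlit W) {z : ℂ} (hz : z ∈ slitDomain) (a : N) :
    0 ≤ z.im * (inner ℂ a (W z a)).im := by
  rcases lt_trichotomy z.im 0 with h | h | h
  · have h1 := hW.2.2 (starRingEnd ℂ z) (by simpa using h) a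
    rw [hW.2.1 z hz, ContinuousLinearMap.adjoint_inner_right, ← inner_conj_symm,
      Complex.conj_im] at h1
    nlinarith
  · simp [h]
  · exact mul_nonneg h.le (hW.2.2 z h a)

/-- A quadratic form of Hankel type. -/
def hankelForm (G : ℕ → N →L[ℂ] N) (f g : ℕ →₀ N) : ℂ :=
  f.sum fun i a => g.sum fun j b => inner ℂ a (G (i + j) b)

theorem inner_intervalIntegral_apply {Φ : ℝ → N →L[ℂ] N} {s t : ℝ} (a b : N)
    (h : IntervalIntegrable Φ volume s t) :
    inner ℂ a ((∫ x in s..t, Φ x) b) = ∫ x in s..t, inner ℂ a (Φ x b) := by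
  have := ((innerSL ℂ a) ∘L (ContinuousLinearMap.apply ℂ N b)).intervalIntegral_comp_comm h
  simpa using this.symm

/-- Since cos^{i+j} = cosⁱ·cosʲ, the double sum collapses to the integral of q(t) sin t ⟨p(t),
V(t)p(t)⟩ with p(t) = ∑ cosⁱt · fᵢ. The imaginary part of the integrand is nonnegative because sin t
has the sign of the imaginary part of the argument of W. -/
theorem hankelForm_trig_nonneg {W : ℂ → N →L[ℂ] N} (hW : IsHerglotzNevanlinnaOnSlit W)
    {q : ℝ → ℝ} (hq : Continuous q) (hq0 : ∀ t, 0 ≤ q t) {r : ℝ} (hr0 : 0 < r) (hr1 : r < 1)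
    (hc : Continuous fun t : ℝ => W (2 * (r * Complex.exp (t * Complex.I)) /
      (1 + (r * Complex.exp (t * Complex.I)) ^ 2))) (f : ℕ →₀ N) :
    0 ≤ (hankelForm (fun n => ∫ t in (0 : ℝ)..2 * Real.pi,
      ((Real.cos t ^ n * (q t * Real.sin t) : ℝ) : ℂ) •
        W (2 * (r * Complex.exp (t * Complex.I)) /
          (1 + (r * Complex.exp (t * Complex.I)) ^ 2))) f f).im := by
  set V : ℝ → N →L[ℂ] N := fun t => W (2 * (r * Complex.exp (t * Complex.I)) /
      (1 + (r * Complex.exp (t * Complex.I)) ^ 2)) with hV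
  let p : ℝ → N := fun t => f.sum fun i a => ((Real.cos t ^ i : ℝ) : ℂ) • a
  have hcont : ∀ n, Continuous fun t : ℝ =>
      ((Real.cos t ^ n * (q t * Real.sin t) : ℝ) : ℂ) • V t := fun n =>
    (Complex.continuous_ofReal.comp (by fun_prop)).smul hc
  have key : hankelForm (fun n => ∫ t in (0 : ℝ)..2 * Real.pi,
      ((Real.cos t ^ n * (q t * Real.sin t) : ℝ) : ℂ) • V t) f f =
      ∫ t in (0 : ℝ)..2 * Real.pi, ((q t * Real.sin t : ℝ) : ℂ) * inner ℂ (p t) (V t (p t)) := by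
    have hint : ∀ (n : ℕ) (a b : N), IntervalIntegrable (fun t : ℝ => inner ℂ a
        ((((Real.cos t ^ n * (q t * Real.sin t) : ℝ) : ℂ) • V t) b)) volume 0 (2 * Real.pi) := by
      intro n a b
      refine Continuous.intervalIntegrable ?_ _ _
      exact continuous_const.inner ((hcont n).clm_apply continuous_const)
    simp only [hankelForm, Finsupp.sum]
    simp_rw [fun (n : ℕ) (a b : N) => inner_intervalIntegral_apply a b
      ((hcont n).intervalIntegrable 0 (2 * Real.pi))]
    simp_rw [← intervalIntegral.integral_finsetSum fun j _ => hint _ _ _]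
    rw [← intervalIntegral.integral_finsetSum]
    · refine intervalIntegral.integral_congr fun t _ => ?_
      simp only [p, Finsupp.sum, map_sum, sum_inner, inner_sum, Finset.mul_sum, map_smul,
        inner_smul_left, inner_smul_right, smul_apply]
      rw [Finset.sum_comm]
      refine Finset.sum_congr rfl fun i _ => Finset.sum_congr rfl fun j _ => ?_
      simp only [Complex.conj_ofReal]
      push_cast
      ring
    · intro i _
      simpa only [Finset.sum_fn] using IntervalIntegrable.sum f.support
        fun j _ => hint (i + j) (f i) (f j)
  rw [key]
  have hp : Continuous p := by
    simp only [p, Finsupp.sum]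
    exact continuous_finsetSum _ fun i _ =>
      (Complex.continuous_ofReal.comp (by fun_prop)).smul continuous_const
  have hcc : Continuous fun t : ℝ =>
      ((q t * Real.sin t : ℝ) : ℂ) * inner ℂ (p t) (V t (p t)) :=
    (Complex.continuous_ofReal.comp (by fun_prop)).mul (hp.inner (hc.clm_apply hp))
  have h3 : (∫ t in (0 : ℝ)..2 * Real.pi, ((q t * Real.sin t : ℝ) : ℂ) *
      inner ℂ (p t) (V t (p t))).im = ∫ t in (0 : ℝ)..2 * Real.pi,
      (((q t * Real.sin t : ℝ) : ℂ) * inner ℂ (p t) (V t (p t))).im :=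
    (ContinuousLinearMap.intervalIntegral_comp_comm Complex.imCLM
      (hcc.intervalIntegrable (μ := volume) 0 (2 * Real.pi))).symm
  rw [h3]
  refine intervalIntegral.integral_nonneg (by positivity) fun t _ => ?_
  rw [Complex.im_ofReal_mul]
  have hz : ‖(r : ℂ) * Complex.exp (t * Complex.I)‖ < 1 := by
    rw [norm_mul, Complex.norm_exp_ofReal_mul_I, mul_one, Complex.norm_of_nonneg hr0.le]
    exact hr1
  obtain ⟨c, hc0, hi⟩ := im_two_mul_div_one_add_sq hz
  have h4 := hW.im_mul_im_nonneg (two_mul_div_one_add_sq_mem_slitDomain hz) (p t)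
  have h5 : ((r : ℂ) * Complex.exp (t * Complex.I)).im = r * Real.sin t := by
    rw [Complex.im_ofReal_mul, Complex.exp_ofReal_mul_I_im]
  rw [hi, h5] at h4
  have h6 : 0 ≤ (c * r) * (Real.sin t * (inner ℂ (p t) (V t (p t))).im) := by
    calc _ ≤ _ := h4
      _ = _ := by ring
  have h7 := nonneg_of_mul_nonneg_right h6 (by positivity)
  have := mul_nonneg (hq0 t) h7
  linarith

theorem tendsto_hankelForm {E : Type*} [NormedAddCommGroup E] [InnerProductSpace ℂ E]
    {ι : Type*} {l : Filter ι} {Φ : ι → ℕ → E →L[ℂ] E}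
    {G : ℕ → E →L[ℂ] E} (h : ∀ n, Tendsto (fun i => Φ i n) l (𝓝 (G n))) (f g : ℕ →₀ E) :
    Tendsto (fun i => hankelForm (Φ i) f g) l (𝓝 (hankelForm G f g)) := by
  refine tendsto_finsetSum _ fun i _ => tendsto_finsetSum _ fun j _ => ?_
  exact tendsto_const_nhds.inner
    (((ContinuousLinearMap.apply ℂ E (g j)).continuous.tendsto _).comp (h (i + j)))

/-- The Taylor coefficients of a Herglotz-Nevanlinna function on the slit domain which vanishes at
`0` satisfy the conditions of the Hausdorff moment problem on `[-1, 1]`. -/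
theorem IsHerglotzNevanlinnaOnSlit.hankelForm_nonneg {W : ℂ → N →L[ℂ] N}
    (hW : IsHerglotzNevanlinnaOnSlit W) {w : ℕ → N →L[ℂ] N} (hw0 : w 0 = 0)
    (hw : ∀ z ∈ Metric.ball (0 : ℂ) 1, HasSum (fun n => z ^ n • w n) (W z)) (f : ℕ →₀ N) :
    0 ≤ (hankelForm (fun n => w (n + 1)) f f).re ∧
      0 ≤ (hankelForm (fun n => w (n + 1) - w (n + 3)) f f).re := by
  let V : ℂ → N →L[ℂ] N := fun ζ => W (2 * ζ / (1 + ζ ^ 2))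
  have hVd : DifferentiableOn ℂ V (Metric.ball 0 1) := by
    refine hW.1.comp ?_ fun z hz =>
      two_mul_div_one_add_sq_mem_slitDomain (mem_ball_zero_iff.1 hz)
    intro z hz
    have := one_add_sq_ne_zero (mem_ball_zero_iff.1 hz)
    exact (DifferentiableAt.div (c := fun z : ℂ => 2 * z) (d := fun z : ℂ => 1 + z ^ 2)
      (by fun_prop) (by fun_prop) this).differentiableWithinAt
  let v : ℕ → N →L[ℂ] N := fun n => (n.factorial : ℂ)⁻¹ • iteratedDeriv n V 0
  have hv : ∀ z ∈ Metric.ball (0 : ℂ) 1, HasSum (fun n => z ^ n • v n) (V z) := by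
    intro z hz
    have := Complex.hasSum_taylorSeries_on_ball hVd hz
    convert! this using 2 with n
    simp only [v, sub_zero, smul_smul]
    rw [mul_comm]
  have hW0 : W 0 = 0 := by
    refine (hw 0 (by simp)).unique ?_
    convert! hasSum_zero using 2 with n
    cases n <;> simp [hw0]
  have hv0 : v 0 = 0 := by simp [v, V, hW0]
  have hnhds : Metric.ball (0 : ℂ) 1 ∈ 𝓝 (0 : ℂ) := Metric.ball_mem_nhds _ one_pos
  have hone := cosCoeff_one hv0 hw0 (eventually_of_mem hnhds hw) (eventually_of_mem hnhds hv)
  have hlim := tendsto_integral_cos_pow_sin hv0 hv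
  have hr : ∀ᶠ r : ℝ in 𝓝[<] 1, 0 < r ∧ r < 1 := by
    filter_upwards [Ioo_mem_nhdsLT (zero_lt_one' ℝ)] with r hr using hr
  have hVc : ∀ r : ℝ, 0 < r → r < 1 →
      Continuous fun t : ℝ => V (r * Complex.exp (t * Complex.I)) := by
    intro r h0 h1
    refine hVd.continuousOn.comp_continuous (by fun_prop) fun t => ?_
    rw [mem_ball_zero_iff, norm_mul, Complex.norm_exp_ofReal_mul_I, mul_one,
      Complex.norm_of_nonneg h0.le]
    exact h1
  -- The moments come with the factor 2πi, which exchanges the imaginary part known to be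
  -- nonnegative with the wanted real part.
  have hscale : ∀ (G : ℕ → N →L[ℂ] N),
      0 ≤ (hankelForm (fun n => (2 * Real.pi * Complex.I) • G n) f f).im →
      0 ≤ (hankelForm G f f).re := by
    intro G h
    have : hankelForm (fun n => (2 * Real.pi * Complex.I) • G n) f f =
        ((2 * Real.pi : ℝ) : ℂ) * (Complex.I * hankelForm G f f) := by
      simp only [hankelForm, Finsupp.sum, smul_apply, inner_smul_right,
        Finset.mul_sum]
      refine Finset.sum_congr rfl fun i _ => Finset.sum_congr rfl fun j _ => ?_
      push_cast
      ring
    rw [this, Complex.im_ofReal_mul, Complex.I_mul_im] at h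
    exact nonneg_of_mul_nonneg_right h (by positivity)
  have hpi : ∀ n, (Real.pi * Complex.I) • cosCoeff v n 1 =
      (2 * Real.pi * Complex.I) • w (n + 1) := by
    intro n
    rw [hone, smul_smul]
    congr 1
    ring
  refine ⟨hscale _ ?_, hscale _ ?_⟩
  · have h1 := tendsto_hankelForm (fun n => hlim n 1) f f
    simp_rw [hpi] at h1
    refine ge_of_tendsto ((Complex.continuous_im.tendsto _).comp h1) ?_
    filter_upwards [hr] with r hr
    have := hankelForm_trig_nonneg hW (q := fun _ => 1) continuous_const (fun _ => zero_le_one)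
      hr.1 hr.2 (hVc r hr.1 hr.2) f
    simpa [V] using this
  · have h1 := tendsto_hankelForm (fun n => (hlim n 1).sub (hlim (n + 2) 1)) f f
    simp_rw [hpi, ← smul_sub] at h1
    refine ge_of_tendsto ((Complex.continuous_im.tendsto _).comp h1) ?_
    filter_upwards [hr] with r hr
    -- The weight sin² = 1 - cos² produces the difference of the moments of orders n and n + 2.
    have := hankelForm_trig_nonneg hW (q := fun t => Real.sin t ^ 2) (by fun_prop)
      (fun _ => sq_nonneg _) hr.1 hr.2 (hVc r hr.1 hr.2) f
    refine this.trans_eq (congrArg (fun G => (hankelForm G f f).im) (funext fun n => ?_))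
    have hc : ∀ n : ℕ, Continuous fun t : ℝ => ((Real.cos t ^ n * Real.sin ((1 : ℕ) * t) : ℝ) : ℂ) •
        V (r * Complex.exp (t * Complex.I)) := fun n =>
      (Complex.continuous_ofReal.comp (by fun_prop)).smul (hVc r hr.1 hr.2)
    refine Eq.trans ?_ (intervalIntegral.integral_sub ((hc n).intervalIntegrable _ _)
      ((hc (n + 2)).intervalIntegrable _ _))
    refine intervalIntegral.integral_congr fun t _ => ?_
    simp only [← sub_smul, V]
    congr 1
    rw [← Complex.ofReal_sub, Real.sin_sq]
    congr 1
    push_cast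
    rw [one_mul]
    ring

/-- Taking adjoints in the expansion at z̄ gives a second expansion of W at z, and coefficients are
unique. -/
theorem IsHerglotzNevanlinnaOnSlit.adjoint_coeff {W : ℂ → N →L[ℂ] N}
    (hW : IsHerglotzNevanlinnaOnSlit W) {w : ℕ → N →L[ℂ] N}
    (hw : ∀ z ∈ Metric.ball (0 : ℂ) 1, HasSum (fun n => z ^ n • w n) (W z)) (n : ℕ) :
    ContinuousLinearMap.adjoint (w n) = w n := by
  have hnhds : Metric.ball (0 : ℂ) 1 ∈ 𝓝 (0 : ℂ) := Metric.ball_mem_nhds _ one_pos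
  have h : (fun n => ContinuousLinearMap.adjoint (w n)) = w := by
    refine hasSum_pow_smul_unique ?_ (eventually_of_mem hnhds hw)
    filter_upwards [hnhds] with z hz
    have hz' : starRingEnd ℂ z ∈ Metric.ball (0 : ℂ) 1 := by simpa using hz
    have h1 := (ContinuousLinearMap.adjoint (𝕜 := ℂ) (E := N) (F := N)).continuous
    have h2 := (hw _ hz').map (ContinuousLinearMap.adjoint (𝕜 := ℂ) (E := N) (F := N)) h1
    rw [hW.2.1 z (ball_subset_slitDomain hz), ContinuousLinearMap.adjoint_adjoint] at h2
    convert! h2 using 2 with n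
    simp [← ContinuousLinearMap.star_eq_adjoint, star_smul]
  exact congrFun h n

end slit

/-! ### The operator Hausdorff moment problem by the GNS construction -/

section gns

/-- The Gelfand-Naimark-Segal construction for a positive semidefinite sesquilinear form. -/
theorem exists_hilbertSpace_of_form {E : Type u} [AddCommGroup E] [Module ℂ E]
    (φ : E → E → ℂ) (hconj : ∀ x y, starRingEnd ℂ (φ y x) = φ x y)
    (hnn : ∀ x, 0 ≤ (φ x x).re) (hadd : ∀ x y z, φ (x + y) z = φ x z + φ y z)
    (hsmul : ∀ x y (c : ℂ), φ (c • x) y = starRingEnd ℂ c * φ x y) :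
    ∃ (K : Type u) (_ : NormedAddCommGroup K) (_ : InnerProductSpace ℂ K) (_ : CompleteSpace K)
      (ι : E →ₗ[ℂ] K), DenseRange ι ∧ ∀ x y, inner ℂ (ι x) (ι y) = φ x y := by
  let core : PreInnerProductSpace.Core ℂ E :=
    { inner := φ
      conj_inner_symm := hconj
      re_inner_nonneg := hnn
      add_left := hadd
      smul_left := hsmul }
  let _ : SeminormedAddCommGroup E := InnerProductSpace.Core.toSeminormedAddCommGroup (c := core)
  let _ : InnerProductSpace ℂ E := InnerProductSpace.ofCore core
  refine ⟨UniformSpace.Completion E, inferInstance, inferInstance, inferInstance,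
    (UniformSpace.Completion.toComplₗᵢ (𝕜 := ℂ) (E := E)).toLinearMap, ?_, fun x y => ?_⟩
  · exact UniformSpace.Completion.denseRange_coe
  · exact UniformSpace.Completion.inner_coe x y

end gns

section hankel

variable {N : Type u} [NormedAddCommGroup N] [InnerProductSpace ℂ N]

theorem hankelForm_add_left (G : ℕ → N →L[ℂ] N) (f g h : ℕ →₀ N) :
    hankelForm G (f + g) h = hankelForm G f h + hankelForm G g h := by
  rw [hankelForm, Finsupp.sum_add_index']
  · rfl
  · intro i; simp
  · intro i a b; simp [Finsupp.sum, Finset.sum_add_distrib]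

theorem hankelForm_smul_left (G : ℕ → N →L[ℂ] N) (f h : ℕ →₀ N) (c : ℂ) :
    hankelForm G (c • f) h = starRingEnd ℂ c * hankelForm G f h := by
  rw [hankelForm, Finsupp.sum_smul_index']
  · simp [hankelForm, Finsupp.sum, Finset.mul_sum, mul_comm]
  · intro i; simp

theorem hankelForm_inputShift_left (G : ℕ → N →L[ℂ] N) (f h : ℕ →₀ N) :
    hankelForm G (DTSystem.inputShift N f) h = hankelForm (fun n => G (n + 1)) f h := by
  rw [hankelForm, DTSystem.inputShift, Finsupp.lmapDomain_apply, Finsupp.sum_mapDomain_index]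
  · simp [hankelForm, Nat.succ_add]
  · intro i; simp
  · intro i a b; simp [Finsupp.sum, Finset.sum_add_distrib]

theorem hankelForm_inputShift_right (G : ℕ → N →L[ℂ] N) (f h : ℕ →₀ N) :
    hankelForm G f (DTSystem.inputShift N h) = hankelForm (fun n => G (n + 1)) f h := by
  rw [hankelForm, hankelForm]
  refine Finsupp.sum_congr fun i _ => ?_
  rw [DTSystem.inputShift, Finsupp.lmapDomain_apply, Finsupp.sum_mapDomain_index]
  · simp [← add_assoc]
  · intro i; simp
  · intro i a b; simp

theorem hankelForm_single (G : ℕ → N →L[ℂ] N) (i j : ℕ) (a b : N) :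
    hankelForm G (Finsupp.single i a) (Finsupp.single j b) = inner ℂ a (G (i + j) b) := by
  simp [hankelForm]

theorem hankelForm_sub (G G' : ℕ → N →L[ℂ] N) (f h : ℕ →₀ N) :
    hankelForm (fun n => G n - G' n) f h = hankelForm G f h - hankelForm G' f h := by
  simp [hankelForm, Finsupp.sum, Finset.sum_sub_distrib]

variable [CompleteSpace N]

theorem conj_hankelForm {G : ℕ → N →L[ℂ] N}
    (hG : ∀ n, ContinuousLinearMap.adjoint (G n) = G n) (f h : ℕ →₀ N) :
    starRingEnd ℂ (hankelForm G h f) = hankelForm G f h := by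
  simp only [hankelForm, Finsupp.sum, map_sum, inner_conj_symm]
  rw [Finset.sum_comm]
  refine Finset.sum_congr rfl fun i _ => Finset.sum_congr rfl fun j _ => ?_
  rw [← ContinuousLinearMap.adjoint_inner_right, hG, add_comm]

/-- The solution of the operator Hausdorff moment problem: `G n = B* Aⁿ B` with a selfadjoint
contraction `A`. -/
theorem exists_selfAdjoint_realization (G : ℕ → N →L[ℂ] N)
    (hG : ∀ n, ContinuousLinearMap.adjoint (G n) = G n)
    (h0 : ∀ f, 0 ≤ (hankelForm G f f).re)
    (h1 : ∀ f, 0 ≤ (hankelForm (fun n => G n - G (n + 2)) f f).re) :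
    ∃ (K : Type u) (_ : NormedAddCommGroup K) (_ : InnerProductSpace ℂ K) (_ : CompleteSpace K)
      (A : K →L[ℂ] K) (B : N →L[ℂ] K), ContinuousLinearMap.adjoint A = A ∧ ‖A‖ ≤ 1 ∧
      (∀ n, ContinuousLinearMap.adjoint B ∘L (A ^ n) ∘L B = G n) ∧
      ∀ D : N →L[ℂ] N,
        (DTSystem.mk A B (ContinuousLinearMap.adjoint B) D).IsControllable := by
  obtain ⟨K, i1, i2, i3, ι, hι, hin⟩ := exists_hilbertSpace_of_form (hankelForm G)
    (fun f g => conj_hankelForm hG f g) h0 (hankelForm_add_left G) (hankelForm_smul_left G)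
  have hnorm : ∀ f, ‖ι f‖ ^ 2 = (hankelForm G f f).re := fun f => by
    rw [← hin, ← inner_self_eq_norm_sq (𝕜 := ℂ)]; rfl
  -- The shift becomes A on the GNS space. Positivity of the form of G(n) - G(n+2) says that the
  -- shift is contractive, and dependence of the form on i + j alone says that it is symmetric. The
  -- input a becomes the sequence supported at 0.
  let Sh := ι ∘ₗ DTSystem.inputShift N
  have hSh : ∀ f, ‖Sh f‖ ≤ 1 * ‖ι f‖ := by
    intro f
    rw [one_mul]
    refine le_of_sq_le_sq ?_ (norm_nonneg _)
    have h2 := h1 f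
    rw [hankelForm_sub, Complex.sub_re] at h2
    rw [hnorm, LinearMap.comp_apply, hnorm, hankelForm_inputShift_left,
      hankelForm_inputShift_right]
    linarith
  let A : K →L[ℂ] K := Sh.extendOfNorm ι
  have hA : ∀ f, A (ι f) = ι (DTSystem.inputShift N f) := fun f =>
    LinearMap.extendOfNorm_eq hι ⟨1, hSh⟩ f
  have hB : ∀ a, ‖(ι ∘ₗ Finsupp.lsingle 0) a‖ ≤ Real.sqrt ‖G 0‖ * ‖a‖ := by
    intro a
    refine le_of_sq_le_sq ?_ (by positivity)
    rw [LinearMap.comp_apply, hnorm, mul_pow, Real.sq_sqrt (norm_nonneg _),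
      Finsupp.lsingle_apply, hankelForm_single]
    calc (inner ℂ a (G (0 + 0) a)).re ≤ ‖a‖ * ‖G 0 a‖ := re_inner_le_norm (𝕜 := ℂ) a (G 0 a)
      _ ≤ ‖a‖ * (‖G 0‖ * ‖a‖) := by gcongr; exact (G 0).le_opNorm a
      _ = _ := by ring
  let B : N →L[ℂ] K := (ι ∘ₗ Finsupp.lsingle 0).mkContinuous _ hB
  have hB' : ∀ a, B a = ι (Finsupp.single 0 a) := fun a => rfl
  have hAB : ∀ n a, (A ^ n) (B a) = ι (Finsupp.single n a) := by
    intro n a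
    induction n with
    | zero => simp [hB']
    | succ n ih => rw [pow_succ', mul_apply_eq_comp, ih, hA]; simp
  refine ⟨K, i1, i2, i3, A, B, ?_, ?_, fun n => ?_, fun D => ?_⟩
  · refine Eq.symm ((ContinuousLinearMap.eq_adjoint_iff _ _).2 fun x y => ?_)
    refine hι.induction_on₂ (p := fun x y => inner ℂ (A x) y = inner ℂ x (A y)) ?_ ?_ x y
    · exact isClosed_eq (by fun_prop) (by fun_prop)
    · intro f g
      rw [hA, hA, hin, hin, hankelForm_inputShift_left, hankelForm_inputShift_right]
  · exact LinearMap.opNorm_extendOfNorm_le hι zero_le_one hSh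
  · ext a
    refine ext_inner_left ℂ fun b => ?_
    rw [ContinuousLinearMap.comp_apply, ContinuousLinearMap.comp_apply,
      ContinuousLinearMap.adjoint_inner_right, hAB, hB', hin, hankelForm_single, zero_add]
  · rw [DTSystem.isControllable_iff]
    convert! hι using 1
    funext f
    induction f using Finsupp.induction_linear with
    | zero => simp
    | add f g hf hg => simp [hf, hg]
    | single n a => rw [DTSystem.reach_single, hAB]

end hankel

/-! ### Defect operators -/

section defect

variable {H : Type*} [NormedAddCommGroup H] [InnerProductSpace ℂ H] [CompleteSpace H]
  {N : Type*} [NormedAddCommGroup N] [InnerProductSpace ℂ N] [CompleteSpace N]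

theorem isSelfAdjoint_sqrt (E : H →L[ℂ] H) :
    ContinuousLinearMap.adjoint (CFC.sqrt E) = CFC.sqrt E :=
  (IsSelfAdjoint.of_nonneg (CFC.sqrt_nonneg E)).adjoint_eq

theorem inner_sqrt_sqrt {E : H →L[ℂ] H} (hE : 0 ≤ E) (x y : H) :
    inner ℂ (CFC.sqrt E x) (CFC.sqrt E y) = inner ℂ x (E y) := by
  conv_rhs => rw [← CFC.sqrt_mul_sqrt_self E hE]
  conv_lhs => rw [← isSelfAdjoint_sqrt E, ContinuousLinearMap.adjoint_inner_left]
  rw [isSelfAdjoint_sqrt]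
  rfl

theorem norm_sqrt_sq {E : H →L[ℂ] H} (hE : 0 ≤ E) (x : H) :
    ‖CFC.sqrt E x‖ ^ 2 = (inner ℂ x (E x)).re := by
  rw [← inner_sqrt_sqrt hE, ← inner_self_eq_norm_sq (𝕜 := ℂ)]; rfl

theorem commute_sqrt {E A : H →L[ℂ] H} (h : Commute E A) :
    Commute (CFC.sqrt E) A := by
  rw [CFC.sqrt_eq_cfc]
  exact h.cfc_nnreal _

theorem one_sub_adjoint_comp_self_nonneg {T : N →L[ℂ] H} (hT : ‖T‖ ≤ 1) :
    0 ≤ 1 - ContinuousLinearMap.adjoint T ∘L T := by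
  rw [ContinuousLinearMap.nonneg_iff_isPositive, ContinuousLinearMap.isPositive_def']
  refine ⟨?_, fun x => ?_⟩
  · exact (IsSelfAdjoint.one _).sub (ContinuousLinearMap.isPositive_adjoint_comp_self T).isSelfAdjoint
  · have h1 : ContinuousLinearMap.reApplyInnerSelf (1 - ContinuousLinearMap.adjoint T ∘L T) x =
        ‖x‖ ^ 2 - ‖T x‖ ^ 2 := by
      rw [ContinuousLinearMap.reApplyInnerSelf_apply, sub_apply, inner_sub_left, map_sub,
        one_apply_eq_self, inner_self_eq_norm_sq, ContinuousLinearMap.comp_apply,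
        ContinuousLinearMap.adjoint_inner_left, inner_self_eq_norm_sq]
    rw [h1]
    have := T.le_of_opNorm_le hT x
    rw [one_mul] at this
    nlinarith [norm_nonneg (T x)]

theorem norm_defect_sq {T : N →L[ℂ] H} (hT : ‖T‖ ≤ 1) (x : N) :
    ‖CFC.sqrt (1 - ContinuousLinearMap.adjoint T ∘L T) x‖ ^ 2 = ‖x‖ ^ 2 - ‖T x‖ ^ 2 := by
  rw [norm_sqrt_sq (one_sub_adjoint_comp_self_nonneg hT)]
  simp only [sub_apply, one_apply_eq_self, inner_sub_right,
    ContinuousLinearMap.comp_apply, ContinuousLinearMap.adjoint_inner_right, Complex.sub_re]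
  rw [← inner_self_eq_norm_sq (𝕜 := ℂ), ← inner_self_eq_norm_sq (𝕜 := ℂ)]
  rfl

end defect

theorem HasNontangentialLimit.tendsto_radial {N : Type*} [NormedAddCommGroup N]
    [InnerProductSpace ℂ N] {F : ℂ → N →L[ℂ] N} {ξ : ℂ} {L : N →L[ℂ] N}
    (h : HasNontangentialLimit F ξ L) (a : N) :
    Tendsto (fun r : ℝ => F (ξ * r) a) (𝓝[<] 1) (𝓝 (L a)) :=
  (h 2 a).comp (tendsto_map'_iff.1 (Tendsto.mono_left tendsto_id
    (Complex.nhdsWithin_lt_le_nhdsWithin_stolzSet one_lt_two)))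

/-! ### Boundary values of the resolvent and contractive completion -/

section resolvent

variable {K : Type*} [NormedAddCommGroup K] [InnerProductSpace ℂ K] [CompleteSpace K]
  {N : Type*} [NormedAddCommGroup N] [InnerProductSpace ℂ N] [CompleteSpace N]

theorem eq_zero_of_denseRange {K : Type*} [NormedAddCommGroup K] [InnerProductSpace ℂ K]
    {ι : Type*} {f : ι → K} (hf : DenseRange f) {x : K}
    (h : ∀ i, inner ℂ (f i) x = 0) : x = 0 := by
  have h1 : ∀ y : K, inner ℂ y x = 0 := fun y =>
    hf.induction_on y (isClosed_eq (by fun_prop) continuous_const) h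
  exact inner_self_eq_zero.1 (h1 x)

theorem norm_ofReal_smul_lt_one {A : K →L[ℂ] K} (hA : ‖A‖ ≤ 1) {r : ℝ} (h0 : 0 ≤ r) (h1 : r < 1) :
    ‖(r : ℂ) • A‖ < 1 := by
  rw [norm_smul, Complex.norm_of_nonneg h0]
  nlinarith [norm_nonneg A]

theorem apply_inverse_one_sub {A : K →L[ℂ] K} (hA : ‖A‖ < 1) (x : K) :
    Ring.inverse (1 - A) x - A (Ring.inverse (1 - A) x) = x := by
  have := Ring.mul_inverse_cancel (1 - A) (isUnit_one_sub_of_norm_lt_one hA)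
  simpa using congrArg (fun T : K →L[ℂ] K => T x) this

/-- Abel means of the resolvent at a boundary point which is not an eigenvalue. -/
theorem tendsto_one_sub_apply_inverse {A : K →L[ℂ] K} (hA : ‖A‖ ≤ 1)
    (hd : DenseRange ⇑(1 - A : K →L[ℂ] K)) (x : K) :
    Tendsto (fun r : ℝ => (1 - A) (Ring.inverse (1 - (r : ℂ) • A) x)) (𝓝[<] 1) (𝓝 x) := by
  have hAn : ∀ z, ‖A z‖ ≤ ‖z‖ := fun z => by simpa using A.le_of_opNorm_le hA z
  have hstep : ∀ r : ℝ, 0 ≤ r → r < 1 → ∀ x : K,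
      (1 - A) (Ring.inverse (1 - (r : ℂ) • A) x) - x =
        -(((1 - r : ℝ) : ℂ) • A (Ring.inverse (1 - (r : ℂ) • A) x)) := by
    intro r h0 h1 x
    have h := apply_inverse_one_sub (norm_ofReal_smul_lt_one hA h0 h1) x
    nth_rewrite 2 [← h]
    simp only [sub_apply, one_apply_eq_self, smul_apply]
    push_cast
    module
  -- The error operators -(1-r)A(I-rA)⁻¹ are contractions, uniformly in r. On ran(I-A) they are
  -- O(1-r), because I-A commutes with the resolvent; density gives the rest.
  have hbound : ∀ r : ℝ, 0 ≤ r → r < 1 → ∀ x : K,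
      ‖(1 - A) (Ring.inverse (1 - (r : ℂ) • A) x) - x‖ ≤ ‖x‖ := by
    intro r h0 h1 x
    have h := apply_inverse_one_sub (norm_ofReal_smul_lt_one hA h0 h1) x
    rw [hstep r h0 h1, norm_neg, norm_smul, Complex.norm_of_nonneg (by linarith)]
    set y := Ring.inverse (1 - (r : ℂ) • A) x with hy
    have h2 : ‖y‖ - r * ‖A y‖ ≤ ‖x‖ := by
      have := norm_sub_norm_le y (((r : ℂ) • A) y)
      rw [h, smul_apply, norm_smul, Complex.norm_of_nonneg h0] at this
      exact this
    have := hAn y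
    nlinarith
  have hcomm : ∀ r : ℝ, 0 ≤ r → r < 1 →
      Commute (Ring.inverse (1 - (r : ℂ) • A)) (1 - A) := by
    intro r h0 h1
    obtain ⟨U, hU⟩ := isUnit_one_sub_of_norm_lt_one (norm_ofReal_smul_lt_one hA h0 h1)
    rw [← hU, Ring.inverse_unit]
    refine Commute.units_inv_left ?_
    rw [hU]
    exact (Commute.one_right _).sub_right ((Commute.one_left A).sub_left
      ((Commute.refl A).smul_left _))
  rw [Metric.tendsto_nhdsWithin_nhds]
  intro ε hε
  obtain ⟨x', hx'⟩ := Metric.denseRange_iff.1 hd x (ε / 2) (half_pos hε)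
  rw [dist_eq_norm] at hx'
  refine ⟨min 1 (ε / (4 * (‖x'‖ + 1))), lt_min one_pos (by positivity), fun r hr hr' => ?_⟩
  have hr1 : r < 1 := hr
  rw [dist_comm, Real.dist_eq, abs_of_pos (by linarith), lt_min_iff] at hr'
  have hr0 : 0 ≤ r := by linarith [hr'.1]
  set z := (1 - A) x' with hz
  have h1 := hbound r hr0 hr1 (x - z)
  have h2 : ‖(1 - A) (Ring.inverse (1 - (r : ℂ) • A) z) - z‖ ≤ (1 - r) * (2 * ‖x'‖) := by
    rw [hstep r hr0 hr1, norm_neg, norm_smul, Complex.norm_of_nonneg (by linarith)]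
    refine mul_le_mul_of_nonneg_left ?_ (by linarith)
    refine (hAn _).trans ?_
    have h3 : Ring.inverse (1 - (r : ℂ) • A) z = (1 - A) (Ring.inverse (1 - (r : ℂ) • A) x') :=
      congrArg (fun T : K →L[ℂ] K => T x') (hcomm r hr0 hr1).eq
    rw [h3]
    have h4 := norm_add_le ((1 - A) (Ring.inverse (1 - (r : ℂ) • A) x') - x') x'
    rw [sub_add_cancel] at h4
    linarith [hbound r hr0 hr1 x']
  have h3 : (1 - r) * (2 * ‖x'‖) < ε / 2 := by
    have h4 := hr'.2
    rw [lt_div_iff₀ (by positivity)] at h4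
    nlinarith [norm_nonneg x']
  rw [dist_eq_norm]
  calc ‖(1 - A) (Ring.inverse (1 - (r : ℂ) • A) x) - x‖
      = ‖((1 - A) (Ring.inverse (1 - (r : ℂ) • A) (x - z)) - (x - z)) +
          ((1 - A) (Ring.inverse (1 - (r : ℂ) • A) z) - z)‖ := by
        congr 1
        simp only [map_sub]
        abel
    _ ≤ _ := norm_add_le _ _
    _ < ε := by linarith

/-- Half the difference of the boundary values is the limit of rB*(I-r²A²)⁻¹B, and (S2) bounds its
quadratic form by ‖a‖². Cauchy-Schwarz in the form of I-r²A² turns this resolvent bound into a bound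
of B by the defect of A, without inverting I-A² itself. -/
theorem norm_inner_sq_le_of_tendsto {A : K →L[ℂ] K} (hA : ContinuousLinearMap.adjoint A = A)
    (hA1 : ‖A‖ ≤ 1) {B : N →L[ℂ] K} {W₁ W₂ : N →L[ℂ] N} {a : N}
    (h₁ : Tendsto (fun r : ℝ => (r : ℂ) • ContinuousLinearMap.adjoint B
      (Ring.inverse (1 - (r : ℂ) • A) (B a))) (𝓝[<] 1) (𝓝 (W₁ a)))
    (h₂ : Tendsto (fun r : ℝ => -(r : ℂ) • ContinuousLinearMap.adjoint B
      (Ring.inverse (1 - (r : ℂ) • -A) (B a))) (𝓝[<] 1) (𝓝 (W₂ a)))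
    (hle : W₁ - W₂ ≤ (2 : ℂ) • (1 : N →L[ℂ] N)) (x : K) :
    ‖inner ℂ (B a) x‖ ^ 2 ≤ ‖a‖ ^ 2 * (‖x‖ ^ 2 - ‖A x‖ ^ 2) := by
  have hAn : ‖A x‖ ≤ ‖x‖ := by simpa using A.le_of_opNorm_le hA1 x
  have hle' : (inner ℂ a ((W₁ - W₂) a)).re ≤ 2 * ‖a‖ ^ 2 := by
    have h := ((ContinuousLinearMap.le_def _ _).1 hle).re_inner_nonneg_right a
    rw [sub_apply, inner_sub_right, map_sub, smul_apply, inner_smul_right, one_apply_eq_self,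
      inner_self_eq_norm_sq_to_K] at h
    have e : ((2 : ℂ) * ((‖a‖ : ℂ)) ^ 2).re = 2 * ‖a‖ ^ 2 := by
      rw [show (2 : ℂ) * ((‖a‖ : ℂ)) ^ 2 = ((2 * ‖a‖ ^ 2 : ℝ) : ℂ) by push_cast; rfl,
        Complex.ofReal_re]
    have h' : 0 ≤ ((2 : ℂ) * ((‖a‖ : ℂ)) ^ 2).re - (inner ℂ a ((W₁ - W₂) a)).re := h
    linarith
  -- By partial fractions, `y r` is (I-r²A²)⁻¹Ba.
  let y : ℝ → K := fun r => (2 : ℂ)⁻¹ • (Ring.inverse (1 - (r : ℂ) • A) (B a) +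
    Ring.inverse (1 - (r : ℂ) • -A) (B a))
  have hlim : Tendsto (fun r : ℝ => r * (inner ℂ (B a) (y r)).re * (‖x‖ ^ 2 - r ^ 2 * ‖A x‖ ^ 2))
      (𝓝[<] 1) (𝓝 (2⁻¹ * (inner ℂ a ((W₁ - W₂) a)).re * (‖x‖ ^ 2 - 1 ^ 2 * ‖A x‖ ^ 2))) := by
    refine Tendsto.mul ?_ ?_
    · have h3 := ((Complex.continuous_re.tendsto _).comp
        ((tendsto_const_nhds (x := a)).inner (h₁.sub h₂))).const_mul (2⁻¹ : ℝ)
      refine h3.congr fun r => ?_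
      simp only [Function.comp_apply, y, inner_sub_right, inner_smul_right, inner_add_right,
        ContinuousLinearMap.adjoint_inner_right]
      rw [show (2 : ℂ)⁻¹ = ((2⁻¹ : ℝ) : ℂ) by push_cast; rfl, ← Complex.ofReal_neg,
        Complex.re_ofReal_mul, Complex.sub_re, Complex.re_ofReal_mul, Complex.re_ofReal_mul,
        Complex.add_re]
      ring
    · have : Continuous fun r : ℝ => ‖x‖ ^ 2 - r ^ 2 * ‖A x‖ ^ 2 := by fun_prop
      exact (this.tendsto 1).mono_left nhdsWithin_le_nhds
  have hlim2 : Tendsto (fun r : ℝ => r * ‖inner ℂ (B a) x‖ ^ 2) (𝓝[<] 1)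
      (𝓝 (1 * ‖inner ℂ (B a) x‖ ^ 2)) := by
    have : Continuous fun r : ℝ => r * ‖inner ℂ (B a) x‖ ^ 2 := by fun_prop
    exact (this.tendsto 1).mono_left nhdsWithin_le_nhds
  have key := le_of_tendsto_of_tendsto hlim2 hlim ?_
  · rw [one_mul, one_pow, one_mul] at key
    refine key.trans (mul_le_mul_of_nonneg_right (by linarith) ?_)
    nlinarith [norm_nonneg (A x)]
  filter_upwards [Ioo_mem_nhdsLT (zero_lt_one' ℝ)] with r hr
  have hn := norm_ofReal_smul_lt_one hA1 hr.1.le hr.2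
  have hn' : ‖(r : ℂ) • -A‖ < 1 :=
    norm_ofReal_smul_lt_one (A := -A) (by rwa [norm_neg]) hr.1.le hr.2
  have hE := one_sub_adjoint_comp_self_nonneg hn.le
  have hEapp : ∀ z, (1 - ContinuousLinearMap.adjoint ((r : ℂ) • A) ∘L ((r : ℂ) • A)) z =
      z - (r : ℂ) • A ((r : ℂ) • A z) := by
    intro z
    simp [← ContinuousLinearMap.star_eq_adjoint, star_smul]
    rw [ContinuousLinearMap.star_eq_adjoint, hA]
  have hEy : (1 - ContinuousLinearMap.adjoint ((r : ℂ) • A) ∘L ((r : ℂ) • A)) (y r) = B a := by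
    have e1 := apply_inverse_one_sub hn (B a)
    have e2 := apply_inverse_one_sub hn' (B a)
    rw [hEapp]
    simp only [y]
    set p := Ring.inverse (1 - (r : ℂ) • A) (B a)
    set q := Ring.inverse (1 - (r : ℂ) • -A) (B a)
    simp only [smul_apply, neg_apply] at e1 e2
    have e3 : A p - (r : ℂ) • A (A p) = A (B a) := by rw [← e1]; simp
    have e4 : A q + (r : ℂ) • A (A q) = A (B a) := by rw [← e2]; simp
    have e5 : (2 : ℂ)⁻¹ • (p + q) - (r : ℂ) • A ((r : ℂ) • A ((2 : ℂ)⁻¹ • (p + q))) =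
        (2 : ℂ)⁻¹ • ((p - (r : ℂ) • A p) + (q - (r : ℂ) • -A q) +
          (r : ℂ) • (A p - (r : ℂ) • A (A p)) - (r : ℂ) • (A q + (r : ℂ) • A (A q))) := by
      simp only [map_smul, map_add]
      module
    rw [e5, e1, e2, e3, e4]
    module
  have h1 : inner ℂ x (B a) = inner ℂ
      (CFC.sqrt (1 - ContinuousLinearMap.adjoint ((r : ℂ) • A) ∘L ((r : ℂ) • A)) x)
      (CFC.sqrt (1 - ContinuousLinearMap.adjoint ((r : ℂ) • A) ∘L ((r : ℂ) • A)) (y r)) := by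
    rw [inner_sqrt_sqrt hE, hEy]
  have h2 := norm_sqrt_sq hE (y r)
  have h3 := norm_defect_sq hn.le x
  rw [hEy] at h2
  have h4 : (inner ℂ (y r) (B a)).re = (inner ℂ (B a) (y r)).re := by
    rw [← inner_conj_symm, Complex.conj_re]
  rw [smul_apply, norm_smul, Complex.norm_of_nonneg hr.1.le, mul_pow] at h3
  rw [mul_assoc]
  refine mul_le_mul_of_nonneg_left ?_ hr.1.le
  rw [← h3, ← h4, ← h2, ← mul_pow, norm_inner_symm, h1, mul_comm]
  exact pow_le_pow_left₀ (norm_nonneg _) (norm_inner_le_norm _ _) 2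

/-- Douglas factorization: the estimate reads ‖B*x‖ ≤ ‖D_A x‖, so D_A x ↦ B*x extends to a
contraction, whose adjoint is L. The kernel of D_A is invariant under A and is annihilated by B*; it
is thus orthogonal to all AⁿBa, and controllability makes it trivial. -/
theorem exists_defect_factor {A : K →L[ℂ] K} (hA : ContinuousLinearMap.adjoint A = A)
    (hA1 : ‖A‖ ≤ 1) {B : N →L[ℂ] K}
    (hctrl : (DTSystem.mk A B (ContinuousLinearMap.adjoint B) 0).IsControllable)
    (hb : ∀ a x, ‖inner ℂ (B a) x‖ ^ 2 ≤ ‖a‖ ^ 2 * (‖x‖ ^ 2 - ‖A x‖ ^ 2)) :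
    Function.Injective ⇑(CFC.sqrt (1 - ContinuousLinearMap.adjoint A ∘L A) : K →L[ℂ] K) ∧
    ∃ L : N →L[ℂ] K, ‖L‖ ≤ 1 ∧ B = CFC.sqrt (1 - ContinuousLinearMap.adjoint A ∘L A) ∘L L := by
  set E : K →L[ℂ] K := 1 - ContinuousLinearMap.adjoint A ∘L A with hE
  have hcomm : Commute (CFC.sqrt E) A := by
    refine commute_sqrt ?_
    have : E = 1 - A * A := by rw [hE, hA]; rfl
    rw [this]
    exact (Commute.one_left A).sub_left ((Commute.refl A).mul_left (Commute.refl A))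
  have hBn : ∀ x, ‖ContinuousLinearMap.adjoint B x‖ ≤ 1 * ‖CFC.sqrt E x‖ := by
    intro x
    rw [one_mul]
    refine le_of_sq_le_sq ?_ (norm_nonneg _)
    have h := hb (ContinuousLinearMap.adjoint B x) x
    rw [← ContinuousLinearMap.adjoint_inner_right, inner_self_eq_norm_sq_to_K, norm_pow,
      ← norm_defect_sq hA1] at h
    simp only [Complex.coe_algebraMap, Complex.norm_real, norm_norm] at h
    by_cases h0 : ‖ContinuousLinearMap.adjoint B x‖ ^ 2 = 0
    · rw [h0]; positivity
    · have hp : 0 < ‖ContinuousLinearMap.adjoint B x‖ ^ 2 := lt_of_le_of_ne (by positivity) (Ne.symm h0)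
      rw [pow_two (‖ContinuousLinearMap.adjoint B x‖ ^ 2)] at h
      exact le_of_mul_le_mul_left h hp
  have hinj : Function.Injective ⇑(CFC.sqrt E) := by
    rw [injective_iff_map_eq_zero]
    intro x hx
    have hn : ∀ n, CFC.sqrt E ((A ^ n) x) = 0 := by
      intro n
      have := congrArg (fun T : K →L[ℂ] K => T x) (hcomm.pow_right n).eq
      simp only [mul_apply_eq_comp] at this
      rw [this, hx, map_zero]
    rw [DTSystem.isControllable_iff] at hctrl
    refine eq_zero_of_denseRange hctrl fun f => ?_
    induction f using Finsupp.induction_linear with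
    | zero => simp
    | add f g hf hg => rw [map_add, inner_add_left, hf, hg, add_zero]
    | single n a =>
      have h1 := hBn ((A ^ n) x)
      rw [hn, norm_zero, mul_zero, norm_le_zero_iff] at h1
      rw [DTSystem.reach_single]
      change inner ℂ ((A ^ n) (B a)) x = 0
      nth_rewrite 1 [← hA]
      rw [DTSystem.adjoint_pow_apply_inner, ← ContinuousLinearMap.adjoint_inner_right, h1,
        inner_zero_right]
  refine ⟨hinj, ?_⟩
  have hd : DenseRange ⇑(CFC.sqrt E) := denseRange_of_isSelfAdjoint_of_injective
    (IsSelfAdjoint.of_nonneg (CFC.sqrt_nonneg E)) hinj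
  let Lt : K →L[ℂ] N :=
    LinearMap.extendOfNorm (ContinuousLinearMap.adjoint B).toLinearMap (CFC.sqrt E).toLinearMap
  have hLt : ∀ x, Lt (CFC.sqrt E x) = ContinuousLinearMap.adjoint B x := fun x =>
    LinearMap.extendOfNorm_eq (f := (ContinuousLinearMap.adjoint B).toLinearMap) hd ⟨1, hBn⟩ x
  refine ⟨ContinuousLinearMap.adjoint Lt, ?_, ?_⟩
  · rw [LinearIsometryEquiv.norm_map]
    exact LinearMap.opNorm_extendOfNorm_le hd zero_le_one hBn
  · ext a
    refine ext_inner_right ℂ fun x => ?_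
    rw [ContinuousLinearMap.comp_apply, ← isSelfAdjoint_sqrt, ContinuousLinearMap.adjoint_inner_left,
      ContinuousLinearMap.adjoint_inner_left, hLt, ContinuousLinearMap.adjoint_inner_right]

/-- The block operators with given selfadjoint entry `A` and `B = D_A L`, `C = B*`, whose
feedthrough operator is of the form `-L* A L + D_L X D_L`, are contractions. -/
theorem isPassive_of_defect {A : K →L[ℂ] K} (hA : ContinuousLinearMap.adjoint A = A)
    (hA1 : ‖A‖ ≤ 1) {L : N →L[ℂ] K} (hL : ‖L‖ ≤ 1) {X : N →L[ℂ] N} (hX : ‖X‖ ≤ 1)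
    {Δ : N →L[ℂ] N} (hΔ : Δ = CFC.sqrt (1 - ContinuousLinearMap.adjoint L ∘L L))
    {S : K →L[ℂ] K} (hS : S = CFC.sqrt (1 - ContinuousLinearMap.adjoint A ∘L A)) :
    (DTSystem.mk A (S ∘L L) (ContinuousLinearMap.adjoint (S ∘L L))
      (-(ContinuousLinearMap.adjoint L ∘L A ∘L L) + Δ ∘L X ∘L Δ)).IsPassive := by
  have hcomm : Commute S A := by
    rw [hS]
    refine commute_sqrt ?_
    have : 1 - ContinuousLinearMap.adjoint A ∘L A = 1 - A * A := by rw [hA]; rfl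
    rw [this]
    exact (Commute.one_left A).sub_left ((Commute.refl A).mul_left (Commute.refl A))
  have hSa : ContinuousLinearMap.adjoint S = S := by rw [hS, isSelfAdjoint_sqrt]
  have hΔa : ContinuousLinearMap.adjoint Δ = Δ := by rw [hΔ, isSelfAdjoint_sqrt]
  have hSn : ∀ x, ‖S x‖ ^ 2 = ‖x‖ ^ 2 - ‖A x‖ ^ 2 := fun x => by rw [hS, norm_defect_sq hA1]
  have hΔn : ∀ x, ‖Δ x‖ ^ 2 = ‖x‖ ^ 2 - ‖L x‖ ^ 2 := fun x => by rw [hΔ, norm_defect_sq hL]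
  rw [DTSystem.isPassive_iff]
  intro a x
  simp only
  set l := L a
  -- The block operator is applied in two stages. The rotation (l, x) ↦ (Sx - Al, Sl + Ax) preserves
  -- the norm, since S and A commute and S² = I-A². The row (u, v) ↦ L*u + Δv is a contraction,
  -- since L*L + Δ² = I.
  set u := S x - A l with hu
  set v := X (Δ a) with hv
  have e1 : (-(ContinuousLinearMap.adjoint L ∘L A ∘L L) + Δ ∘L X ∘L Δ) a +
      ContinuousLinearMap.adjoint (S ∘L L) x = ContinuousLinearMap.adjoint L u + Δ v := by
    simp only [ContinuousLinearMap.adjoint_comp, hSa, add_apply, neg_apply,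
      ContinuousLinearMap.comp_apply, hu, hv, map_sub]
    abel
  have e2 : (S ∘L L) a = S l := rfl
  rw [e1, e2]
  have f1 : ‖ContinuousLinearMap.adjoint L u + Δ v‖ ^ 2 ≤ ‖u‖ ^ 2 + ‖v‖ ^ 2 := by
    set t := ContinuousLinearMap.adjoint L u + Δ v with ht
    have g1 : ‖t‖ ^ 2 = (inner ℂ (L t) u).re + (inner ℂ (Δ t) v).re := by
      rw [← inner_self_eq_norm_sq (𝕜 := ℂ)]
      nth_rewrite 2 [ht]
      rw [inner_add_right, ContinuousLinearMap.adjoint_inner_right,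
        ← ContinuousLinearMap.adjoint_inner_left, hΔa]
      rfl
    have g2 : (inner ℂ (L t) u).re ≤ ‖L t‖ * ‖u‖ := re_inner_le_norm (𝕜 := ℂ) _ _
    have g3 : (inner ℂ (Δ t) v).re ≤ ‖Δ t‖ * ‖v‖ := re_inner_le_norm (𝕜 := ℂ) _ _
    have g4 := hΔn t
    nlinarith [sq_nonneg (‖L t‖ - ‖u‖), sq_nonneg (‖Δ t‖ - ‖v‖)]
  have f2 : ‖u‖ ^ 2 + ‖S l + A x‖ ^ 2 = ‖l‖ ^ 2 + ‖x‖ ^ 2 := by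
    have g1 : (inner ℂ (S x) (A l)).re = (inner ℂ (S l) (A x)).re := by
      have : inner ℂ (S x) (A l) = inner ℂ (A x) (S l) := by
        have h1 : inner ℂ (S x) (A l) = inner ℂ x ((S * A) l) := by
          rw [← hSa, ContinuousLinearMap.adjoint_inner_left, hSa]; rfl
        have h2 : inner ℂ (A x) (S l) = inner ℂ x ((A * S) l) := by
          rw [← hA, ContinuousLinearMap.adjoint_inner_left, hA]; rfl
        rw [h1, h2, hcomm.eq]
      rw [this, ← inner_conj_symm, Complex.conj_re]
    have g2 := norm_sub_sq (𝕜 := ℂ) (S x) (A l)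
    have g3 := norm_add_sq (𝕜 := ℂ) (S l) (A x)
    simp only [RCLike.re_to_complex] at g2 g3
    rw [hu, g2, g3, g1, hSn, hSn]
    ring
  have f3 : ‖v‖ ≤ ‖Δ a‖ := by simpa using X.le_of_opNorm_le hX (Δ a)
  have f4 : ‖v‖ ^ 2 ≤ ‖Δ a‖ ^ 2 := pow_le_pow_left₀ (norm_nonneg _) f3 2
  have f5 := hΔn a
  linarith

end resolvent

/-! ### Existence of a minimal pqs-realization -/

section realization

/-- Since S² = (I+A)(I-A), the middle factor S(I-rA)⁻¹S equals (I+A)(I-A)(I-rA)⁻¹ and converges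
strongly to I+A. Injectivity of S excludes the eigenvalue 1 of A. Applied to A and to -A, this
yields W(1) and W(-1). -/
theorem tendsto_radial_of_defect {K : Type*} [NormedAddCommGroup K] [InnerProductSpace ℂ K]
    [CompleteSpace K] {N : Type*} [NormedAddCommGroup N] [InnerProductSpace ℂ N] [CompleteSpace N]
    {A S : K →L[ℂ] K} (hA : ContinuousLinearMap.adjoint A = A) (hA1 : ‖A‖ ≤ 1)
    (hS : ContinuousLinearMap.adjoint S = S) (hSS : S * S = 1 - A * A)
    (hcomm : Commute S A) (hinj : Function.Injective S) (L : N →L[ℂ] K) (a : N) :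
    Tendsto (fun r : ℝ => (r : ℂ) • ContinuousLinearMap.adjoint (S ∘L L)
      (Ring.inverse (1 - (r : ℂ) • A) ((S ∘L L) a))) (𝓝[<] 1)
      (𝓝 ((ContinuousLinearMap.adjoint L ∘L (1 + A) ∘L L) a)) := by
  have hi : Function.Injective ⇑(1 - A : K →L[ℂ] K) := by
    rw [injective_iff_map_eq_zero]
    intro x hx
    have h1 : (1 - A * A) x = 0 := by
      have : (1 - A * A : K →L[ℂ] K) = (1 + A) * (1 - A) := by noncomm_ring
      rw [this, mul_apply_eq_comp, hx, map_zero]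
    rw [← hSS, mul_apply_eq_comp] at h1
    exact (injective_iff_map_eq_zero S).1 hinj _ ((injective_iff_map_eq_zero S).1 hinj _ h1)
  have hsa : IsSelfAdjoint (1 - A : K →L[ℂ] K) :=
    (IsSelfAdjoint.one _).sub (ContinuousLinearMap.isSelfAdjoint_iff'.2 hA)
  have h1 := tendsto_one_sub_apply_inverse hA1
    (denseRange_of_isSelfAdjoint_of_injective hsa hi) (L a)
  have h2 : Tendsto (fun r : ℝ => (r : ℂ)) (𝓝[<] 1) (𝓝 ((1 : ℝ) : ℂ)) :=
    (Complex.continuous_ofReal.tendsto 1).mono_left nhdsWithin_le_nhds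
  have h3 := h2.smul (((ContinuousLinearMap.adjoint L ∘L (1 + A)).continuous.tendsto _).comp h1)
  rw [Complex.ofReal_one, one_smul] at h3
  refine h3.congr' ?_
  filter_upwards [Ioo_mem_nhdsLT (zero_lt_one' ℝ)] with r hr
  obtain ⟨U, hU⟩ := isUnit_one_sub_of_norm_lt_one (norm_ofReal_smul_lt_one hA1 hr.1.le hr.2)
  have hc : Commute (Ring.inverse (1 - (r : ℂ) • A)) S := by
    rw [← hU, Ring.inverse_unit]
    refine Commute.units_inv_left ?_
    rw [hU]
    exact (Commute.one_left S).sub_left (hcomm.symm.smul_left _)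
  have e1 : S (Ring.inverse (1 - (r : ℂ) • A) (S (L a))) =
      (1 + A) ((1 - A) (Ring.inverse (1 - (r : ℂ) • A) (L a))) := by
    have h4 : S * (Ring.inverse (1 - (r : ℂ) • A) * S) =
        (1 + A) * ((1 - A) * Ring.inverse (1 - (r : ℂ) • A)) := by
      rw [hc.eq, ← mul_assoc, hSS, ← mul_assoc]
      congr 1
      noncomm_ring
    exact congrArg (fun T : K →L[ℂ] K => T (L a)) h4
  simp only [Function.comp_apply, ContinuousLinearMap.adjoint_comp, hS,
    ContinuousLinearMap.comp_apply, e1]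

variable {N : Type u} [NormedAddCommGroup N] [InnerProductSpace ℂ N] [CompleteSpace N]

/-- For A = A* and C* = B the two density conditions coincide. -/
theorem DTSystem.IsPqs.isObservable {H : Type*} [NormedAddCommGroup H] [InnerProductSpace ℂ H]
    [CompleteSpace H] {τ : DTSystem N N H} (h : τ.IsPqs) (hc : τ.IsControllable) :
    τ.IsObservable := by
  obtain ⟨_, hA, hC⟩ := τ.isPqs_iff.1 h
  rw [IsObservable, hA, hC]
  exact hc

/-- The contraction on the closure of ran R is extended by zero on the orthogonal complement. -/
theorem exists_contraction_of_mem_operatorBall {S R Q : N →L[ℂ] N} (h : Q ∈ operatorBall S R) :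
    ∃ X : N →L[ℂ] N, ‖X‖ ≤ 1 ∧ Q = S + CFC.sqrt R ∘L X ∘L CFC.sqrt R := by
  obtain ⟨X, hX, hQ⟩ := h
  refine ⟨R.range.topologicalClosure.subtypeL ∘L X ∘L
    R.range.topologicalClosure.orthogonalProjectionOnto, ?_, hQ⟩
  refine ContinuousLinearMap.opNorm_le_bound _ zero_le_one fun a => ?_
  have h1 := X.le_of_opNorm_le hX (R.range.topologicalClosure.orthogonalProjectionOnto a)
  have h2 := R.range.topologicalClosure.norm_orthogonalProjectionOnto_apply_le a
  rw [one_mul] at h1 ⊢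
  exact h1.trans h2

/-- Condition (S1) yields A and B through the moment problem, (S2) yields the factorization B = D_A
L, and (S3) is what makes the block operator with D = Θ(0) contractive. -/
theorem IsSqs.exists_minimal_pqs {Θ : ℂ → N →L[ℂ] N} (hΘ : IsSqs Θ) :
    ∃ (K : Type u) (_ : NormedAddCommGroup K) (_ : InnerProductSpace ℂ K) (_ : CompleteSpace K)
      (σ : DTSystem N N K), σ.IsMinimal ∧ σ.IsPqs ∧
      ∀ z ∈ Metric.ball (0 : ℂ) 1, σ.transferFunction z = Θ z := by
  obtain ⟨W, W₁, W₂, hWΘ, hW, hl₁, hl₂, hle, hD⟩ := hΘ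
  let w : ℕ → N →L[ℂ] N := fun n => (n.factorial : ℂ)⁻¹ • iteratedDeriv n W 0
  have hw : ∀ z ∈ Metric.ball (0 : ℂ) 1, HasSum (fun n => z ^ n • w n) (W z) := by
    intro z hz
    have := Complex.hasSum_taylorSeries_on_ball (hW.1.mono ball_subset_slitDomain) hz
    convert! this using 2 with n
    simp only [w, sub_zero, smul_smul]
    rw [mul_comm]
  have hw0 : w 0 = 0 := by
    simp [w, hWΘ 0 (by simp)]
  obtain ⟨K, i1, i2, i3, A, B, hA, hA1, hG, hctrl⟩ := exists_selfAdjoint_realization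
    (fun n => w (n + 1)) (fun n => hW.adjoint_coeff hw _)
    (fun f => (hW.hankelForm_nonneg hw0 hw f).1) (fun f => (hW.hankelForm_nonneg hw0 hw f).2)
  have hWtf : ∀ z ∈ Metric.ball (0 : ℂ) 1,
      W z = z • (ContinuousLinearMap.adjoint B ∘L Ring.inverse (1 - z • A) ∘L B) := by
    intro z hz
    have h1 : ‖z • A‖ < 1 := by
      rw [mem_ball_zero_iff] at hz
      rw [norm_smul]
      nlinarith [norm_nonneg A, norm_nonneg z]
    have h2 := (DTSystem.mk A B (ContinuousLinearMap.adjoint B) 0).hasSum_transferFunction h1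
    have h3 : (DTSystem.mk A B (ContinuousLinearMap.adjoint B) 0).impulseResponse = w := by
      funext n
      cases n with
      | zero => exact hw0.symm
      | succ n => exact hG n
    rw [h3] at h2
    rw [(hw z hz).unique h2, DTSystem.transferFunction, zero_add]
  have hr : ∀ᶠ r : ℝ in 𝓝[<] 1, 0 < r ∧ r < 1 := by
    filter_upwards [Ioo_mem_nhdsLT (zero_lt_one' ℝ)] with r hr using hr
  have ht₁ : ∀ a, Tendsto (fun r : ℝ => (r : ℂ) • ContinuousLinearMap.adjoint B
      (Ring.inverse (1 - (r : ℂ) • A) (B a))) (𝓝[<] 1) (𝓝 (W₁ a)) := by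
    intro a
    refine (hl₁.tendsto_radial a).congr' ?_
    filter_upwards [hr] with r hr
    rw [one_mul, hWtf]
    · rfl
    · rw [mem_ball_zero_iff, Complex.norm_of_nonneg hr.1.le]
      exact hr.2
  have ht₂ : ∀ a, Tendsto (fun r : ℝ => -(r : ℂ) • ContinuousLinearMap.adjoint B
      (Ring.inverse (1 - (r : ℂ) • -A) (B a))) (𝓝[<] 1) (𝓝 (W₂ a)) := by
    intro a
    refine (hl₂.tendsto_radial a).congr' ?_
    filter_upwards [hr] with r hr
    rw [neg_one_mul, hWtf, smul_neg, neg_smul (r : ℂ) A]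
    · rfl
    · rw [mem_ball_zero_iff, norm_neg, Complex.norm_of_nonneg hr.1.le]
      exact hr.2
  obtain ⟨hinj, L, hL, hBL⟩ := exists_defect_factor hA hA1 (hctrl 0)
    (fun a x => norm_inner_sq_le_of_tendsto hA hA1 (ht₁ a) (ht₂ a) hle x)
  set S : K →L[ℂ] K := CFC.sqrt (1 - ContinuousLinearMap.adjoint A ∘L A) with hS
  have hSa : ContinuousLinearMap.adjoint S = S := isSelfAdjoint_sqrt _
  have hE : 1 - ContinuousLinearMap.adjoint A ∘L A = 1 - A * A := by rw [hA]; rfl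
  have hSS : S * S = 1 - A * A := by
    rw [hS, CFC.sqrt_mul_sqrt_self _ (one_sub_adjoint_comp_self_nonneg hA1), hE]
  have hcomm : Commute S A := by
    rw [hS]
    refine commute_sqrt ?_
    rw [hE]
    exact (Commute.one_left A).sub_left ((Commute.refl A).mul_left (Commute.refl A))
  have hW₁ : W₁ = ContinuousLinearMap.adjoint L ∘L (1 + A) ∘L L := by
    ext a
    refine tendsto_nhds_unique (ht₁ a) ?_
    rw [hBL]
    exact tendsto_radial_of_defect hA hA1 hSa hSS hcomm hinj L a
  have hW₂ : W₂ = -(ContinuousLinearMap.adjoint L ∘L (1 + -A) ∘L L) := by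
    ext a
    refine tendsto_nhds_unique (ht₂ a) ?_
    rw [hBL]
    have := (tendsto_radial_of_defect (A := -A) (S := S) (by rw [map_neg, hA])
      (by rwa [norm_neg]) hSa (by rw [hSS, neg_mul_neg]) hcomm.neg_right hinj L a).neg
    simpa using this
  -- The centre of the operator ball in (S3) is -L*AL and its radius operator is I-L*L, the squared
  -- defect of L.
  have hsum : -((2 : ℂ)⁻¹ • (W₁ + W₂)) = -(ContinuousLinearMap.adjoint L ∘L A ∘L L) := by
    rw [hW₁, hW₂]
    ext a
    simp only [neg_apply, smul_apply, add_apply, ContinuousLinearMap.comp_apply,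
      one_apply_eq_self, map_add, map_neg]
    module
  have hdiff : 1 - (2 : ℂ)⁻¹ • (W₁ - W₂) = 1 - ContinuousLinearMap.adjoint L ∘L L := by
    rw [hW₁, hW₂]
    ext a
    simp only [neg_apply, smul_apply, add_apply, sub_apply, ContinuousLinearMap.comp_apply,
      one_apply_eq_self, map_add, map_neg]
    module
  rw [hsum, hdiff] at hD
  obtain ⟨X, hX, hD⟩ := exists_contraction_of_mem_operatorBall hD
  have hpqs : (DTSystem.mk A B (ContinuousLinearMap.adjoint B) (Θ 0)).IsPqs := by
    refine (DTSystem.isPqs_iff _).2 ⟨?_, hA, ContinuousLinearMap.adjoint_adjoint B⟩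
    rw [hD, hBL]
    exact isPassive_of_defect hA hA1 hL hX rfl hS
  refine ⟨K, i1, i2, i3, DTSystem.mk A B (ContinuousLinearMap.adjoint B) (Θ 0),
    ⟨hctrl _, hpqs.isObservable (hctrl _)⟩, hpqs, fun z hz => ?_⟩
  rw [DTSystem.transferFunction, ← hWtf z hz, hWΘ z hz, add_sub_cancel]

end realization

/-! ### Unbounded selfadjoint operators as fractions of commuting bounded ones -/

section fraction

variable {H : Type*} [NormedAddCommGroup H] [InnerProductSpace ℂ H]

/-- The operator `a h ↦ b h` with domain `ran a`, for injective `a`. -/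
def fractionPMap (a b : H →L[ℂ] H) : H →ₗ.[ℂ] H :=
  (LinearMap.range (a.toLinearMap.prod b.toLinearMap)).toLinearPMap

theorem mem_graph_fractionPMap {a b : H →L[ℂ] H} (ha : Function.Injective a) {x y : H} :
    (x, y) ∈ (fractionPMap a b).graph ↔ ∃ h, x = a h ∧ y = b h := by
  rw [fractionPMap, Submodule.toLinearPMap_graph_eq]
  · constructor
    · rintro ⟨h, hh⟩
      exact ⟨h, (congrArg Prod.fst hh).symm, (congrArg Prod.snd hh).symm⟩
    · rintro ⟨h, rfl, rfl⟩
      exact ⟨h, rfl⟩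
  · rintro _ ⟨h, rfl⟩ h0
    have : h = 0 := (injective_iff_map_eq_zero a).1 ha h h0
    simp [this]

theorem mem_domain_fractionPMap {a b : H →L[ℂ] H} (ha : Function.Injective a) (h : H) :
    a h ∈ (fractionPMap a b).domain :=
  LinearPMap.mem_domain_of_mem_graph ((mem_graph_fractionPMap ha).2 ⟨h, rfl, rfl⟩)

theorem fractionPMap_apply {a b : H →L[ℂ] H} (ha : Function.Injective a) (h : H)
    (hx : a h ∈ (fractionPMap a b).domain) : fractionPMap a b ⟨a h, hx⟩ = b h := by
  have h1 := (fractionPMap a b).mem_graph ⟨a h, hx⟩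
  exact LinearPMap.mem_graph_snd_inj _ h1 ((mem_graph_fractionPMap ha).2 ⟨h, rfl, rfl⟩) rfl

theorem exists_of_mem_domain_fractionPMap {a b : H →L[ℂ] H} (ha : Function.Injective a)
    (x : (fractionPMap a b).domain) : ∃ h, (x : H) = a h ∧ fractionPMap a b x = b h :=
  (mem_graph_fractionPMap ha).1 ((fractionPMap a b).mem_graph x)

variable [CompleteSpace H]

/-- A pair (x, y) lies in the graph of the adjoint exactly when bx = ay. The Bezout identity ua + vb
= I then recovers the parameter h = ux + vy with x = ah and y = bh. It serves for b/a = s/c with (u,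
v) = (c, s), and for s²/c² with u = v = I. -/
theorem isSelfAdjoint_fractionPMap {a b u v : H →L[ℂ] H} (ha : ContinuousLinearMap.adjoint a = a)
    (hb : ContinuousLinearMap.adjoint b = b) (hinj : Function.Injective a) (hab : Commute a b)
    (hau : Commute a u) (hav : Commute a v) (hbu : Commute b u) (hbv : Commute b v)
    (h1 : u * a + v * b = 1) : IsSelfAdjoint (fractionPMap a b) := by
  have hdense : Dense ((fractionPMap a b).domain : Set H) := by
    refine (denseRange_of_isSelfAdjoint_of_injective
      (ContinuousLinearMap.isSelfAdjoint_iff'.2 ha) hinj).mono ?_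
    rintro _ ⟨h, rfl⟩
    exact mem_domain_fractionPMap hinj h
  rw [LinearPMap.isSelfAdjoint_def]
  refine LinearPMap.eq_of_eq_graph ?_
  rw [LinearPMap.adjoint_graph_eq_graph_adjoint hdense]
  have h1' : ∀ z, u (a z) + v (b z) = z := fun z => congrArg (fun T : H →L[ℂ] H => T z) h1
  have hc : ∀ {p q : H →L[ℂ] H}, Commute p q → ∀ z, p (q z) = q (p z) :=
    fun h z => congrArg (fun T : H →L[ℂ] H => T z) h.eq
  ext ⟨x, y⟩
  rw [Submodule.mem_adjoint_iff, mem_graph_fractionPMap hinj]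
  constructor
  · intro h
    have hxy : b x = a y := by
      refine ext_inner_left ℂ fun z => ?_
      have h2 := h (a z) (b z) ((mem_graph_fractionPMap hinj).2 ⟨z, rfl, rfl⟩)
      rw [← ContinuousLinearMap.adjoint_inner_left, hb, ← ContinuousLinearMap.adjoint_inner_left,
        ha]
      exact sub_eq_zero.1 h2
    refine ⟨u x + v y, ?_, ?_⟩
    · rw [map_add, hc hau, hc hav, ← hxy, h1']
    · rw [map_add, hc hbu, hc hbv, hxy, h1']
  · rintro ⟨h, rfl, rfl⟩ p q hpq
    obtain ⟨z, rfl, rfl⟩ := (mem_graph_fractionPMap hinj).1 hpq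
    rw [sub_eq_zero]
    change inner ℂ (b z) (a h) = inner ℂ (a z) (b h)
    rw [← ha, ContinuousLinearMap.adjoint_inner_right, ha, hc hab,
      ← ContinuousLinearMap.adjoint_inner_right, hb]

/-- By commutation ⟨bh, ah⟩ is the squared norm of b^{1/2}a^{1/2}h, and square roots of injective
positive operators are injective. -/
theorem re_inner_pos_of_commute {a b : H →L[ℂ] H} (ha : 0 ≤ a) (hb : 0 ≤ b) (hab : Commute a b)
    (hia : Function.Injective a) (hib : Function.Injective b) {h : H} (hh : h ≠ 0) :
    0 < (inner ℂ (b h) (a h)).re := by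
  have hsqrt : ∀ {e : H →L[ℂ] H}, 0 ≤ e → Function.Injective e →
      ∀ {z : H}, z ≠ 0 → CFC.sqrt e z ≠ 0 := by
    intro e he hie z hz h0
    apply hz
    have h1 : CFC.sqrt e (CFC.sqrt e z) = e z :=
      congrArg (fun T : H →L[ℂ] H => T z) (CFC.sqrt_mul_sqrt_self e he)
    rw [h0, map_zero] at h1
    exact (injective_iff_map_eq_zero e).1 hie z h1.symm
  have h1 : (inner ℂ (b h) (a h)).re = ‖CFC.sqrt b (CFC.sqrt a h)‖ ^ 2 := by
    have h2 : b (CFC.sqrt a h) = CFC.sqrt a (b h) :=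
      congrArg (fun T : H →L[ℂ] H => T h) (commute_sqrt hab).symm.eq
    have h3 : inner ℂ (a h) (b h) = inner ℂ (CFC.sqrt a h) (CFC.sqrt a (b h)) := by
      rw [inner_sqrt_sqrt ha, ← (IsSelfAdjoint.of_nonneg ha).adjoint_eq,
        ContinuousLinearMap.adjoint_inner_left, (IsSelfAdjoint.of_nonneg ha).adjoint_eq]
    rw [norm_sqrt_sq hb, h2, ← h3, ← inner_conj_symm, Complex.conj_re]
  rw [h1]
  have := norm_pos_iff.2 (hsqrt hb hib (hsqrt ha hia hh))
  positivity

theorem isPositiveSelfAdjoint_fractionPMap {a b u v : H →L[ℂ] H} (ha : 0 ≤ a) (hb : 0 ≤ b)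
    (hia : Function.Injective a) (hib : Function.Injective b) (hab : Commute a b)
    (hau : Commute a u) (hav : Commute a v) (hbu : Commute b u) (hbv : Commute b v)
    (h1 : u * a + v * b = 1) : IsPositiveSelfAdjoint (fractionPMap a b) := by
  refine ⟨isSelfAdjoint_fractionPMap (IsSelfAdjoint.of_nonneg ha).adjoint_eq
    (IsSelfAdjoint.of_nonneg hb).adjoint_eq hia hab hau hav hbu hbv h1, fun x hx => ?_⟩
  obtain ⟨h, h2, h3⟩ := exists_of_mem_domain_fractionPMap hia x
  rw [h2, h3]
  refine re_inner_pos_of_commute ha hb hab hia hib ?_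
  rintro rfl
  exact hx (Subtype.ext (by rw [h2, map_zero]; rfl))

/-- Simultaneous polar decomposition of two operators with `P* P + Q* Q = 1`. -/
theorem exists_cos_sin {G : Type*} [NormedAddCommGroup G] [InnerProductSpace ℂ G] [CompleteSpace G]
    {K : Type*} [NormedAddCommGroup K] [InnerProductSpace ℂ K] [CompleteSpace K]
    {P : G →L[ℂ] H} {Q : G →L[ℂ] K} (hP : Function.Injective P) (hQ : Function.Injective Q)
    (hPd : DenseRange P) (hQd : DenseRange Q) (hPQ : ∀ g, ‖P g‖ ^ 2 + ‖Q g‖ ^ 2 = ‖g‖ ^ 2) :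
    ∃ (c s : H →L[ℂ] H) (V : H ≃ₗᵢ[ℂ] G) (U : H ≃ₗᵢ[ℂ] K), 0 ≤ c ∧ 0 ≤ s ∧ Commute c s ∧
      c * c + s * s = 1 ∧ Function.Injective c ∧ Function.Injective s ∧
      (∀ h, P (V h) = c h) ∧ ∀ h, Q (V h) = U (s h) := by
  have hP1 : ‖ContinuousLinearMap.adjoint P‖ ≤ 1 := by
    rw [LinearIsometryEquiv.norm_map]
    refine ContinuousLinearMap.opNorm_le_bound _ zero_le_one fun g => ?_
    rw [one_mul]
    refine le_of_sq_le_sq ?_ (norm_nonneg _)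
    have := hPQ g
    nlinarith [sq_nonneg ‖Q g‖]
  have hadjinj : Function.Injective (ContinuousLinearMap.adjoint P) := by
    rw [injective_iff_map_eq_zero]
    intro x hx
    refine eq_zero_of_denseRange hPd fun g => ?_
    rw [← ContinuousLinearMap.adjoint_inner_right, hx, inner_zero_right]
  have hadjd : DenseRange (ContinuousLinearMap.adjoint P) := by
    refine denseRange_of_adjoint_injective ?_
    rwa [ContinuousLinearMap.adjoint_adjoint]
  -- The cosine is (PP*)^{1/2} and the sine is (I-PP*)^{1/2}. The unitary V extends ch ↦ P*h, and U
  -- extends sh ↦ QVh; the norms match because ‖QVh‖² = ‖h‖² - ‖ch‖².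
  set E : H →L[ℂ] H := P ∘L ContinuousLinearMap.adjoint P with hE
  have hE0 : 0 ≤ E := (ContinuousLinearMap.nonneg_iff_isPositive _).2
    (ContinuousLinearMap.isPositive_self_comp_adjoint P)
  have hE' : 1 - E = 1 - ContinuousLinearMap.adjoint (ContinuousLinearMap.adjoint P) ∘L
      ContinuousLinearMap.adjoint P := by rw [ContinuousLinearMap.adjoint_adjoint]
  have hE1 : 0 ≤ 1 - E := by
    rw [hE']
    exact one_sub_adjoint_comp_self_nonneg hP1
  set c := CFC.sqrt E with hc
  set s := CFC.sqrt (1 - E) with hs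
  have hcn : ∀ h, ‖c h‖ = ‖ContinuousLinearMap.adjoint P h‖ := by
    intro h
    refine (sq_eq_sq₀ (norm_nonneg _) (norm_nonneg _)).1 ?_
    rw [hc, norm_sqrt_sq hE0, hE, ContinuousLinearMap.comp_apply,
      ← ContinuousLinearMap.adjoint_inner_left, ← inner_self_eq_norm_sq (𝕜 := ℂ)]
    rfl
  have hsn : ∀ h, ‖s h‖ ^ 2 = ‖h‖ ^ 2 - ‖c h‖ ^ 2 := by
    intro h
    rw [hs, hE', norm_defect_sq hP1, hcn]
  have hcinj : Function.Injective c := by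
    rw [injective_iff_map_eq_zero]
    intro x hx
    refine (injective_iff_map_eq_zero _).1 hadjinj x ?_
    rw [← norm_eq_zero, ← hcn, hx, norm_zero]
  have hc0 : 0 ≤ c := CFC.sqrt_nonneg E
  have hs0 : 0 ≤ s := CFC.sqrt_nonneg _
  have hcd := denseRange_of_isSelfAdjoint_of_injective (IsSelfAdjoint.of_nonneg hc0) hcinj
  obtain ⟨V, hV⟩ := exists_linearIsometryEquiv_of_norm_eq c.toLinearMap
    (ContinuousLinearMap.adjoint P).toLinearMap hcd hadjd hcn
  have hPV : ∀ h, P (V h) = c h := by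
    intro h
    refine ext_inner_left ℂ fun z => ?_
    have hVz : V (c z) = ContinuousLinearMap.adjoint P z := hV z
    rw [← ContinuousLinearMap.adjoint_inner_left, ← hVz, V.inner_map_map,
      ← ContinuousLinearMap.adjoint_inner_right, (IsSelfAdjoint.of_nonneg hc0).adjoint_eq]
  have hQV : ∀ h, ‖s h‖ = ‖Q (V h)‖ := by
    intro h
    refine (sq_eq_sq₀ (norm_nonneg _) (norm_nonneg _)).1 ?_
    have := hPQ (V h)
    rw [hPV, V.norm_map] at this
    rw [hsn]
    linarith
  have hsinj : Function.Injective s := by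
    rw [injective_iff_map_eq_zero]
    intro x hx
    have h1 : Q (V x) = 0 := by rw [← norm_eq_zero, ← hQV, hx, norm_zero]
    exact V.map_eq_zero_iff.1 ((injective_iff_map_eq_zero _).1 hQ _ h1)
  have hsd := denseRange_of_isSelfAdjoint_of_injective (IsSelfAdjoint.of_nonneg hs0) hsinj
  have hQVd : DenseRange (Q ∘L V.toContinuousLinearEquiv.toContinuousLinearMap) :=
    hQd.comp V.surjective.denseRange Q.continuous
  obtain ⟨U, hU⟩ := exists_linearIsometryEquiv_of_norm_eq s.toLinearMap
    (Q ∘L V.toContinuousLinearEquiv.toContinuousLinearMap).toLinearMap hsd hQVd hQV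
  refine ⟨c, s, V, U, hc0, hs0, ?_, ?_, hcinj, hsinj, hPV, fun h => (hU h).symm⟩
  · refine commute_sqrt (Commute.symm (commute_sqrt ?_))
    exact (Commute.one_left E).sub_left (Commute.refl E)
  · rw [hc, hs, CFC.sqrt_mul_sqrt_self E hE0, CFC.sqrt_mul_sqrt_self _ hE1]
    abel

end fraction

/-! ### The closed operator intertwining two minimal systems -/

namespace DTSystem

section intertwining

variable {M : Type*} {N : Type*} {H : Type*} {K : Type*}
  [NormedAddCommGroup M] [InnerProductSpace ℂ M]
  [NormedAddCommGroup N] [InnerProductSpace ℂ N]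
  [NormedAddCommGroup H] [InnerProductSpace ℂ H]
  [NormedAddCommGroup K] [InnerProductSpace ℂ K]

/-- The closure of the relation `∑ Aⁿ B aₙ ↦ ∑ A'ⁿ B' aₙ` between the state spaces of two
systems. -/
def reachRelation (τ : DTSystem M N H) (τ' : DTSystem M N K) : Submodule ℂ (WithLp 2 (H × K)) :=
  (LinearMap.range ((WithLp.linearEquiv 2 ℂ (H × K)).symm.toLinearMap ∘ₗ
    τ.reach.prod τ'.reach)).topologicalClosure

variable (τ : DTSystem M N H) (τ' : DTSystem M N K)

theorem reach_mem_reachRelation (f : ℕ →₀ M) :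
    WithLp.toLp 2 (τ.reach f, τ'.reach f) ∈ reachRelation τ τ' :=
  Submodule.le_topologicalClosure _ ⟨f, rfl⟩

theorem reachRelation_induction {p : WithLp 2 (H × K) → Prop} (hp : IsClosed {x | p x})
    (h : ∀ f, p (WithLp.toLp 2 (τ.reach f, τ'.reach f))) {x : WithLp 2 (H × K)}
    (hx : x ∈ reachRelation τ τ') : p x := by
  refine closure_minimal (t := {x | p x}) ?_ hp hx
  rintro _ ⟨f, rfl⟩
  exact h f

/-- The first projection of `reachRelation`. -/
def reachFst : reachRelation τ τ' →L[ℂ] H :=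
  (ContinuousLinearMap.fst ℂ H K ∘L
    (WithLp.prodContinuousLinearEquiv 2 ℂ H K).toContinuousLinearMap) ∘L
      (reachRelation τ τ').subtypeL

/-- The second projection of `reachRelation`. -/
def reachSnd : reachRelation τ τ' →L[ℂ] K :=
  (ContinuousLinearMap.snd ℂ H K ∘L
    (WithLp.prodContinuousLinearEquiv 2 ℂ H K).toContinuousLinearMap) ∘L
      (reachRelation τ τ').subtypeL

theorem reachFst_apply (x : reachRelation τ τ') : reachFst τ τ' x = (x : WithLp 2 (H × K)).fst :=
  rfl

theorem reachSnd_apply (x : reachRelation τ τ') : reachSnd τ τ' x = (x : WithLp 2 (H × K)).snd :=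
  rfl

theorem continuous_fst_withLp : Continuous fun x : WithLp 2 (H × K) => x.fst :=
  (ContinuousLinearMap.fst ℂ H K ∘L
    (WithLp.prodContinuousLinearEquiv 2 ℂ H K).toContinuousLinearMap).continuous

theorem continuous_snd_withLp : Continuous fun x : WithLp 2 (H × K) => x.snd :=
  (ContinuousLinearMap.snd ℂ H K ∘L
    (WithLp.prodContinuousLinearEquiv 2 ℂ H K).toContinuousLinearMap).continuous

theorem norm_reachFst_sq_add (x : reachRelation τ τ') :
    ‖reachFst τ τ' x‖ ^ 2 + ‖reachSnd τ τ' x‖ ^ 2 = ‖x‖ ^ 2 := by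
  rw [reachFst_apply, reachSnd_apply, Submodule.coe_norm, WithLp.prod_norm_sq_eq_of_L2]

theorem exists_reachFst_eq_A (x : reachRelation τ τ') :
    ∃ y : reachRelation τ τ', reachFst τ τ' y = τ.A (reachFst τ τ' x) ∧
      reachSnd τ τ' y = τ'.A (reachSnd τ τ' x) := by
  have h := reachRelation_induction τ τ'
    (p := fun x => WithLp.toLp 2 (τ.A x.fst, τ'.A x.snd) ∈ reachRelation τ τ') ?_ ?_ x.2
  · exact ⟨⟨_, h⟩, rfl, rfl⟩
  · refine IsClosed.preimage ?_ (Submodule.isClosed_topologicalClosure _)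
    exact (WithLp.prodContinuousLinearEquiv 2 ℂ H K).symm.continuous.comp
      ((τ.A.continuous.comp continuous_fst_withLp).prodMk
        (τ'.A.continuous.comp continuous_snd_withLp))
  · intro f
    have := reach_mem_reachRelation τ τ' (inputShift M f)
    rwa [reach_inputShift, reach_inputShift] at this

theorem exists_reachFst_eq_B (a : M) :
    ∃ y : reachRelation τ τ', reachFst τ τ' y = τ.B a ∧ reachSnd τ τ' y = τ'.B a := by
  have := reach_mem_reachRelation τ τ' (Finsupp.single 0 a)
  simp only [reach_single, pow_zero, one_apply_eq_self] at this
  exact ⟨⟨_, this⟩, rfl, rfl⟩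

variable {τ τ'}

theorem reachRelation_eq_zero {x : reachRelation τ τ'} (h₁ : reachFst τ τ' x = 0)
    (h₂ : reachSnd τ τ' x = 0) : x = 0 := by
  have := norm_reachFst_sq_add τ τ' x
  rw [h₁, h₂, norm_zero, norm_zero] at this
  rw [← norm_eq_zero, ← sq_eq_zero_iff, ← this]
  norm_num

theorem denseRange_reachFst (hτ : τ.IsControllable) : DenseRange (reachFst τ τ') := by
  refine Dense.mono ?_ ((isControllable_iff τ).1 hτ)
  rintro _ ⟨f, rfl⟩
  exact ⟨⟨_, reach_mem_reachRelation τ τ' f⟩, rfl⟩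

theorem denseRange_reachSnd (hτ' : τ'.IsControllable) : DenseRange (reachSnd τ τ') := by
  refine Dense.mono ?_ ((isControllable_iff τ').1 hτ')
  rintro _ ⟨f, rfl⟩
  exact ⟨⟨_, reach_mem_reachRelation τ τ' f⟩, rfl⟩

theorem C_reachFst (h : τ.impulseResponse = τ'.impulseResponse) (x : reachRelation τ τ') :
    τ.C (reachFst τ τ' x) = τ'.C (reachSnd τ τ' x) := by
  refine reachRelation_induction τ τ' (p := fun x => τ.C x.fst = τ'.C x.snd) ?_ ?_ x.2
  · exact isClosed_eq (τ.C.continuous.comp continuous_fst_withLp)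
      (τ'.C.continuous.comp continuous_snd_withLp)
  · intro f
    change τ.C (τ.reach f) = τ'.C (τ'.reach f)
    induction f using Finsupp.induction_linear with
    | zero => simp
    | add f g hf hg => simp [hf, hg]
    | single n a =>
      have := congrArg (fun T : M →L[ℂ] N => T a) (congrFun h (n + 1))
      rw [reach_single, reach_single]
      exact this

variable [CompleteSpace M] [CompleteSpace N] [CompleteSpace H] [CompleteSpace K]

instance (τ : DTSystem M N H) (τ' : DTSystem M N K) : CompleteSpace (reachRelation τ τ') :=
  (Submodule.isClosed_topologicalClosure _).completeSpace_coe

/-- The pairing of reachable with observable vectors involves only the coefficients CAⁿB. This is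
what ties together the state spaces of systems with the same transfer function. -/
theorem inner_reach_dual_reach (τ : DTSystem M N H) (f : ℕ →₀ M) (g : ℕ →₀ N) :
    inner ℂ (τ.reach f) (τ.dual.reach g) =
      f.sum fun n a => g.sum fun m b => inner ℂ (τ.impulseResponse (m + n + 1) a) b := by
  simp only [reach, Finsupp.lsum_apply, Finsupp.sum, sum_inner, inner_sum]
  rw [Finset.sum_comm]
  refine Finset.sum_congr rfl fun n _ => Finset.sum_congr rfl fun m _ => ?_
  change inner ℂ ((τ.A ^ n) (τ.B (f n))) ((ContinuousLinearMap.adjoint τ.A ^ m)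
    (ContinuousLinearMap.adjoint τ.C (g m))) = _
  rw [← inner_conj_symm, adjoint_pow_apply_inner, inner_conj_symm,
    ContinuousLinearMap.adjoint_inner_right, impulseResponse, pow_add]
  rfl

theorem inner_reachFst_dual_reach (h : τ.impulseResponse = τ'.impulseResponse)
    (x : reachRelation τ τ') (g : ℕ →₀ N) :
    inner ℂ (reachFst τ τ' x) (τ.dual.reach g) = inner ℂ (reachSnd τ τ' x) (τ'.dual.reach g) := by
  refine reachRelation_induction τ τ'
    (p := fun x => inner ℂ x.fst (τ.dual.reach g) = inner ℂ x.snd (τ'.dual.reach g)) ?_ ?_ x.2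
  · exact isClosed_eq (continuous_fst_withLp.inner continuous_const)
      (continuous_snd_withLp.inner continuous_const)
  · intro f
    change inner ℂ (τ.reach f) (τ.dual.reach g) = inner ℂ (τ'.reach f) (τ'.dual.reach g)
    rw [inner_reach_dual_reach, inner_reach_dual_reach, h]

theorem eq_zero_of_inner_dual_reach (hτ : τ.IsMinimal) {x : H}
    (h : ∀ g, inner ℂ x (τ.dual.reach g) = 0) : x = 0 := by
  refine eq_zero_of_denseRange ((isControllable_iff _).1 hτ.dual.1) fun g => ?_
  rw [← inner_conj_symm, h, map_zero]

/-- The two components of a pair in the relation have equal pairings with the observable vectors of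
the respective systems. If the first component is zero, the second is orthogonal to a dense set.
Together with `reachSnd_injective` this makes the closed relation the graph of an injective
operator. -/
theorem reachFst_injective (h : τ.impulseResponse = τ'.impulseResponse) (hτ' : τ'.IsMinimal) :
    Function.Injective (reachFst τ τ') := by
  rw [injective_iff_map_eq_zero]
  intro x hx
  refine reachRelation_eq_zero hx (eq_zero_of_inner_dual_reach hτ' fun g => ?_)
  rw [← inner_reachFst_dual_reach h, hx, inner_zero_left]

theorem reachSnd_injective (h : τ.impulseResponse = τ'.impulseResponse) (hτ : τ.IsMinimal) :
    Function.Injective (reachSnd τ τ') := by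
  rw [injective_iff_map_eq_zero]
  intro x hx
  refine reachRelation_eq_zero (eq_zero_of_inner_dual_reach hτ fun g => ?_) hx
  rw [inner_reachFst_dual_reach h, hx, inner_zero_left]

end intertwining

/-! ### Polar decomposition of the intertwining operator and renormalization -/

section renormalization

variable {N : Type*} {H : Type*} {K : Type*}
  [NormedAddCommGroup N] [InnerProductSpace ℂ N] [CompleteSpace N]
  [NormedAddCommGroup H] [InnerProductSpace ℂ H] [CompleteSpace H]
  [NormedAddCommGroup K] [InnerProductSpace ℂ K] [CompleteSpace K]

/-- The completion of `dom R` in the norm `‖R f‖` is identified by `R` with the whole space, if `R`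
has dense range. -/
theorem exists_compl_equiv (R : H →ₗ.[ℂ] H) (hR : DenseRange R) :
    ∃ J : Renormed.Compl R ≃ₗᵢ[ℂ] H, ∀ x, J (Renormed.toCompl R x) = R x := by
  let i : R.domain →ₗ[ℂ] Renormed R :=
    { toFun := Renormed.mk R
      map_add' := fun _ _ => rfl
      map_smul' := fun _ _ => rfl }
  have hd : DenseRange ((UniformSpace.Completion.toComplₗᵢ (𝕜 := ℂ) (E := Renormed R)) ∘ i) :=
    UniformSpace.Completion.denseRange_coe.comp Function.surjective_id.denseRange
      (UniformSpace.Completion.continuous_coe _)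
  exact exists_linearIsometryEquiv_of_norm_eq
    ((UniformSpace.Completion.toComplₗᵢ (𝕜 := ℂ) (E := Renormed R)).toLinearMap ∘ₗ i) R.toFun hd hR
    fun x => UniformSpace.Completion.norm_coe (i x)

theorem exists_of_mem_domain_inverse {R : H →ₗ.[ℂ] H} (hR : IsPositiveSelfAdjoint R)
    (y : R.inverse.domain) : ∃ x : R.domain, R x = y ∧ R.inverse y = x := by
  have hker : LinearMap.ker R.toFun = ⊥ := by
    rw [LinearMap.ker_eq_bot']
    intro x hx
    by_contra h0
    have h1 := hR.2 x h0
    rw [show R x = 0 from hx, inner_zero_left] at h1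
    exact lt_irrefl _ h1
  obtain ⟨x, hx⟩ : (y : H) ∈ LinearMap.range R.toFun := by
    rw [← LinearPMap.inverse_domain]
    exact y.2
  exact ⟨x, hx, LinearPMap.inverse_apply_eq hker hx⟩

theorem inner_apply_of_nonneg {e : H →L[ℂ] H} (he : 0 ≤ e) (x y : H) :
    inner ℂ (e x) y = inner ℂ x (e y) := by
  rw [← ContinuousLinearMap.adjoint_inner_right, (IsSelfAdjoint.of_nonneg he).adjoint_eq]

theorem apply_apply_add_apply_apply {E : Type*} [NormedAddCommGroup E] [InnerProductSpace ℂ E]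
    {c s : E →L[ℂ] E} (hsum : c * c + s * s = 1) (z : E) :
    c (c z) + s (s z) = z :=
  congrArg (fun T : E →L[ℂ] E => T z) hsum

/-- The expected formula (s/c)² = s²/c² has to hold with equality of domains. This rests on c² + s²
= I, which supplies the Bezout identity for both fractions. -/
theorem isPositiveSqrt_fractionPMap {c s : H →L[ℂ] H} (hc : 0 ≤ c) (hs : 0 ≤ s)
    (hcs : Commute c s) (hsum : c * c + s * s = 1) (hci : Function.Injective c)
    (hsi : Function.Injective s) :
    IsPositiveSelfAdjoint (fractionPMap (c * c) (s * s)) ∧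
      IsPositiveSqrt (fractionPMap c s) (fractionPMap (c * c) (s * s)) := by
  have hcs' : ∀ z, c (s z) = s (c z) := fun z => congrArg (fun T : H →L[ℂ] H => T z) hcs.eq
  have hsum' := apply_apply_add_apply_apply hsum
  have hcci : Function.Injective ⇑(c * c) := hci.comp hci
  have hssi : Function.Injective ⇑(s * s) := hsi.comp hsi
  refine ⟨?_, ?_, fun x y => ?_⟩
  · refine isPositiveSelfAdjoint_fractionPMap (u := 1) (v := 1) ?_ ?_ hcci hssi ?_
      (Commute.one_right _) (Commute.one_right _) (Commute.one_right _) (Commute.one_right _)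
      (by rwa [one_mul, one_mul])
    · simpa [(IsSelfAdjoint.of_nonneg hc).star_eq] using star_mul_self_nonneg c
    · simpa [(IsSelfAdjoint.of_nonneg hs).star_eq] using star_mul_self_nonneg s
    · exact (hcs.mul_left hcs).mul_right (hcs.mul_left hcs)
  · exact isPositiveSelfAdjoint_fractionPMap hc hs hci hsi hcs (Commute.refl c) hcs hcs.symm
      (Commute.refl s) hsum
  · rw [mem_graph_fractionPMap hcci]
    simp only [mem_graph_fractionPMap hci]
    constructor
    · rintro ⟨m, rfl, rfl⟩
      exact ⟨s (c m), ⟨c m, rfl, rfl⟩, ⟨s m, (hcs' m).symm, rfl⟩⟩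
    · rintro ⟨z, ⟨p, rfl, rfl⟩, ⟨k, hk, rfl⟩⟩
      -- A common parameter m must satisfy p = cm and k = sm, so c² + s² = I forces m = cp + sk; the
      -- matching condition sp = ck makes it work.
      refine ⟨c p + s k, ?_, ?_⟩
      · rw [mul_apply_eq_comp, map_add, hcs', ← hk, hsum']
      · rw [mul_apply_eq_comp, map_add, ← hcs', hk, hsum']

/-- The first representation theorem for the form `(s z, s z')`. -/
theorem mem_graph_fractionPMap_of_inner {c s : H →L[ℂ] H} (hc : 0 ≤ c) (hs : 0 ≤ s)
    (hsum : c * c + s * s = 1) (hci : Function.Injective c) {z y : H}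
    (h : ∀ z', inner ℂ (s z) (s z') = inner ℂ y (c z')) :
    (c z, y) ∈ (fractionPMap (c * c) (s * s)).graph := by
  have hcci : Function.Injective ⇑(c * c) := hci.comp hci
  have hsum' := apply_apply_add_apply_apply hsum
  have h1 : s (s z) = c y := by
    refine ext_inner_right ℂ fun z' => ?_
    rw [inner_apply_of_nonneg hs, h, inner_apply_of_nonneg hc]
  -- From s²z = cy one gets z = c(cz + y), so cz + y is the parameter of the pair in the graph of
  -- s²/c².
  have h2 : c (c z + y) = z := by rw [map_add, ← h1, hsum']
  refine (mem_graph_fractionPMap hcci).2 ⟨c z + y, ?_, ?_⟩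
  · rw [mul_apply_eq_comp, h2]
  · have h3 := hsum' (c z + y)
    rw [h2] at h3
    exact (add_left_cancel h3).symm

theorem exists_of_mem_graph_fractionPMap {E : Type*} [NormedAddCommGroup E]
    [InnerProductSpace ℂ E] {a b : E →L[ℂ] E} (hi : Function.Injective a) {x y : E}
    (hxy : (x, y) ∈ (fractionPMap a b).graph) :
    ∃ h : x ∈ (fractionPMap a b).domain, fractionPMap a b ⟨x, h⟩ = y := by
  obtain ⟨p, rfl, rfl⟩ := (mem_graph_fractionPMap hi).1 hxy
  exact ⟨mem_domain_fractionPMap hi p, fractionPMap_apply hi p _⟩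

/-- The unitary V of `exists_cos_sin` moves the parameter space of the graph onto H, where the
intertwining relations become relations between c and s. -/
theorem exists_cos_sin_intertwining_of_graph {G : Type*} [NormedAddCommGroup G]
    [InnerProductSpace ℂ G] [CompleteSpace G] {M : Type*} [NormedAddCommGroup M]
    [InnerProductSpace ℂ M] {E : Type*} [NormedAddCommGroup E] [InnerProductSpace ℂ E]
    {τ : DTSystem M E H} {τ' : DTSystem M E K}
    {P : G →L[ℂ] H} {Q : G →L[ℂ] K} (hP : Function.Injective P) (hQ : Function.Injective Q)
    (hPd : DenseRange P) (hQd : DenseRange Q) (hPQ : ∀ g, ‖P g‖ ^ 2 + ‖Q g‖ ^ 2 = ‖g‖ ^ 2)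
    (hA : ∀ x, ∃ y, P y = τ.A (P x) ∧ Q y = τ'.A (Q x))
    (hB : ∀ a, ∃ y, P y = τ.B a ∧ Q y = τ'.B a) (hC : ∀ x, τ.C (P x) = τ'.C (Q x)) :
    ∃ (c s : H →L[ℂ] H) (U : H ≃ₗᵢ[ℂ] K), 0 ≤ c ∧ 0 ≤ s ∧ Commute c s ∧ c * c + s * s = 1 ∧
      Function.Injective c ∧ Function.Injective s ∧
      (∀ z, ∃ z', c z' = τ.A (c z) ∧ U (s z') = τ'.A (U (s z))) ∧
      (∀ a, ∃ z', c z' = τ.B a ∧ U (s z') = τ'.B a) ∧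
      ∀ z, τ.C (c z) = τ'.C (U (s z)) := by
  obtain ⟨c, s, V, U, hc, hs, hcs, hsum, hci, hsi, hPV, hQV⟩ := exists_cos_sin hP hQ hPd hQd hPQ
  refine ⟨c, s, U, hc, hs, hcs, hsum, hci, hsi, fun z => ?_, fun a => ?_, fun z => ?_⟩
  · obtain ⟨y, h1, h2⟩ := hA (V z)
    obtain ⟨z', rfl⟩ := V.surjective y
    exact ⟨z', by rw [← hPV, h1, hPV], by rw [← hQV, h2, hQV]⟩
  · obtain ⟨y, h1, h2⟩ := hB a
    obtain ⟨z', rfl⟩ := V.surjective y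
    exact ⟨z', by rw [← hPV, h1], by rw [← hQV, h2]⟩
  · rw [← hPV, ← hQV, hC]

/-- The closure of the operator intertwining two minimal systems with equal impulse responses is
`c z ↦ U (s z)` with commuting positive `c`, `s` such that `c² + s² = 1`. -/
theorem exists_cos_sin_intertwining {τ : DTSystem N N H} {τ' : DTSystem N N K}
    (hτ : τ.IsMinimal) (hτ' : τ'.IsMinimal) (h : τ.impulseResponse = τ'.impulseResponse) :
    ∃ (c s : H →L[ℂ] H) (U : H ≃ₗᵢ[ℂ] K), 0 ≤ c ∧ 0 ≤ s ∧ Commute c s ∧ c * c + s * s = 1 ∧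
      Function.Injective c ∧ Function.Injective s ∧
      (∀ z, ∃ z', c z' = τ.A (c z) ∧ U (s z') = τ'.A (U (s z))) ∧
      (∀ a, ∃ z', c z' = τ.B a ∧ U (s z') = τ'.B a) ∧
      ∀ z, τ.C (c z) = τ'.C (U (s z)) :=
  exists_cos_sin_intertwining_of_graph (P := reachFst τ τ') (Q := reachSnd τ τ')
    (reachFst_injective h hτ') (reachSnd_injective h hτ) (denseRange_reachFst hτ.1)
    (denseRange_reachSnd hτ'.1) (norm_reachFst_sq_add τ τ') (exists_reachFst_eq_A τ τ')
    (exists_reachFst_eq_B τ τ') (C_reachFst h)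

/-- For a minimal system having the same impulse response as a minimal pqs-system, the operator
intertwining the two has the form `U R` with `U` unitary and `R` positive selfadjoint. -/
theorem exists_positive_intertwining {τ : DTSystem N N H} {τ' : DTSystem N N K}
    (hτ : τ.IsMinimal) (hτ' : τ'.IsMinimal) (hpqs : τ'.IsPqs)
    (h : τ.impulseResponse = τ'.impulseResponse) :
    ∃ (S R : H →ₗ.[ℂ] H) (U : H ≃ₗᵢ[ℂ] K), IsPositiveSelfAdjoint S ∧ IsPositiveSqrt R S ∧
      (∀ x : S.domain, ∃ h : τ.A x ∈ S.domain,
        S ⟨τ.A x, h⟩ = ContinuousLinearMap.adjoint τ.A (S x)) ∧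
      (∀ a : N, ∃ h : τ.B a ∈ S.domain,
        S ⟨τ.B a, h⟩ = ContinuousLinearMap.adjoint τ.C a) ∧
      DenseRange R ∧ (∀ x : R.domain, τ.C x = τ'.C (U (R x))) ∧
      (∀ a : N, ∃ h : τ.B a ∈ R.domain, R ⟨τ.B a, h⟩ = U.symm (τ'.B a)) ∧
      (∀ x : R.domain, ∃ h : τ.A x ∈ R.domain,
        R ⟨τ.A x, h⟩ = U.symm (τ'.A (U (R x)))) := by
  obtain ⟨hpass, hA', hC'⟩ := τ'.isPqs_iff.1 hpqs
  obtain ⟨c, s, U, hc, hs, hcs, hsum, hci, hsi, hUA, hUB, hUC⟩ :=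
    exists_cos_sin_intertwining hτ hτ' h
  have hcci : Function.Injective ⇑(c * c) := hci.comp hci
  have hgraph' : ∀ m z', inner ℂ (s (c m)) (s z') = inner ℂ ((s * s) m) (c z') := by
    intro m z'
    have hcs' : ∀ z, c (s z) = s (c z) := fun z => congrArg (fun T : H →L[ℂ] H => T z) hcs.eq
    rw [mul_apply_eq_comp, ← inner_apply_of_nonneg hs, ← inner_apply_of_nonneg hc, hcs', hcs']
  obtain ⟨hS, hR⟩ := isPositiveSqrt_fractionPMap hc hs hcs hsum hci hsi
  refine ⟨fractionPMap (c * c) (s * s), fractionPMap c s, U, hS, hR, fun x => ?_,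
    fun a => ?_, ?_, fun x => ?_, fun a => ?_, fun x => ?_⟩
  · obtain ⟨m, h1, h2⟩ := exists_of_mem_domain_fractionPMap hcci x
    obtain ⟨z', h3, h4⟩ := hUA (c m)
    refine exists_of_mem_graph_fractionPMap hcci ?_
    rw [h1, h2, mul_apply_eq_comp, ← h3]
    refine mem_graph_fractionPMap_of_inner hc hs hsum hci fun z'' => ?_
    -- With Z sending cz to U(sz) and A' the selfadjoint main operator of τ', this is the chain
    -- ⟨ZAx, Zf⟩ = ⟨A'Zx, Zf⟩ = ⟨Zx, A'Zf⟩ = ⟨Zx, ZAf⟩ = ⟨Sx, Af⟩.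
    obtain ⟨z₃, h5, h6⟩ := hUA z''
    rw [← U.inner_map_map, h4, ← hA', ContinuousLinearMap.adjoint_inner_left, ← h6,
      U.inner_map_map, hgraph', h5, ContinuousLinearMap.adjoint_inner_left]
  · obtain ⟨z, h1, h2⟩ := hUB a
    refine exists_of_mem_graph_fractionPMap hcci ?_
    rw [← h1]
    refine mem_graph_fractionPMap_of_inner hc hs hsum hci fun z' => ?_
    rw [← U.inner_map_map, h2, ← hC', ContinuousLinearMap.adjoint_inner_left, ← hUC,
      ContinuousLinearMap.adjoint_inner_left]
  · refine (denseRange_of_isSelfAdjoint_of_injective (IsSelfAdjoint.of_nonneg hs) hsi).mono ?_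
    rintro _ ⟨z, rfl⟩
    exact ⟨⟨c z, mem_domain_fractionPMap hci z⟩, fractionPMap_apply hci z _⟩
  · obtain ⟨z, h1, h2⟩ := exists_of_mem_domain_fractionPMap hci x
    rw [h1, h2, hUC]
  · obtain ⟨z, h1, h2⟩ := hUB a
    exact exists_of_mem_graph_fractionPMap hci ((mem_graph_fractionPMap hci).2
      ⟨z, h1.symm, by rw [← h2, U.symm_apply_apply]⟩)
  · obtain ⟨z, h1, h2⟩ := exists_of_mem_domain_fractionPMap hci x
    obtain ⟨z', h3, h4⟩ := hUA z
    exact exists_of_mem_graph_fractionPMap hci ((mem_graph_fractionPMap hci).2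
      ⟨z', by rw [h1, h3], by rw [h2, ← h4, U.symm_apply_apply]⟩)

/-- A minimal system having the same impulse response as a minimal pqs-system becomes unitarily
similar to the latter after renormalization by a positive selfadjoint operator. -/
theorem exists_renormalization {τ : DTSystem N N H} {τ' : DTSystem N N K} (hτ : τ.IsMinimal)
    (hτ' : τ'.IsMinimal) (hpqs : τ'.IsPqs) (h : τ.impulseResponse = τ'.impulseResponse) :
    ∃ S R : H →ₗ.[ℂ] H, IsPositiveSelfAdjoint S ∧ IsPositiveSqrt R S ∧
      (∀ x : S.domain, ∃ h : τ.A x ∈ S.domain,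
        S ⟨τ.A x, h⟩ = ContinuousLinearMap.adjoint τ.A (S x)) ∧
      (∀ a : N, ∃ h : τ.B a ∈ S.domain,
        S ⟨τ.B a, h⟩ = ContinuousLinearMap.adjoint τ.C a) ∧
      (∃ σ : DTSystem N N H,
        τ'.UnitarilySimilar σ ∧
        (∀ y : R.inverse.domain, σ.C y = τ.C (R.inverse y)) ∧
        (∀ a : N, ∃ h : τ.B a ∈ R.domain, σ.B a = R ⟨τ.B a, h⟩) ∧
        (∀ y : R.inverse.domain, ∃ h : τ.A (R.inverse y) ∈ R.domain,
          σ.A y = R ⟨τ.A (R.inverse y), h⟩)) ∧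
      (∃ ρ : DTSystem N N (Renormed.Compl R),
        τ'.UnitarilySimilar ρ ∧
        (∀ x : R.domain, ρ.C (Renormed.toCompl R x) = τ.C x) ∧
        (∀ a : N, ∃ h : τ.B a ∈ R.domain, ρ.B a = Renormed.toCompl R ⟨τ.B a, h⟩) ∧
        (∀ x : R.domain, ∃ h : τ.A x ∈ R.domain,
          ρ.A (Renormed.toCompl R x) = Renormed.toCompl R ⟨τ.A x, h⟩)) := by
  obtain ⟨S, R, U, hS, hR, hSA, hSB, hRd, hC, hB, hA⟩ :=
    exists_positive_intertwining hτ hτ' hpqs h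
  obtain ⟨J, hJ⟩ := exists_compl_equiv R hRd
  -- Both systems are copies of τ': on H through the inverse of U, and on the completion through the
  -- identification J, which extends R. Boundedness of the extensions is then automatic.
  refine ⟨S, R, hS, hR, hSA, hSB, ⟨τ'.transport U.symm, τ'.unitarilySimilar_transport _,
    fun y => ?_, fun a => ?_, fun y => ?_⟩, ⟨τ'.transport (U.symm.trans J.symm),
    τ'.unitarilySimilar_transport _, fun x => ?_, fun a => ?_, fun x => ?_⟩⟩
  · obtain ⟨x, h1, h2⟩ := exists_of_mem_domain_inverse hR.1 y
    rw [h2, hC, h1]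
    rfl
  · exact ⟨(hB a).1, (hB a).2.symm⟩
  · obtain ⟨x, h1, h2⟩ := exists_of_mem_domain_inverse hR.1 y
    obtain ⟨h3, h4⟩ := hA x
    rw [h1] at h4
    exact ⟨by rw [h2]; exact h3, by simp only [h2]; exact h4.symm⟩
  · change τ'.C (U (J (Renormed.toCompl R x))) = _
    rw [hJ, hC]
  · obtain ⟨h1, h2⟩ := hB a
    refine ⟨h1, ?_⟩
    change J.symm (U.symm (τ'.B a)) = _
    rw [LinearIsometryEquiv.symm_apply_eq, hJ, h2]
  · obtain ⟨h1, h2⟩ := hA x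
    refine ⟨h1, ?_⟩
    change J.symm (U.symm (τ'.A (U (J (Renormed.toCompl R x))))) = _
    rw [LinearIsometryEquiv.symm_apply_eq, hJ, hJ, h2]

end renormalization

end DTSystem

/-! ### Vanishing of bounded power series with zero radial limits -/

section boundary

/-- This is (I-T*T)² ≤ I-T*T in quadratic-form terms: the vector (I-T*T)x is controlled by the
energy lost under T. -/
theorem norm_defect_sq_le {E F : Type*} [NormedAddCommGroup E] [InnerProductSpace ℂ E]
    [CompleteSpace E] [NormedAddCommGroup F] [InnerProductSpace ℂ F] [CompleteSpace F]
    {T : E →L[ℂ] F} (hT : ‖T‖ ≤ 1) (x : E) :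
    ‖x - ContinuousLinearMap.adjoint T (T x)‖ ^ 2 ≤ ‖x‖ ^ 2 - ‖T x‖ ^ 2 := by
  have h1 : ‖ContinuousLinearMap.adjoint T (T x)‖ ≤ ‖T x‖ := by
    refine (ContinuousLinearMap.le_opNorm _ _).trans ?_
    rw [LinearIsometryEquiv.norm_map]
    exact mul_le_of_le_one_left (norm_nonneg _) hT
  have h2 : RCLike.re (inner ℂ x (ContinuousLinearMap.adjoint T (T x))) = ‖T x‖ ^ 2 := by
    rw [ContinuousLinearMap.adjoint_inner_right, inner_self_eq_norm_sq]
  rw [norm_sub_sq (𝕜 := ℂ), h2]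
  nlinarith [norm_nonneg (ContinuousLinearMap.adjoint T (T x))]

/-- A bounded vector-valued power series with vanishing radial limits almost everywhere is zero. -/
theorem eq_zero_of_radial_limit_zero {F : Type*} [NormedAddCommGroup F] [NormedSpace ℂ F]
    [CompleteSpace F] {c : ℕ → F} {g : ℂ → F} {R : ℝ}
    (hg : ∀ z : ℂ, ‖z‖ < 1 → HasSum (fun n => z ^ n • c n) (g z))
    (hR : ∀ z : ℂ, ‖z‖ < 1 → ‖g z‖ ≤ R)
    (hlim : ∀ᵐ t : ℝ, Tendsto (fun r : ℝ => g (Complex.exp (t * Complex.I) * r)) (𝓝[<] 1) (𝓝 0)) :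
    c = 0 := by
  have hnorm : ∀ r : ℝ, 0 ≤ r → ∀ t : ℝ, ‖(r * Complex.exp (t * Complex.I) : ℂ)‖ = r := by
    intro r h0 t
    rw [norm_mul, Complex.norm_exp_ofReal_mul_I, mul_one, Complex.norm_of_nonneg h0]
  have hmem : ∀ᶠ r : ℝ in 𝓝[<] 1, 0 ≤ r ∧ r < 1 := by
    filter_upwards [Ico_mem_nhdsLT (zero_lt_one' ℝ)] with r hr using hr
  -- Multiplication by z gives a zero constant term, as the sine moments require; the original
  -- coefficient of index k is read off at k + 1.
  set c' : ℕ → F := fun n => Nat.casesOn n 0 c with hc'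
  have hg' : ∀ z ∈ Metric.ball (0 : ℂ) 1, HasSum (fun n => z ^ n • c' n) (z • g z) := by
    intro z hz
    refine (hasSum_nat_add_iff' 1).1 ?_
    convert! (hg z (mem_ball_zero_iff.1 hz)).const_smul z using 1
    · funext n
      simp only [hc', pow_succ', smul_smul]
    · simp [hc']
  funext k
  have h1 := tendsto_integral_cos_pow_sin (v := c') (V := fun z => z • g z) rfl hg' 0 (k + 1)
  have h2 : Tendsto (fun r : ℝ => ∫ t in (0 : ℝ)..2 * Real.pi,
      ((Real.cos t ^ 0 * Real.sin ((k + 1 : ℕ) * t) : ℝ) : ℂ) •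
        ((r * Complex.exp (t * Complex.I) : ℂ) • g (r * Complex.exp (t * Complex.I))))
      (𝓝[<] 1) (𝓝 (∫ _ in (0 : ℝ)..2 * Real.pi, (0 : F))) := by
    refine intervalIntegral.tendsto_integral_filter_of_dominated_convergence (fun _ => R) ?_ ?_
      intervalIntegrable_const ?_
    · filter_upwards [hmem] with r hr
      have hs : Summable fun n => r ^ n * ‖c' n‖ := by
        have h2 : ‖(((1 + r) / 2 : ℝ) : ℂ)‖ = (1 + r) / 2 :=
          Complex.norm_of_nonneg (by linarith)
        refine summable_norm_mul_pow_of_hasSum (hg' (((1 + r) / 2 : ℝ) : ℂ) ?_) hr.1 ?_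
        · rw [mem_ball_zero_iff, h2]; linarith
        · rw [h2]; linarith
      refine ((Complex.continuous_ofReal.comp (by fun_prop)).smul
        (continuous_circle_of_hasSum (V := fun z => z • g z) hr.1 hs
          fun t => hg' _ ?_)).aestronglyMeasurable
      rw [mem_ball_zero_iff, hnorm r hr.1]
      exact hr.2
    · filter_upwards [hmem] with r hr
      refine Eventually.of_forall fun t _ => ?_
      have h3 := hR _ ((hnorm r hr.1 t).trans_lt hr.2)
      rw [norm_smul, norm_smul, hnorm r hr.1, Complex.norm_real, pow_zero, one_mul]
      have h4 := Real.abs_sin_le_one ((k + 1 : ℕ) * t)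
      calc _ ≤ 1 * (1 * R) := mul_le_mul h4 (mul_le_mul hr.2.le h3 (norm_nonneg _) zero_le_one)
              (mul_nonneg hr.1 (norm_nonneg _)) zero_le_one
        _ = R := by ring
    · filter_upwards [hlim] with t ht _
      have h3 : Tendsto (fun r : ℝ => ((Real.cos t ^ 0 * Real.sin ((k + 1 : ℕ) * t) : ℝ) : ℂ) *
          (r * Complex.exp (t * Complex.I) : ℂ)) (𝓝[<] 1) (𝓝
            (((Real.cos t ^ 0 * Real.sin ((k + 1 : ℕ) * t) : ℝ) : ℂ) *
              ((1 : ℝ) * Complex.exp (t * Complex.I) : ℂ))) :=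
        Tendsto.mono_left (Continuous.tendsto (by fun_prop) 1) nhdsWithin_le_nhds
      have h4 := h3.smul ht
      rw [smul_zero] at h4
      refine h4.congr fun r => ?_
      rw [smul_smul, mul_comm (Complex.exp _)]
  rw [intervalIntegral.integral_zero] at h2
  have h3 := tendsto_nhds_unique h1 h2
  rcases smul_eq_zero.1 h3 with h4 | h4
  · simp [Real.pi_ne_zero] at h4
  · exact h4

theorem norm_exp_mul_ofReal_lt_one {r : ℝ} (hr : r ∈ Set.Ico (0 : ℝ) 1) (t : ℝ) :
    ‖Complex.exp (t * Complex.I) * r‖ < 1 := by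
  rw [norm_mul, Complex.norm_exp_ofReal_mul_I, one_mul, Complex.norm_of_nonneg hr.1]
  exact hr.2

end boundary

/-! ### Energy balance and isometric realizations -/

namespace DTSystem

section energy

variable {M : Type*} {N : Type*} {H : Type*}
  [NormedAddCommGroup M] [InnerProductSpace ℂ M]
  [NormedAddCommGroup N] [InnerProductSpace ℂ N]
  [NormedAddCommGroup H] [InnerProductSpace ℂ H] [CompleteSpace H]

theorem IsPassive.apply_inverse {τ : DTSystem M N H} (h : τ.IsPassive) {z : ℂ} (hz : ‖z‖ < 1)
    (x : H) : x + τ.A (z • Ring.inverse (1 - z • τ.A) x) = Ring.inverse (1 - z • τ.A) x := by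
  have hu : IsUnit (1 - z • τ.A) := by
    refine isUnit_one_sub_of_norm_lt_one ?_
    rw [norm_smul]
    nlinarith [h.norm_A_le, norm_nonneg z, norm_nonneg τ.A]
  have h1 := congrArg (fun T : H →L[ℂ] H => T x) (Ring.mul_inverse_cancel _ hu)
  simp only [mul_apply_eq_comp, sub_apply, smul_apply, one_apply_eq_self] at h1
  rw [map_smul]
  exact (sub_eq_iff_eq_add.1 h1).symm

/-- The energy balance on the unit disk. -/
theorem IsPassive.norm_sq_sub_le {τ : DTSystem M N H} (h : τ.IsPassive) {z : ℂ} (hz : ‖z‖ < 1)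
    (a : M) :
    ‖WithLp.toLp 2 (a, z • Ring.inverse (1 - z • τ.A) (τ.B a))‖ ^ 2 -
      ‖τ.blockOp (WithLp.toLp 2 (a, z • Ring.inverse (1 - z • τ.A) (τ.B a)))‖ ^ 2 ≤
      ‖a‖ ^ 2 - ‖τ.transferFunction z a‖ ^ 2 := by
  have h1 : τ.blockOp (WithLp.toLp 2 (a, z • Ring.inverse (1 - z • τ.A) (τ.B a))) =
      WithLp.toLp 2 (τ.D a + τ.C (z • Ring.inverse (1 - z • τ.A) (τ.B a)),
        τ.B a + τ.A (z • Ring.inverse (1 - z • τ.A) (τ.B a))) := rfl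
  have h2 : τ.transferFunction z a = τ.D a + τ.C (z • Ring.inverse (1 - z • τ.A) (τ.B a)) := by
    simp [transferFunction]
  rw [h1, h.apply_inverse hz, ← h2, WithLp.prod_norm_sq_eq_of_L2, WithLp.prod_norm_sq_eq_of_L2]
  simp only [WithLp.toLp_fst, WithLp.toLp_snd, norm_smul]
  have : (‖z‖ * ‖Ring.inverse (1 - z • τ.A) (τ.B a)‖) ^ 2 ≤
      ‖Ring.inverse (1 - z • τ.A) (τ.B a)‖ ^ 2 :=
    pow_le_pow_left₀ (by positivity) (mul_le_of_le_one_left (norm_nonneg _) hz.le) 2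
  linarith

/-- For each a the transfer function applied to a is bounded by ‖a‖ and, by the hypothesis on Θ,
tends radially to zero almost everywhere. -/
theorem impulseResponse_eq_zero_of_norm_sq_le {E : Type*} [NormedAddCommGroup E]
    [InnerProductSpace ℂ E] [CompleteSpace E] {σ : DTSystem M E H} (hσ : ‖σ.A‖ ≤ 1)
    {Θ : ℂ → M →L[ℂ] N}
    (hle : ∀ z : ℂ, ‖z‖ < 1 → ∀ a, ‖σ.transferFunction z a‖ ^ 2 ≤ ‖a‖ ^ 2 - ‖Θ z a‖ ^ 2)
    (hlim : ∀ᵐ t : ℝ, ∀ a, Tendsto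
      (fun r : ℝ => ‖Θ (Complex.exp (t * Complex.I) * r) a‖) (𝓝[<] 1) (𝓝 ‖a‖)) (n : ℕ) :
    σ.impulseResponse n = 0 := by
  ext1 a
  refine congrFun (eq_zero_of_radial_limit_zero (c := fun n => σ.impulseResponse n a)
    (g := fun z => σ.transferFunction z a) (R := ‖a‖) (fun z hz => ?_) (fun z hz => ?_) ?_) n
  · refine (ContinuousLinearMap.apply ℂ _ a).hasSum (σ.hasSum_transferFunction ?_)
    rw [norm_smul]
    nlinarith [norm_nonneg z, norm_nonneg σ.A]
  · refine le_of_sq_le_sq ((hle z hz a).trans ?_) (norm_nonneg _)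
    linarith [sq_nonneg ‖Θ z a‖]
  · filter_upwards [hlim] with t ht
    have h1 := ((ht a).pow 2).const_sub (‖a‖ ^ 2)
    rw [sub_self] at h1
    have h2 : Tendsto (fun r : ℝ =>
        ‖σ.transferFunction (Complex.exp (t * Complex.I) * r) a‖ ^ 2) (𝓝[<] 1) (𝓝 0) := by
      refine squeeze_zero' (Eventually.of_forall fun _ => sq_nonneg _) ?_ h1
      filter_upwards [Ico_mem_nhdsLT (zero_lt_one' ℝ)] with r hr
      exact hle _ (norm_exp_mul_ofReal_lt_one hr t) a
    have h3 := h2.sqrt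
    simp only [Real.sqrt_sq (norm_nonneg _), Real.sqrt_zero] at h3
    exact tendsto_zero_iff_norm_tendsto_zero.2 h3

variable [CompleteSpace M] [CompleteSpace N]

/-- A controllable passive system is isometric, if its transfer function has isometric radial
boundary values. -/
theorem IsPassive.isIsometric {τ : DTSystem M N H} (h : τ.IsPassive) (hc : τ.IsControllable)
    (hlim : ∀ᵐ t : ℝ, ∀ a, Tendsto
      (fun r : ℝ => ‖τ.transferFunction (Complex.exp (t * Complex.I) * r) a‖) (𝓝[<] 1)
      (𝓝 ‖a‖)) : τ.IsIsometric := by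
  let Q : WithLp 2 (M × H) →L[ℂ] WithLp 2 (M × H) :=
    1 - ContinuousLinearMap.adjoint τ.blockOp ∘L τ.blockOp
  let e := (WithLp.prodContinuousLinearEquiv 2 ℂ M H).symm.toContinuousLinearMap
  -- This auxiliary system has the same states but the output Q of the pair (input, state). Its
  -- transfer function sends a to Q(a, z(I-zA)⁻¹Ba), which the energy balance estimates.
  let σ : DTSystem M (WithLp 2 (M × H)) H :=
    ⟨τ.A, τ.B, Q ∘L e ∘L ContinuousLinearMap.inr ℂ M H, Q ∘L e ∘L ContinuousLinearMap.inl ℂ M H⟩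
  have hσ : ∀ z a, σ.transferFunction z a =
      Q (WithLp.toLp 2 (a, z • Ring.inverse (1 - z • τ.A) (τ.B a))) := by
    intro z a
    have h1 : σ.transferFunction z a = Q (e (a, 0)) +
        z • Q (e (0, Ring.inverse (1 - z • τ.A) (τ.B a))) := rfl
    rw [h1, ← map_smul, ← map_add, ← map_smul, ← map_add]
    simp [e]
  have hle : ∀ z : ℂ, ‖z‖ < 1 → ∀ a, ‖σ.transferFunction z a‖ ^ 2 ≤
      ‖a‖ ^ 2 - ‖τ.transferFunction z a‖ ^ 2 := by
    intro z hz a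
    rw [hσ]
    exact (norm_defect_sq_le h _).trans (h.norm_sq_sub_le hz a)
  have hzero := impulseResponse_eq_zero_of_norm_sq_le (σ := σ) h.norm_A_le hle hlim
  have hQ1 : ∀ a, Q (WithLp.toLp 2 (a, 0)) = 0 := fun a =>
    congrArg (fun T : M →L[ℂ] WithLp 2 (M × H) => T a) (hzero 0)
  -- The higher coefficients say that Q kills (0, AⁿBa), and controllability makes these vectors
  -- dense in the state component.
  have hQ2 : ∀ x, Q (WithLp.toLp 2 (0, x)) = 0 := by
    intro x
    have hd := (isControllable_iff τ).1 hc
    refine hd.induction_on x (isClosed_eq (Q ∘L e ∘L ContinuousLinearMap.inr ℂ M H).continuous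
      continuous_const) fun f => ?_
    change (Q ∘L e ∘L ContinuousLinearMap.inr ℂ M H) (τ.reach f) = 0
    induction f using Finsupp.induction_linear with
    | zero => rw [map_zero, map_zero]
    | add f g hf hg => rw [map_add, map_add, hf, hg, add_zero]
    | single n a =>
      rw [reach_single]
      exact congrArg (fun T : M →L[ℂ] WithLp 2 (M × H) => T a) (hzero (n + 1))
  have hQ : ∀ v, Q v = 0 := by
    intro v
    have : v = WithLp.toLp 2 (v.fst, 0) + WithLp.toLp 2 (0, v.snd) := by
      rw [← WithLp.toLp_add, Prod.mk_add_mk, add_zero, zero_add]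
      rfl
    rw [this, map_add, hQ1, hQ2, add_zero]
  refine AddMonoidHomClass.isometry_of_norm _ fun v => ?_
  have h1 : ContinuousLinearMap.adjoint τ.blockOp (τ.blockOp v) = v :=
    (sub_eq_zero.1 (hQ v)).symm
  have h2 : inner ℂ (τ.blockOp v) (τ.blockOp v) = inner ℂ v v := by
    rw [← ContinuousLinearMap.adjoint_inner_left, h1]
  rw [@norm_eq_sqrt_re_inner ℂ, h2, ← norm_eq_sqrt_re_inner]

end energy

/-! ### Unitary similarity of controllable isometric systems -/

section uniqueness

variable {M : Type*} {N : Type*} {H₁ : Type*} {H₂ : Type*}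
  [NormedAddCommGroup M] [InnerProductSpace ℂ M]
  [NormedAddCommGroup N] [InnerProductSpace ℂ N]
  [NormedAddCommGroup H₁] [InnerProductSpace ℂ H₁]
  [NormedAddCommGroup H₂] [InnerProductSpace ℂ H₂]

theorem IsIsometric.inner_add_inner {τ : DTSystem M N H₁} (h : τ.IsIsometric) (a b : M)
    (x y : H₁) : inner ℂ (τ.D a + τ.C x) (τ.D b + τ.C y) +
      inner ℂ (τ.B a + τ.A x) (τ.B b + τ.A y) = inner ℂ a b + inner ℂ x y :=
  LinearIsometry.inner_map_map (𝕜 := ℂ)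
    ⟨τ.blockOp.toLinearMap, (AddMonoidHomClass.isometry_iff_norm _).1 h⟩
    (WithLp.toLp 2 (a, x)) (WithLp.toLp 2 (b, y))

/-- The Gram matrix of the vectors `Aᵐ B a` of an isometric system is determined by its impulse
response. -/
theorem IsIsometric.inner_pow_eq {τ₁ : DTSystem M N H₁} {τ₂ : DTSystem M N H₂}
    (h₁ : τ₁.IsIsometric) (h₂ : τ₂.IsIsometric) (h : τ₁.impulseResponse = τ₂.impulseResponse)
    (a b : M) (m n : ℕ) :
    inner ℂ ((τ₁.A ^ m) (τ₁.B a)) ((τ₁.A ^ n) (τ₁.B b)) =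
      inner ℂ ((τ₂.A ^ m) (τ₂.B a)) ((τ₂.A ^ n) (τ₂.B b)) := by
  have hD : ∀ a, τ₁.D a = τ₂.D a := fun a =>
    congrArg (fun T : M →L[ℂ] N => T a) (congrFun h 0)
  have hC : ∀ n a, τ₁.C ((τ₁.A ^ n) (τ₁.B a)) = τ₂.C ((τ₂.A ^ n) (τ₂.B a)) := fun n a =>
    congrArg (fun T : M →L[ℂ] N => T a) (congrFun h (n + 1))
  -- The isometry identity reduces (m+1, n+1) to (m, n). When m or n is zero it expresses the entry
  -- by inner products of inputs and of the values of D and CAʲB.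
  induction m generalizing n with
  | zero =>
    cases n with
    | zero =>
      have h3 := h₁.inner_add_inner a b 0 0
      have h4 := h₂.inner_add_inner a b 0 0
      simp only [map_zero, add_zero, hD, inner_zero_right] at h3 h4
      simpa using add_left_cancel (h3.trans h4.symm)
    | succ n =>
      have h3 := h₁.inner_add_inner a 0 0 ((τ₁.A ^ n) (τ₁.B b))
      have h4 := h₂.inner_add_inner a 0 0 ((τ₂.A ^ n) (τ₂.B b))
      simp only [map_zero, add_zero, zero_add, hD, hC, inner_zero_left, inner_zero_right]
        at h3 h4
      simpa [pow_succ'] using add_left_cancel (h3.trans h4.symm)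
  | succ m ih =>
    cases n with
    | zero =>
      have h3 := h₁.inner_add_inner 0 b ((τ₁.A ^ m) (τ₁.B a)) 0
      have h4 := h₂.inner_add_inner 0 b ((τ₂.A ^ m) (τ₂.B a)) 0
      simp only [map_zero, add_zero, zero_add, hD, hC, inner_zero_left, inner_zero_right]
        at h3 h4
      simpa [pow_succ'] using add_left_cancel (h3.trans h4.symm)
    | succ n =>
      have h3 := h₁.inner_add_inner 0 0 ((τ₁.A ^ m) (τ₁.B a)) ((τ₁.A ^ n) (τ₁.B b))
      have h4 := h₂.inner_add_inner 0 0 ((τ₂.A ^ m) (τ₂.B a)) ((τ₂.A ^ n) (τ₂.B b))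
      rw [ih] at h3
      simp only [map_zero, zero_add, hC] at h3 h4
      simpa [pow_succ'] using add_left_cancel (h3.trans h4.symm)

theorem IsIsometric.norm_reach_eq {τ₁ : DTSystem M N H₁} {τ₂ : DTSystem M N H₂}
    (h₁ : τ₁.IsIsometric) (h₂ : τ₂.IsIsometric) (h : τ₁.impulseResponse = τ₂.impulseResponse)
    (f : ℕ →₀ M) : ‖τ₁.reach f‖ = ‖τ₂.reach f‖ := by
  have h3 : inner ℂ (τ₁.reach f) (τ₁.reach f) = inner ℂ (τ₂.reach f) (τ₂.reach f) := by
    simp only [reach, Finsupp.lsum_apply, Finsupp.sum, sum_inner, inner_sum]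
    refine Finset.sum_congr rfl fun n _ => Finset.sum_congr rfl fun m _ => ?_
    exact h₁.inner_pow_eq h₂ h _ _ _ _
  rw [@norm_eq_sqrt_re_inner ℂ, h3, ← norm_eq_sqrt_re_inner]

theorem IsIsometric.unitarilySimilar [CompleteSpace H₁] [CompleteSpace H₂]
    {τ₁ : DTSystem M N H₁} {τ₂ : DTSystem M N H₂} (h₁ : τ₁.IsIsometric) (h₂ : τ₂.IsIsometric)
    (hc₁ : τ₁.IsControllable) (hc₂ : τ₂.IsControllable)
    (h : τ₁.impulseResponse = τ₂.impulseResponse) : τ₁.UnitarilySimilar τ₂ := by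
  rw [isControllable_iff] at hc₁ hc₂
  obtain ⟨U, hU⟩ := exists_linearIsometryEquiv_of_norm_eq τ₁.reach τ₂.reach hc₁ hc₂
    (h₁.norm_reach_eq h₂ h)
  have hU' : ∀ f, U.symm (τ₂.reach f) = τ₁.reach f := fun f => by
    rw [← hU, U.symm_apply_apply]
  refine ⟨U, fun x => ?_, fun a => ?_, fun x => ?_, (congrFun h 0).symm⟩
  · refine hc₂.induction_on x (isClosed_eq (by fun_prop) (by fun_prop)) fun f => ?_
    rw [hU', ← reach_inputShift, ← reach_inputShift, hU]
  · have := hU (Finsupp.single 0 a)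
    simpa using this.symm
  · refine hc₂.induction_on x (isClosed_eq (by fun_prop) (by fun_prop)) fun f => ?_
    rw [hU']
    induction f using Finsupp.induction_linear with
    | zero => simp
    | add f g hf hg => simp [hf, hg]
    | single n a =>
      rw [reach_single, reach_single]
      exact congrArg (fun T : M →L[ℂ] N => T a) (congrFun h (n + 1)).symm

end uniqueness

/-! ### Inner and co-inner transfer functions -/

section innerFunctions

variable {N : Type*} {H : Type*}
  [NormedAddCommGroup N] [InnerProductSpace ℂ N] [CompleteSpace N]
  [NormedAddCommGroup H] [InnerProductSpace ℂ H] [CompleteSpace H]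

theorem IsPassive.norm_transferFunction_le {τ : DTSystem N N H} (h : τ.IsPassive) {z : ℂ}
    (hz : ‖z‖ < 1) (a : N) : ‖τ.transferFunction z a‖ ≤ ‖a‖ := by
  refine le_of_sq_le_sq ?_ (norm_nonneg _)
  have h1 := (norm_defect_sq_le h _).trans (h.norm_sq_sub_le hz a)
  linarith [sq_nonneg ‖WithLp.toLp 2 (a, z • Ring.inverse (1 - z • τ.A) (τ.B a)) -
    ContinuousLinearMap.adjoint τ.blockOp
      (τ.blockOp (WithLp.toLp 2 (a, z • Ring.inverse (1 - z • τ.A) (τ.B a))))‖]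

theorem IsPassive.isIsometric_of_isInnerFunction {τ : DTSystem N N H} (h : τ.IsPassive)
    (hc : τ.IsControllable) {Θ : ℂ → N →L[ℂ] N} (hΘ : IsInnerFunction Θ)
    (hτ : ∀ z ∈ Metric.ball (0 : ℂ) 1, τ.transferFunction z = Θ z) : τ.IsIsometric := by
  refine h.isIsometric hc ?_
  filter_upwards [hΘ] with t ⟨L, hL, hL1⟩ a
  have h1 : ‖L a‖ = ‖a‖ := by
    have : inner ℂ (L a) (L a) = inner ℂ a a := by
      rw [← ContinuousLinearMap.adjoint_inner_left]
      exact congrArg (fun T : N →L[ℂ] N => inner ℂ (T a) a) hL1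
    rw [@norm_eq_sqrt_re_inner ℂ, this, ← norm_eq_sqrt_re_inner]
  rw [← h1]
  refine (hL.tendsto_radial a).norm.congr' ?_
  filter_upwards [Ico_mem_nhdsLT (zero_lt_one' ℝ)] with r hr
  rw [hτ _ (mem_ball_zero_iff.2 (norm_exp_mul_ofReal_lt_one hr t))]

theorem IsPassive.dual_transferFunction {τ : DTSystem N N H} (h : τ.IsPassive) {z : ℂ}
    (hz : ‖z‖ < 1) : τ.dual.transferFunction (starRingEnd ℂ z) =
      ContinuousLinearMap.adjoint (τ.transferFunction z) := by
  have h2 := h.dual.hasSum_transferFunction (z := starRingEnd ℂ z) (by rwa [RCLike.norm_conj])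
  refine h2.unique ?_
  convert! (h.hasSum_transferFunction hz).map
    (ContinuousLinearMap.adjoint (𝕜 := ℂ) (E := N) (F := N)) (LinearIsometryEquiv.continuous _)
    using 1
  funext n
  simp [dual_impulseResponse, map_smulₛₗ]

/-- The dual system has transfer function Θ(z̄)*. Strong limits of Θ do not give strong limits of
the adjoints, but only the norms ‖Θ(z̄)*a‖ are needed: they are at most ‖a‖ by passivity, and
testing against L*a bounds them from below. -/
theorem IsPassive.dual_isIsometric_of_isCoinnerFunction {τ : DTSystem N N H} (h : τ.IsPassive)
    (hc : τ.dual.IsControllable) {Θ : ℂ → N →L[ℂ] N} (hΘ : IsCoinnerFunction Θ)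
    (hτ : ∀ z ∈ Metric.ball (0 : ℂ) 1, τ.transferFunction z = Θ z) : τ.dual.IsIsometric := by
  refine h.dual.isIsometric hc ?_
  -- Conjugation of the boundary point is t ↦ -t, which preserves null sets.
  have hneg := (Measure.measurePreserving_neg (volume : Measure ℝ)).quasiMeasurePreserving.ae hΘ
  filter_upwards [hneg] with t ⟨L, hL, hL1⟩ a
  have hLL : L (ContinuousLinearMap.adjoint L a) = a :=
    congrArg (fun T : N →L[ℂ] N => T a) hL1
  have hLa : ‖ContinuousLinearMap.adjoint L a‖ = ‖a‖ := by
    have : inner ℂ (ContinuousLinearMap.adjoint L a) (ContinuousLinearMap.adjoint L a) =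
        inner ℂ a a := by
      rw [ContinuousLinearMap.adjoint_inner_right, hLL]
    rw [@norm_eq_sqrt_re_inner ℂ, this, ← norm_eq_sqrt_re_inner]
  rcases eq_or_ne a 0 with rfl | ha
  · simp
  have ha' : 0 < ‖a‖ := norm_pos_iff.2 ha
  -- This lower bound tends to |⟨LL*a, a⟩|/‖a‖ = ‖a‖, because LL* = I.
  have h1 : Tendsto (fun r : ℝ => ‖inner ℂ (Θ (Complex.exp ((-t : ℝ) * Complex.I) * r)
      (ContinuousLinearMap.adjoint L a)) a‖ / ‖a‖) (𝓝[<] 1) (𝓝 ‖a‖) := by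
    have := (((hL.tendsto_radial (ContinuousLinearMap.adjoint L a)).inner (𝕜 := ℂ)
      (tendsto_const_nhds (x := a))).norm).div_const ‖a‖
    rw [hLL, inner_self_eq_norm_sq_to_K] at this
    convert! this using 2
    simp
    field_simp
  refine tendsto_of_tendsto_of_tendsto_of_le_of_le' h1 tendsto_const_nhds ?_ ?_
  · filter_upwards [Ico_mem_nhdsLT (zero_lt_one' ℝ)] with r hr
    have hz := norm_exp_mul_ofReal_lt_one hr (-t)
    have hconj : Complex.exp (t * Complex.I) * r =
        starRingEnd ℂ (Complex.exp ((-t : ℝ) * Complex.I) * r) := by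
      simp [← Complex.exp_conj]
    rw [div_le_iff₀ ha', hconj, h.dual_transferFunction hz, hτ _ (mem_ball_zero_iff.2 hz),
      ← ContinuousLinearMap.adjoint_inner_right]
    refine (norm_inner_le_norm _ _).trans_eq ?_
    rw [hLa, mul_comm]
  · filter_upwards [Ico_mem_nhdsLT (zero_lt_one' ℝ)] with r hr
    exact h.dual.norm_transferFunction_le (norm_exp_mul_ofReal_lt_one hr t) a

end innerFunctions

end DTSystem

namespace DTSystem

variable {M : Type*} {N : Type*} {H : Type*}
  [NormedAddCommGroup M] [InnerProductSpace ℂ M]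
  [NormedAddCommGroup N] [InnerProductSpace ℂ N]
  [NormedAddCommGroup H] [InnerProductSpace ℂ H] [CompleteSpace H]

theorem impulseResponse_eq_of_ball {H' : Type*} [NormedAddCommGroup H']
    [InnerProductSpace ℂ H'] [CompleteSpace H'] {τ : DTSystem M N H} {τ' : DTSystem M N H'}
    {Θ : ℂ → M →L[ℂ] N} (h : ∀ᶠ z in 𝓝 (0 : ℂ), τ.transferFunction z = Θ z)
    (h' : ∀ z ∈ Metric.ball (0 : ℂ) 1, τ'.transferFunction z = Θ z) :
    τ.impulseResponse = τ'.impulseResponse := by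
  refine impulseResponse_eq ?_
  filter_upwards [h, Metric.ball_mem_nhds (0 : ℂ) one_pos] with z h1 h2
  rw [h1, h' z h2]

theorem UnitarilySimilar.transferFunction_eq {H' : Type*} [NormedAddCommGroup H']
    [InnerProductSpace ℂ H'] [CompleteSpace H'] {τ : DTSystem M N H} {τ' : DTSystem M N H'}
    (h : τ.UnitarilySimilar τ') (hτ : τ.IsPassive) {z : ℂ} (hz : ‖z‖ < 1) :
    τ'.transferFunction z = τ.transferFunction z := by
  refine ((h.isPassive hτ).hasSum_transferFunction hz).unique ?_
  rw [h.impulseResponse_eq]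
  exact hτ.hasSum_transferFunction hz

theorem IsPassive.unitarilySimilar_of_isCoinnerFunction {N : Type*} {H₁ : Type*} {H₂ : Type*}
    [NormedAddCommGroup N] [InnerProductSpace ℂ N] [CompleteSpace N]
    [NormedAddCommGroup H₁] [InnerProductSpace ℂ H₁] [CompleteSpace H₁]
    [NormedAddCommGroup H₂] [InnerProductSpace ℂ H₂] [CompleteSpace H₂]
    {τ₁ : DTSystem N N H₁} {τ₂ : DTSystem N N H₂} (hp₁ : τ₁.IsPassive) (hp₂ : τ₂.IsPassive)
    (hτ₁ : τ₁.IsMinimal) (hτ₂ : τ₂.IsMinimal) {Θ : ℂ → N →L[ℂ] N} (hΘ : IsCoinnerFunction Θ)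
    (hΘ₁ : ∀ z ∈ Metric.ball (0 : ℂ) 1, τ₁.transferFunction z = Θ z)
    (hΘ₂ : ∀ z ∈ Metric.ball (0 : ℂ) 1, τ₂.transferFunction z = Θ z) :
    τ₁.UnitarilySimilar τ₂ := by
  have himp := impulseResponse_eq_of_ball
    (eventually_of_mem (Metric.ball_mem_nhds _ one_pos) hΘ₁) hΘ₂
  have h := (hp₁.dual_isIsometric_of_isCoinnerFunction hτ₁.2 hΘ hΘ₁).unitarilySimilar
    (hp₂.dual_isIsometric_of_isCoinnerFunction hτ₂.2 hΘ hΘ₂) hτ₁.2 hτ₂.2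
    (funext fun n => by rw [dual_impulseResponse, dual_impulseResponse, himp])
  simpa only [dual_dual] using h.dual

end DTSystem

end

theorem theorem5p1
    {N : Type u} [NormedAddCommGroup N] [InnerProductSpace ℂ N] [CompleteSpace N]
    (Θ : ℂ → N →L[ℂ] N) (hΘ : IsSqs Θ) :
    -- a minimal, not necessarily passive, system realizing `Θ` near zero
    (∀ (H : Type v) [NormedAddCommGroup H] [InnerProductSpace ℂ H] [CompleteSpace H]
      (τ : DTSystem N N H), τ.IsMinimal → (∀ᶠ z in 𝓝 (0 : ℂ), τ.transferFunction z = Θ z) →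
      -- `R` is the square root of `S`
      ∃ S R : H →ₗ.[ℂ] H, IsPositiveSelfAdjoint S ∧ IsPositiveSqrt R S ∧
        -- `A* S = S A` on `dom S`, and `C* = S B`
        (∀ x : S.domain, ∃ h : τ.A x ∈ S.domain,
          S ⟨τ.A x, h⟩ = ContinuousLinearMap.adjoint τ.A (S x)) ∧
        (∀ a : N, ∃ h : τ.B a ∈ S.domain,
          S ⟨τ.B a, h⟩ = ContinuousLinearMap.adjoint τ.C a) ∧
        -- the system with entries `D`, `C R⁻¹`, `R B`, `R A R⁻¹`
        (∃ σ : DTSystem N N H,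
          σ.D = τ.D ∧
          (∀ y : R.inverse.domain, σ.C y = τ.C (R.inverse y)) ∧
          (∀ a : N, ∃ h : τ.B a ∈ R.domain, σ.B a = R ⟨τ.B a, h⟩) ∧
          (∀ y : R.inverse.domain, ∃ h : τ.A (R.inverse y) ∈ R.domain,
            σ.A y = R ⟨τ.A (R.inverse y), h⟩) ∧
          σ.IsMinimal ∧ σ.IsPqs ∧
          ∀ z ∈ Metric.ball (0 : ℂ) 1, σ.transferFunction z = Θ z) ∧
        -- the given system itself, after renormalization of the state space
        (∃ ρ : DTSystem N N (Renormed.Compl R),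
          ρ.D = τ.D ∧
          (∀ x : R.domain, ρ.C (Renormed.toCompl R x) = τ.C x) ∧
          (∀ a : N, ∃ h : τ.B a ∈ R.domain, ρ.B a = Renormed.toCompl R ⟨τ.B a, h⟩) ∧
          (∀ x : R.domain, ∃ h : τ.A x ∈ R.domain,
            ρ.A (Renormed.toCompl R x) = Renormed.toCompl R ⟨τ.A x, h⟩) ∧
          ρ.IsPqs)) ∧
    (IsInnerFunction Θ →
      (∀ (H : Type v) [NormedAddCommGroup H] [InnerProductSpace ℂ H] [CompleteSpace H]
        (τ : DTSystem N N H), τ.IsMinimal → τ.IsPassive →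
        (∀ z ∈ Metric.ball (0 : ℂ) 1, τ.transferFunction z = Θ z) →
        τ.IsIsometric ∧ τ.IsPqs) ∧
      (∀ (H₁ : Type v) [NormedAddCommGroup H₁] [InnerProductSpace ℂ H₁] [CompleteSpace H₁]
        (H₂ : Type w) [NormedAddCommGroup H₂] [InnerProductSpace ℂ H₂] [CompleteSpace H₂]
        (τ₁ : DTSystem N N H₁) (τ₂ : DTSystem N N H₂),
        τ₁.IsMinimal → τ₁.IsPassive →
        (∀ z ∈ Metric.ball (0 : ℂ) 1, τ₁.transferFunction z = Θ z) →
        τ₂.IsMinimal → τ₂.IsPassive →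
        (∀ z ∈ Metric.ball (0 : ℂ) 1, τ₂.transferFunction z = Θ z) →
        τ₁.UnitarilySimilar τ₂)) ∧
    (IsCoinnerFunction Θ →
      (∀ (H : Type v) [NormedAddCommGroup H] [InnerProductSpace ℂ H] [CompleteSpace H]
        (τ : DTSystem N N H), τ.IsMinimal → τ.IsPassive →
        (∀ z ∈ Metric.ball (0 : ℂ) 1, τ.transferFunction z = Θ z) →
        τ.IsCoisometric ∧ τ.IsPqs) ∧
      (∀ (H₁ : Type v) [NormedAddCommGroup H₁] [InnerProductSpace ℂ H₁] [CompleteSpace H₁]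
        (H₂ : Type w) [NormedAddCommGroup H₂] [InnerProductSpace ℂ H₂] [CompleteSpace H₂]
        (τ₁ : DTSystem N N H₁) (τ₂ : DTSystem N N H₂),
        τ₁.IsMinimal → τ₁.IsPassive →
        (∀ z ∈ Metric.ball (0 : ℂ) 1, τ₁.transferFunction z = Θ z) →
        τ₂.IsMinimal → τ₂.IsPassive →
        (∀ z ∈ Metric.ball (0 : ℂ) 1, τ₂.transferFunction z = Θ z) →
        τ₁.UnitarilySimilar τ₂)) := by
  obtain ⟨K, _, _, _, σ₀, hmin₀, hpqs₀, hσ₀⟩ := hΘ.exists_minimal_pqs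
  have hball : Metric.ball (0 : ℂ) 1 ∈ 𝓝 (0 : ℂ) := Metric.ball_mem_nhds _ one_pos
  refine ⟨fun H _ _ _ τ hτ hτΘ => ?_, fun hin => ⟨fun H _ _ _ τ hτ hp hτΘ => ?_,
    fun H₁ _ _ _ H₂ _ _ _ τ₁ τ₂ hτ₁ hp₁ hΘ₁ hτ₂ hp₂ hΘ₂ => ?_⟩,
    fun hco => ⟨fun H _ _ _ τ hτ hp hτΘ => ?_,
    fun H₁ _ _ _ H₂ _ _ _ τ₁ τ₂ hτ₁ hp₁ hΘ₁ hτ₂ hp₂ hΘ₂ => ?_⟩⟩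
  · have himp := DTSystem.impulseResponse_eq_of_ball hτΘ hσ₀
    have hD : σ₀.D = τ.D := (congrFun himp 0).symm
    obtain ⟨S, R, hS, hR, hSA, hSB, ⟨σ, hsim, hσC, hσB, hσA⟩, ⟨ρ, hsim', hρC, hρB, hρA⟩⟩ :=
      DTSystem.exists_renormalization hτ hmin₀ hpqs₀ himp
    refine ⟨S, R, hS, hR, hSA, hSB, ⟨σ, ?_, hσC, hσB, hσA, hsim.isMinimal hmin₀,
      hsim.isPqs hpqs₀, fun z hz => ?_⟩, ⟨ρ, ?_, hρC, hρB, hρA, hsim'.isPqs hpqs₀⟩⟩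
    · exact (congrFun hsim.impulseResponse_eq 0).trans hD
    · rw [hsim.transferFunction_eq hpqs₀.1 (mem_ball_zero_iff.1 hz), hσ₀ z hz]
    · exact (congrFun hsim'.impulseResponse_eq 0).trans hD
  · have hiso := hp.isIsometric_of_isInnerFunction hτ.1 hin hτΘ
    have hiso₀ := hpqs₀.1.isIsometric_of_isInnerFunction hmin₀.1 hin hσ₀
    -- Selfadjointness of the main operator is not derived from τ itself; it is carried over from
    -- the model by unitary similarity.
    exact ⟨hiso, (hiso₀.unitarilySimilar hiso hmin₀.1 hτ.1
      (DTSystem.impulseResponse_eq_of_ball (eventually_of_mem hball hσ₀) hτΘ)).isPqs hpqs₀⟩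
  · exact (hp₁.isIsometric_of_isInnerFunction hτ₁.1 hin hΘ₁).unitarilySimilar
      (hp₂.isIsometric_of_isInnerFunction hτ₂.1 hin hΘ₂) hτ₁.1 hτ₂.1
      (DTSystem.impulseResponse_eq_of_ball (eventually_of_mem hball hΘ₁) hΘ₂)
  · exact ⟨τ.isCoisometric_iff.2 (hp.dual_isIsometric_of_isCoinnerFunction hτ.2 hco hτΘ),
      (hpqs₀.1.unitarilySimilar_of_isCoinnerFunction hp hmin₀ hτ hco hσ₀ hτΘ).isPqs hpqs₀⟩
  · exact hp₁.unitarilySimilar_of_isCoinnerFunction hp₂ hτ₁ hτ₂ hco hΘ₁ hΘ₂
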